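/- Let $\mathcal K$ be an algebraically closed field of characteristic zero. Varieties are integral separated schemes of finite type over $\mathcal K$, and "point" means closed point. An effective divisor on a nonsingular variety, identified with its support $E$, is SNC if at every point its ideal is generated by a monomial $v_1^{a_1}\cdots v_d^{a_d}$ in some regular system of parameters of the local ring. An irreducible closed subvariety $Z$ makes SNC with $E$ at $p$ if there is a regular system of parameters $v_1,\dots,v_d$ at $p$ such that $E$ is defined at $p$ by a monomial in the $v_j$ and, if $p\in Z$, the ideal of $Z$ at $p$ is generated by a subset of the $v_j$ (so $Z$ is nonsingular at $p$). If this holds at $q\in Z$, and exactly $\ell$ irreducible components of $E$ contain $q$ and exactly $\bar\ell$ contain $Z$, then $Z$ is called an $(\ell,\bar\ell)$-subvariety for $E$ at $q$. A closed subscheme is called an SNC subscheme if its ideal sheaf is locally monomial: at every point it is generated by finitely many monomials in a regular system of parameters. Let $U,V$ be nonsingular varieties, $E\subset V$ an SNC divisor and $\varphi:U\to V$ a dominant $\mathcal K$-morphism such that $D=\varphi^{-1}(E)$ (reduced) is an SNC divisor on $U$. Suppose that $\varphi:(U,D)\to(V,E)$ is toroidal: for every $p\in U$ with $q=\varphi(p)$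 there are nonsingular affine toric varieties $X_\sigma\ni p'$, $Y_\tau\ni q'$ over $\mathcal K$, isomorphisms of $\mathcal K$-algebras $\hat{\mathcal O}_{U,p}\cong\hat{\mathcal O}_{X_\sigma,p'}$ and $\hat{\mathcal O}_{V,q}\cong\hat{\mathcal O}_{Y_\tau,q'}$ that take the ideals of $D$ and $E$ to the ideals of the complements of the tori, and a toric morphism $\phi:X_\sigma\to Y_\tau$ with $\phi(p')=q'$ such that $\hat\varphi^*$ corresponds to $\hat\phi^*$. Let $Z\subset V$ be an irreducible closed subvariety such that at every point $q\in Z$ it is an $(\ell,\bar\ell)$-subvariety for $E$ for some $\ell,\bar\ell$ (with $\ell$ allowed to depend on $q$). Let $$W_Z(U)=\{p\in U \mid \mathcal I_Z\mathcal O_{U,p}\text{ is not principal}\}.$$ Then $W_Z(U)$ is an SNC subscheme of $U$: there are ideal sheaves $\mathcal F,\mathcal N\subset\mathcal O_U$ with $\mathcal I_Z\mathcal O_U=\mathcal F\,\mathcal N$, $\mathcal F$ locally principal, $\operatorname{Supp}(\mathcal O_U/\mathcal N)=W_Z(U)$, and $\mathcal N$ is locally monomial. Moreover every irreducible component $T$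 of $W_Z(U)$ makes SNC with $D$ at every point of $U$, and $$2\le\operatorname{codim}_U T\le\dim V.$$ -/

import Mathlib

open AlgebraicGeometry CategoryTheory TopologicalSpace IsLocalRing

universe u

namespace ToroidalNP

noncomputable section

/-! ### Nonsingular varieties, regular parameters, ideals at points -/

/-- A nonsingular variety over `K`: an integral separated scheme of finite type over `K` all of
whose local rings are regular. -/
structure IsNonsingularVariety {K : Type u} [Field K] {X : Scheme.{u}}
    (s : X ⟶ Spec (CommRingCat.of K)) : Prop where
  isIntegral : IsIntegral X
  isSeparated : IsSeparated s
  locallyOfFiniteType : LocallyOfFiniteType s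
  quasiCompact : QuasiCompact s
  regular : ∀ p : X, IsRegularLocalRing (X.presheaf.stalk p)

/-- `x₁, …, x_d` is a regular system of parameters of the local ring `R`: it generates the maximal
ideal and `d = dim R`. -/
def IsRegularParams {R : Type*} [CommRing R] [IsLocalRing R] {d : ℕ} (x : Fin d → R) : Prop :=
  Ideal.span (Set.range x) = maximalIdeal R ∧ ringKrullDim R = d

/-- The stalk `𝓘_p ⊆ 𝒪_{X,p}` of an ideal sheaf at a point. -/
def idealStalk {X : Scheme.{u}} (I : X.IdealSheafData) (p : X) : Ideal (X.presheaf.stalk p) :=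
  ⨆ (W : X.affineOpens) (h : p ∈ W.1), (I.ideal W).map (X.presheaf.germ W.1 p h).hom

/-- The ideal `𝓘_{C,p}` of a closed subset `C` (with its reduced structure) at a point. -/
def idealAt {X : Scheme.{u}} (C : Closeds X) (p : X) : Ideal (X.presheaf.stalk p) :=
  idealStalk (Scheme.IdealSheafData.vanishingIdeal C) p

/-- An irreducible closed subset, regarded as a closed subset. -/
def toCloseds {X : Scheme.{u}} (T : IrreducibleCloseds X) : Closeds X :=
  ⟨(T : Set X), T.isClosed⟩

/-- The irreducible components of a closed subset. -/
def components {X : Scheme.{u}} (E : Set X) : Set (IrreducibleCloseds X) :=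
  {C | Maximal (fun C' : IrreducibleCloseds X => (C' : Set X) ⊆ E) C}

/-! ### Simple normal crossings -/

/-- A (reduced) effective divisor, given by its support `E`, is a simple normal crossings divisor:
at every closed point its ideal is generated by a monomial in a regular system of parameters. -/
def IsSNCDivisor {X : Scheme.{u}} (E : Closeds X) : Prop :=
  ∀ p : X, IsClosed ({p} : Set X) →
    ∃ (d : ℕ) (v : Fin d → X.presheaf.stalk p) (a : Fin d → ℕ), IsRegularParams v ∧
      idealAt E p = Ideal.span {∏ j, v j ^ a j}

/-- An ideal of a local ring is generated by finitely many monomials in some regular system of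
parameters. -/
def IsMonomial {R : Type*} [CommRing R] [IsLocalRing R] (I : Ideal R) : Prop :=
  ∃ (d : ℕ) (v : Fin d → R) (c : ℕ) (a : Fin c → Fin d → ℕ), IsRegularParams v ∧
    I = Ideal.span (Set.range fun i => ∏ j, v j ^ a i j)

/-- The closed subscheme defined by `I` is an SNC subscheme: `I` is a locally monomial ideal
sheaf. -/
def IsSNCSubscheme {X : Scheme.{u}} (I : X.IdealSheafData) : Prop :=
  ∀ p : X, IsClosed ({p} : Set X) → IsMonomial (idealStalk I p)

/-- The irreducible closed subvariety `Z` makes SNC with the divisor `E` at `p`: for suitable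
regular parameters at `p`, `E` is defined by a monomial in them and, if `p ∈ Z`, `Z` is defined by
the vanishing of some of them (in particular `Z` is nonsingular at `p`). -/
def MakesSNCAt {X : Scheme.{u}} (E : Closeds X) (Z : IrreducibleCloseds X) (p : X) : Prop :=
  ∃ (d : ℕ) (v : Fin d → X.presheaf.stalk p) (a : Fin d → ℕ) (J : Finset (Fin d)),
    IsRegularParams v ∧ idealAt E p = Ideal.span {∏ j, v j ^ a j} ∧
      (p ∈ (Z : Set X) → idealAt (toCloseds Z) p = Ideal.span (v '' (J : Set (Fin d))))

/-- `Z` makes SNC with `E`. -/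
def MakesSNC {X : Scheme.{u}} (E : Closeds X) (Z : IrreducibleCloseds X) : Prop :=
  ∀ p : X, IsClosed ({p} : Set X) → MakesSNCAt E Z p

/-- `Z` is an `(ℓ, ℓ')`-subvariety for `E` at `q`: `q ∈ Z`, `Z` makes SNC with `E` at `q`, exactly
`ℓ` irreducible components of `E` contain `q` and exactly `ℓ'` of them contain `Z`. -/
def IsSubvarietyAt {X : Scheme.{u}} (E : Closeds X) (Z : IrreducibleCloseds X) (ℓ ℓ' : ℕ)
    (q : X) : Prop :=
  q ∈ (Z : Set X) ∧ MakesSNCAt E Z q ∧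
    {C ∈ components (E : Set X) | q ∈ (C : Set X)}.encard = ℓ ∧
    {C ∈ components (E : Set X) | (Z : Set X) ⊆ C}.encard = ℓ'

/-! ### Completed local rings -/

/-- The completion of a local ring at its maximal ideal. -/
abbrev Completed (R : Type*) [CommRing R] [IsLocalRing R] : Type _ :=
  AdicCompletion (maximalIdeal R) R

theorem pow_maximalIdeal_le_comap {R S : Type*} [CommRing R] [IsLocalRing R] [CommRing S]
    [IsLocalRing S] (f : R →+* S) [IsLocalHom f] (n : ℕ) :
    maximalIdeal R ^ n ≤ (maximalIdeal S ^ n).comap f := by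
  rw [← Ideal.map_le_iff_le_comap, Ideal.map_pow]
  exact Ideal.pow_right_mono
    (((local_hom_TFAE f).out 0 2).mp ‹IsLocalHom f›) n

/-- The ring homomorphism between completions induced by a local homomorphism. -/
def completedMap {R S : Type*} [CommRing R] [IsLocalRing R] [CommRing S] [IsLocalRing S]
    (f : R →+* S) [IsLocalHom f] : Completed R →+* Completed S :=
  AdicCompletion.liftRingHom (maximalIdeal S)
    (fun n => (Ideal.quotientMap (maximalIdeal S ^ n) f (pow_maximalIdeal_le_comap f n)).comp
      (AdicCompletion.evalₐ (maximalIdeal R) n : Completed R →+* R ⧸ maximalIdeal R ^ n))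
    (by
      intro m n hle
      ext x
      obtain ⟨r, hr⟩ := Ideal.Quotient.mk_surjective (AdicCompletion.evalₐ (maximalIdeal R) n x)
      have hm : AdicCompletion.evalₐ (maximalIdeal R) m x = Ideal.Quotient.mk _ r := by
        obtain ⟨y, rfl⟩ := AdicCompletion.mk_surjective (maximalIdeal R) R x
        rw [AdicCompletion.evalₐ_mk] at hr ⊢
        rw [← AdicCompletion.Ideal.mk_eq_mk _ hle]
        rw [Ideal.Quotient.eq] at hr ⊢
        have := Ideal.pow_le_pow_right hle hr
        rw [← neg_sub]
        exact neg_mem this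
      change Ideal.Quotient.factorPow (maximalIdeal S) hle
        (Ideal.quotientMap _ f (pow_maximalIdeal_le_comap f n)
          (AdicCompletion.evalₐ (maximalIdeal R) n x)) =
        Ideal.quotientMap _ f (pow_maximalIdeal_le_comap f m)
          (AdicCompletion.evalₐ (maximalIdeal R) m x)
      rw [hm, ← hr]
      rfl)

/-! ### Nonsingular affine toric varieties -/

/-- The semigroup `S_σ = σ^∨ ∩ M ⊆ M = ℤ^d` of the regular cone `σ = Cone(e₁, …, e_n)`, `n ≤ d`. -/
def toricMonoid (d n : ℕ) : AddSubmonoid (Fin d → ℤ) where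
  carrier := {a | ∀ i : Fin d, i.val < n → 0 ≤ a i}
  zero_mem' := fun _ _ => le_rfl
  add_mem' := fun ha hb i hi => add_nonneg (ha i hi) (hb i hi)

/-- The coordinate ring `K[S_σ]` of the nonsingular affine toric variety `X_σ`. -/
abbrev ToricRing (K : Type u) [Field K] (d n : ℕ) : Type u :=
  AddMonoidAlgebra K (toricMonoid d n)

/-- The torus `T ⊆ X_σ`: the locus where all characters `χ^s`, `s ∈ S_σ`, are invertible. -/
def torus (K : Type u) [Field K] (d n : ℕ) : Set (PrimeSpectrum (ToricRing K d n)) :=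
  {x | ∀ s : toricMonoid d n, AddMonoidAlgebra.single s (1 : K) ∉ x.asIdeal}

/-- The ideal of `X_σ ∖ T`. -/
def boundaryIdeal (K : Type u) [Field K] (d n : ℕ) : Ideal (ToricRing K d n) :=
  PrimeSpectrum.vanishingIdeal (torus K d n)ᶜ

/-- The comorphism `K[S_τ] → K[S_σ]` of the toric morphism given by a homomorphism of semigroups
`S_τ → S_σ`. -/
def toricMap (K : Type u) [Field K] {m l d n : ℕ} (γ : toricMonoid m l →+ toricMonoid d n) :
    ToricRing K m l →+* ToricRing K d n :=
  AddMonoidAlgebra.mapDomainRingHom K γ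

/-- A local model `(X_σ, p')` for a local `K`-algebra `R` with structure map `κ` and boundary ideal
`I`: a nonsingular affine toric variety `X_σ`, a closed point `p'` and an isomorphism of completed
local `K`-algebras that takes the extension of `I` to the extension of the ideal of `X_σ ∖ T`. -/
structure LocalModel {K : Type u} [Field K] {R : Type u} [CommRing R] [IsLocalRing R]
    (κ : K →+* R) (I : Ideal R) where
  d : ℕ
  n : ℕ
  n_le_d : n ≤ d
  pt : Ideal (ToricRing K d n)
  [isMaximal : pt.IsMaximal]
  iso : Completed R ≃+* Completed (Localization.AtPrime pt)
  iso_const : ∀ a : K, iso (algebraMap R (Completed R) (κ a)) =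
    algebraMap (Localization.AtPrime pt) (Completed (Localization.AtPrime pt))
      (algebraMap (ToricRing K d n) (Localization.AtPrime pt) (algebraMap K (ToricRing K d n) a))
  iso_boundary : (I.map (algebraMap R (Completed R))).map (iso : Completed R →+* _) =
    ((boundaryIdeal K d n).map (algebraMap (ToricRing K d n) (Localization.AtPrime pt))).map
      (algebraMap (Localization.AtPrime pt) (Completed (Localization.AtPrime pt)))

attribute [instance] LocalModel.isMaximal

/-! ### Toroidal morphisms -/

/-- The inclusion of the constants in a local ring of a `K`-scheme. -/
def stalkConst {K : Type u} [Field K] {X : Scheme.{u}} (s : X ⟶ Spec (CommRingCat.of K)) (p : X) :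
    K →+* X.presheaf.stalk p :=
  (X.presheaf.germ ⊤ p trivial).hom.comp
    (s.appTop.hom.comp (Scheme.ΓSpecIso (CommRingCat.of K)).inv.hom)

/-- `φ : (U, D) → (V, E)` is toroidal: `φ` is a dominant morphism of `K`-schemes, `E` and
`D = φ⁻¹(E)` are SNC divisors, and at every closed point `p` there are local models of `U` at `p`
and of `V` at `φ(p)` and a toric morphism between them, mapping the one point to the other, that
induces the same homomorphism of completed local rings as `φ`. -/
structure IsToroidal {K : Type u} [Field K] {U V : Scheme.{u}}
    (sU : U ⟶ Spec (CommRingCat.of K)) (sV : V ⟶ Spec (CommRingCat.of K))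
    (φ : U ⟶ V) (D : Closeds U) (E : Closeds V) : Prop where
  comp_eq : φ ≫ sV = sU
  dominant : IsDominant φ
  snc_D : IsSNCDivisor D
  snc_E : IsSNCDivisor E
  preimage_eq : (D : Set U) = φ ⁻¹' (E : Set V)
  model : ∀ p : U, IsClosed ({p} : Set U) →
    ∃ (M : LocalModel (stalkConst sU p) (idealAt D p))
      (N : LocalModel (stalkConst sV (φ p)) (idealAt E (φ p)))
      (γ : toricMonoid N.d N.n →+ toricMonoid M.d M.n)
      (h : N.pt = M.pt.comap (toricMap K γ)),
      ∀ x : Completed (V.presheaf.stalk (φ p)),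
        M.iso (completedMap (φ.stalkMap p).hom x) =
          completedMap (Localization.localRingHom N.pt M.pt (toricMap K γ) h) (N.iso x)

/-! ### The non-principal locus -/

/-- The ideal `𝓘_Z 𝒪_{U,p}`. -/
def pullbackIdealAt {U V : Scheme.{u}} (φ : U ⟶ V) (Z : Closeds V) (p : U) :
    Ideal (U.presheaf.stalk p) :=
  (idealAt Z (φ p)).map (φ.stalkMap p).hom

/-- The non-principal locus `W_Z(U)`. -/
def nonPrincipalLocus {U V : Scheme.{u}} (φ : U ⟶ V) (Z : Closeds V) : Set U :=
  {p | ¬ (pullbackIdealAt φ Z p).IsPrincipal}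

/-- `N` is the ideal sheaf of `W_Z(U)`: there is a factorization `𝓘_Z 𝒪_U = 𝓕 N` with `𝓕` locally
principal such that the support of `𝒪_U / N` is `W_Z(U)`. (On a nonsingular variety this
determines `N`.) -/
def IsNonPrincipalIdeal {U V : Scheme.{u}} (φ : U ⟶ V) (Z : Closeds V)
    (N : U.IdealSheafData) : Prop :=
  (N.support : Set U) = nonPrincipalLocus φ Z ∧
  ∃ F : U.IdealSheafData, ∀ p : U, (idealStalk F p).IsPrincipal ∧
    pullbackIdealAt φ Z p = idealStalk F p * idealStalk N p

end

end ToroidalNP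

namespace ToroidalNP

/-! ### Regular local rings -/

section RegularLocal

/-! Everything reduces to a local claim: at a closed point p with q = φ(p), the pullback of the
ideal of Z is generated by monomials in regular parameters in which D is also monomial. Let v be
parameters at q adapted to E and Z, and u parameters at p in which D is monomial. A v_j dividing the
equation of E pulls back to a divisor of a power of the equation of D, hence to a unit times a
monomial in the u_i occurring in D. For the other v_j one shows that their pullbacks, together with
the u_i occurring in D, are independent in the cotangent space at p
(`LocalModel.Hom.cotangentIndependent`). They then extend to parameters z in which every v_j is a
monomial up to a unit (`LocalModel.Hom.exists_monomial`).

Independence is read off linear parts in formal toric coordinates. The u_i of D involve boundary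
coordinates only, and in the torus directions the differential of a toric morphism is its matrix of
exponents. A kernel vector of that matrix over K yields an integral one, hence two characters with
equal pullback whose difference has a nonzero linear part. Dominance of φ excludes this: in
characteristic zero a formal function killed by a dominant map has no linear part
(`mem_sq_of_forall_mem_pow`), as one sees by differentiating along a vector field upstairs dual to
one parameter and applying Krull's intersection theorem. So a dependent combination of the v_j not
dividing E has its linear part in the boundary directions of E, which the v_j dividing E already
span, and the independence of v finishes the argument.

A monomial ideal is the product of the gcd of its generators and an ideal of monomials without
common factor. Intrinsically these are the divisorial hull and the residual ideal; both commute with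
localization, so they glue to sheaves F and N, and N is the unit ideal exactly where the pullback is
principal. Minimal primes of a monomial ideal are generated by subsets of the parameters, so the
components make SNC with D. Absence of a common factor gives height at least 2; Krull's height
theorem bounds the height by the number of generators, which is at most dim V. -/

theorem natCast_le_of_add_le_add {n k : ℕ} {x : WithBot ℕ∞}
    (h : (n : WithBot ℕ∞) + k ≤ x + k) : (n : WithBot ℕ∞) ≤ x := by
  induction x using WithBot.recBotCoe with
  | bot => simp at h
  | coe x =>
    induction x using ENat.recTopCoe with
    | top => exact_mod_cast le_top
    | coe x =>
      have : n + k ≤ x + k := by exact_mod_cast h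
      exact_mod_cast (by omega : n ≤ x)

/-- Exchange argument: when x is written in terms of `s`, some coefficient is a unit because x is
not in the square of the maximal ideal, and the corresponding generator can be solved for. -/
theorem exists_erase_span_eq {R : Type*} [CommRing R] [IsLocalRing R] [DecidableEq R]
    (s : Finset R) (hs : Ideal.span (s : Set R) = maximalIdeal R) {x : R}
    (hx : x ∈ maximalIdeal R) (hx2 : x ∉ maximalIdeal R ^ 2) :
    ∃ i ∈ s, Ideal.span (insert x (s.erase i : Set R)) = maximalIdeal R := by
  have hx' := hx
  rw [← hs] at hx'
  obtain ⟨a, -, ha⟩ := Submodule.mem_span_finset.mp hx'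
  have hsm : ∀ i ∈ s, i ∈ maximalIdeal R := fun i hi => hs ▸ Ideal.subset_span hi
  obtain ⟨i, hi, hui⟩ : ∃ i ∈ s, a i ∉ maximalIdeal R := by
    by_contra! h
    apply hx2
    rw [← ha, pow_two]
    exact Ideal.sum_mem _ fun i hi => Ideal.mul_mem_mul (h i hi) (hsm i hi)
  refine ⟨i, hi, le_antisymm ?_ ?_⟩
  · rw [Ideal.span_le]
    rintro y (rfl | hy)
    · exact hx
    · exact hsm y (Finset.mem_of_mem_erase hy)
  · rw [← hs, Ideal.span_le]
    intro y hy
    by_cases hyi : y = i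
    · rw [hyi] at hy ⊢
      obtain ⟨b, hb⟩ := (not_not.mp hui : IsUnit (a i)).exists_left_inv
      have h1 : i = b * (x - ∑ j ∈ s.erase i, a j • j) := by
        rw [← ha, ← Finset.add_sum_erase s _ hi, add_sub_cancel_right, smul_eq_mul, ← mul_assoc,
          hb, one_mul]
      change i ∈ Ideal.span (insert x (s.erase i : Set R))
      have h2 : b * (x - ∑ j ∈ s.erase i, a j • j) ∈ Ideal.span (insert x (s.erase i : Set R)) := by
        refine Ideal.mul_mem_left _ _ (Ideal.sub_mem _ (Ideal.subset_span (Set.mem_insert _ _))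
          (Ideal.sum_mem _ fun j hj => Ideal.mul_mem_left _ _ (Ideal.subset_span ?_)))
        exact Set.mem_insert_of_mem _ hj
      rwa [← h1] at h2
    · exact Ideal.subset_span (Set.mem_insert_of_mem _ (Finset.mem_erase.mpr ⟨hyi, hy⟩))

/-- A regular local ring is a domain. Choose x in the maximal ideal outside its square and outside
all minimal primes. The quotient by x satisfies the hypotheses for n, so (x) is prime by induction.
A minimal prime P inside (x) does not contain x, so P = xP and Nakayama gives P = 0. -/
theorem isDomain_of_span_eq_maximalIdeal (n : ℕ) : ∀ (R : Type u) [CommRing R] [IsLocalRing R]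
    [IsNoetherianRing R] (s : Finset R), s.card ≤ n → Ideal.span (s : Set R) = maximalIdeal R →
    (n : WithBot ℕ∞) ≤ ringKrullDim R → IsDomain R := by
  classical
  induction n with
  | zero =>
    intro R _ _ _ s hs hspan _
    have h0 : s = ∅ := Finset.card_eq_zero.mp (Nat.le_zero.mp hs)
    have hF : IsField R := by
      rw [isField_iff_maximalIdeal_eq, ← hspan, h0]
      simp
    exact hF.isDomain
  | succ n ih =>
    intro R _ _ _ s hs hspan hdim
    have hht : (maximalIdeal R).height ≠ 0 := by
      intro h0
      rw [← maximalIdeal_height_eq_ringKrullDim, h0] at hdim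
      have : ((n + 1 : ℕ) : ℕ∞) ≤ 0 := by exact_mod_cast hdim
      simp at this
    have hmin : ∀ P ∈ minimalPrimes R, ¬ maximalIdeal R ≤ P := by
      intro P hP hle
      have hPp : P.IsPrime := hP.1.1
      have h1 : maximalIdeal R = P := le_antisymm hle (le_maximalIdeal hPp.ne_top)
      exact hht (h1 ▸ Ideal.height_eq_zero_iff.mpr hP)
    have hsq : ¬ maximalIdeal R ≤ maximalIdeal R ^ 2 := by
      intro hle
      have h1 : maximalIdeal R = ⊥ :=
        Submodule.eq_bot_of_le_smul_of_le_jacobson_bot (maximalIdeal R) _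
          (IsNoetherian.noetherian _) (by rwa [smul_eq_mul, ← pow_two])
          (IsLocalRing.jacobson_eq_maximalIdeal ⊥ bot_ne_top).ge
      have : IsDomain R := (isField_iff_maximalIdeal_eq.mpr h1).isDomain
      exact hht (by rw [h1, Ideal.height_bot])
    have hfin : (insert (maximalIdeal R ^ 2) (minimalPrimes R)).Finite :=
      (minimalPrimes.finite_of_isNoetherianRing R).insert _
    -- Prime avoidance tolerates two ideals that need not be prime; the square of the maximal ideal
    -- fills both places.
    have havoid := (Ideal.subset_union_prime_finite hfin (f := id) (maximalIdeal R ^ 2)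
      (maximalIdeal R ^ 2) (fun P hP hne _ => ((Set.mem_of_mem_insert_of_ne hP hne).1.1))
      (I := maximalIdeal R)).not.mpr (by
        rintro ⟨P, hP, hle⟩
        rcases hP with rfl | hP
        · exact hsq hle
        · exact hmin P hP hle)
    obtain ⟨x, hx, hxn⟩ := Set.not_subset.mp havoid
    simp only [Set.mem_iUnion, not_exists, id] at hxn
    have hx2 : x ∉ maximalIdeal R ^ 2 := hxn _ (Set.mem_insert _ _)
    have hxm : ∀ P ∈ minimalPrimes R, x ∉ P := fun P hP => hxn P (Set.mem_insert_of_mem _ hP)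
    obtain ⟨i, hi, hspan'⟩ := exists_erase_span_eq s hspan hx hx2
    have hne : Ideal.span {x} ≠ ⊤ := fun h =>
      (maximalIdeal.isMaximal R).ne_top (top_le_iff.mp (h ▸ (Ideal.span_singleton_le_iff_mem _).mpr hx))
    have : Nontrivial (R ⧸ Ideal.span {x}) := Ideal.Quotient.nontrivial_iff.mpr hne
    have : IsLocalRing (R ⧸ Ideal.span {x}) :=
      IsLocalRing.of_surjective' (Ideal.Quotient.mk _) Ideal.Quotient.mk_surjective
    have hmap : (maximalIdeal R).map (Ideal.Quotient.mk (Ideal.span {x})) =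
        maximalIdeal (R ⧸ Ideal.span {x}) :=
      IsLocalRing.map_maximalIdeal_of_surjective _ Ideal.Quotient.mk_surjective
    have hdom : IsDomain (R ⧸ Ideal.span {x}) := by
      refine ih _ ((s.erase i).image (Ideal.Quotient.mk (Ideal.span {x}))) ?_ ?_ ?_
      · refine Finset.card_image_le.trans ?_
        rw [Finset.card_erase_of_mem hi]
        omega
      · rw [← hmap, ← hspan', Ideal.map_span, Set.image_insert_eq,
          Ideal.Quotient.eq_zero_iff_mem.mpr (Ideal.mem_span_singleton_self x),
          Ideal.span_insert_zero, Finset.coe_image]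
        
      · have h1 := ringKrullDim_le_ringKrullDim_quotient_add_spanFinrank (Ideal.span {x})
          (by rw [IsLocalRing.ringJacobson_eq_maximalIdeal]; exact le_maximalIdeal hne)
        have h2 : (Ideal.span {x}).spanFinrank ≤ 1 := by
          simpa using Submodule.spanFinrank_span_le_ncard_of_finite (R := R) (Set.finite_singleton x)
        have h3 : ((n + 1 : ℕ) : WithBot ℕ∞) ≤ ringKrullDim (R ⧸ Ideal.span {x}) + 1 :=
          hdim.trans (h1.trans (by gcongr; exact_mod_cast h2))
        push_cast at h3
        exact natCast_le_of_add_le_add (k := 1) (by exact_mod_cast h3)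
    have hxp : (Ideal.span {x}).IsPrime := (Ideal.Quotient.isDomain_iff_prime _).mp hdom
    obtain ⟨P, hP, hPx⟩ := Ideal.exists_minimalPrimes_le (I := ⊥) (J := Ideal.span {x}) bot_le
    have hPp : P.IsPrime := hP.1.1
    have hPle : P ≤ maximalIdeal R • P := by
      intro y hy
      obtain ⟨z, rfl⟩ := Ideal.mem_span_singleton'.mp (hPx hy)
      rw [mul_comm]
      exact Submodule.smul_mem_smul hx ((hPp.mem_or_mem hy).resolve_right (hxm P hP))
    have hP0 : P = ⊥ := Submodule.eq_bot_of_le_smul_of_le_jacobson_bot (maximalIdeal R) _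
          (IsNoetherian.noetherian _) hPle
          (IsLocalRing.jacobson_eq_maximalIdeal ⊥ bot_ne_top).ge
    have : (⊥ : Ideal R).IsPrime := hP0 ▸ hPp
    exact IsDomain.of_bot_isPrime R

end RegularLocal

/-! ### Regular systems of parameters and the cotangent space -/

section RegularParams

set_option linter.unusedSectionVars false

variable {R : Type u} [CommRing R] [IsLocalRing R] [IsNoetherianRing R] {d : ℕ} {x : Fin d → R}

theorem IsRegularParams.mem (hx : IsRegularParams x) (i : Fin d) : x i ∈ maximalIdeal R :=
  hx.1 ▸ Ideal.subset_span ⟨i, rfl⟩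

theorem IsRegularParams.span_image_le (hx : IsRegularParams x) (T : Finset (Fin d)) :
    Ideal.span (x '' T) ≤ maximalIdeal R := by
  rw [Ideal.span_le]
  rintro _ ⟨i, -, rfl⟩
  exact hx.mem i

/-- A subset of a regular system of parameters generates a prime ideal. -/
theorem IsRegularParams.isPrime_span_image (hx : IsRegularParams x) (T : Finset (Fin d)) :
    (Ideal.span (x '' T)).IsPrime := by
  classical
  set I := Ideal.span (x '' (T : Set (Fin d))) with hI
  have hle : I ≤ maximalIdeal R := hx.span_image_le T
  have hne : I ≠ ⊤ := fun h => (maximalIdeal.isMaximal R).ne_top (top_le_iff.mp (h ▸ hle))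
  have : Nontrivial (R ⧸ I) := Ideal.Quotient.nontrivial_iff.mpr hne
  have : IsLocalRing (R ⧸ I) :=
    IsLocalRing.of_surjective' (Ideal.Quotient.mk _) Ideal.Quotient.mk_surjective
  have hmap : (maximalIdeal R).map (Ideal.Quotient.mk I) = maximalIdeal (R ⧸ I) :=
    IsLocalRing.map_maximalIdeal_of_surjective _ Ideal.Quotient.mk_surjective
  rw [← Ideal.Quotient.isDomain_iff_prime]
  -- The remaining parameters generate the maximal ideal of the quotient, and the dimension drops by
  -- at most the cardinality of `T`; so the quotient is again regular.
  refine isDomain_of_span_eq_maximalIdeal (Tᶜ.card) _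
    (Tᶜ.image (fun i => Ideal.Quotient.mk I (x i))) Finset.card_image_le ?_ ?_
  · rw [← hmap, ← hx.1, Ideal.map_span]
    apply le_antisymm
    · apply Ideal.span_mono
      intro y hy
      obtain ⟨i, -, rfl⟩ := Finset.mem_image.mp (Finset.mem_coe.mp hy)
      exact ⟨x i, ⟨i, rfl⟩, rfl⟩
    · rw [Ideal.span_le]
      rintro _ ⟨_, ⟨i, rfl⟩, rfl⟩
      by_cases hi : i ∈ T
      · rw [Ideal.Quotient.eq_zero_iff_mem.mpr
          (show x i ∈ I from Ideal.subset_span (Set.mem_image_of_mem x hi))]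
        exact Ideal.zero_mem _
      · exact Ideal.subset_span (Finset.mem_coe.mpr
          (Finset.mem_image.mpr ⟨i, Finset.mem_compl.mpr hi, rfl⟩))
  · have h1 := ringKrullDim_le_ringKrullDim_quotient_add_spanFinrank I
      (by rw [IsLocalRing.ringJacobson_eq_maximalIdeal]; exact hle)
    have h2 : I.spanFinrank ≤ T.card := by
      refine (Submodule.spanFinrank_span_le_ncard_of_finite (T.finite_toSet.image x)).trans ?_
      refine (Set.ncard_image_le T.finite_toSet).trans ?_
      rw [Set.ncard_coe_finset]
    apply natCast_le_of_add_le_add (k := T.card)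
    have h3 : ((Tᶜ.card : ℕ) : WithBot ℕ∞) + T.card = ringKrullDim R := by
      rw [hx.2, ← Nat.cast_add, Finset.card_compl_add_card, Fintype.card_fin]
    rw [h3]
    refine h1.trans ?_
    gcongr

/-- Otherwise d - 1 elements would generate the maximal ideal of a ring of dimension d. -/
theorem IsRegularParams.notMem_span_image (hx : IsRegularParams x) {T : Finset (Fin d)}
    {i : Fin d} (hi : i ∉ T) : x i ∉ Ideal.span (x '' T) := by
  classical
  intro hmem
  have hle : maximalIdeal R ≤ Ideal.span (x '' ((Finset.univ.erase i : Finset (Fin d)) : Set (Fin d))) := by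
    rw [← hx.1, Ideal.span_le]
    rintro _ ⟨j, rfl⟩
    by_cases hj : j = i
    · subst hj
      refine Ideal.span_mono (Set.image_mono ?_) hmem
      intro k hk
      simp only [Finset.coe_erase, Finset.coe_univ, Set.mem_sdiff, Set.mem_univ, true_and,
        Set.mem_singleton_iff]
      rintro rfl
      exact hi hk
    · exact Ideal.subset_span (Set.mem_image_of_mem x (by simp [hj]))
  have heq := le_antisymm hle (hx.span_image_le _)
  have h1 := ringKrullDim_le_spanFinrank_maximalIdeal R
  rw [hx.2, heq] at h1
  have h2 := (Submodule.spanFinrank_span_le_ncard_of_finite (R := R)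
    ((Finset.univ.erase i).finite_toSet.image x)).trans (Set.ncard_image_le (Finset.finite_toSet _))
  rw [Set.ncard_coe_finset, Finset.card_erase_of_mem (Finset.mem_univ i), Finset.card_univ,
    Fintype.card_fin] at h2
  have h3 : d ≤ d - 1 := (by exact_mod_cast h1 : d ≤ _).trans h2
  have := i.2
  omega

theorem IsRegularParams.isDomain (hx : IsRegularParams x) : IsDomain R := by
  have := hx.isPrime_span_image ∅
  simp only [Finset.coe_empty, Set.image_empty, Ideal.span_empty] at this
  exact IsDomain.of_bot_isPrime R

theorem IsRegularParams.ne_zero (hx : IsRegularParams x) (i : Fin d) : x i ≠ 0 := by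
  have := hx.notMem_span_image (Finset.notMem_empty i)
  simpa using this

theorem IsRegularParams.prime (hx : IsRegularParams x) (i : Fin d) : Prime (x i) := by
  have := hx.isPrime_span_image {i}
  rw [Finset.coe_singleton, Set.image_singleton] at this
  exact (Ideal.span_singleton_prime (hx.ne_zero i)).mp this

theorem IsRegularParams.not_dvd (hx : IsRegularParams x) {i j : Fin d} (h : i ≠ j) :
    ¬ x i ∣ x j := by
  have := hx.notMem_span_image (T := {i}) (i := j) (by simpa using h.symm)
  rwa [Finset.coe_singleton, Set.image_singleton, Ideal.mem_span_singleton] at this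

theorem IsRegularParams.isRegularLocalRing (hx : IsRegularParams x) : IsRegularLocalRing R := by
  apply IsRegularLocalRing.of_spanFinrank_maximalIdeal_le
  rw [hx.2, ← hx.1, ← Set.image_univ]
  have h2 := (Submodule.spanFinrank_span_le_ncard_of_finite (R := R)
    (Set.finite_univ.image x)).trans (Set.ncard_image_le Set.finite_univ)
  rw [Set.ncard_univ, Nat.card_eq_fintype_card, Fintype.card_fin] at h2
  exact_mod_cast h2

/-- Elements of the maximal ideal are independent if their classes in the cotangent space are
linearly independent. -/
def CotangentIndependent {ι : Type*} [Fintype ι] (y : ι → R) : Prop :=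
  ∀ c : ι → R, ∑ i, c i * y i ∈ maximalIdeal R ^ 2 → ∀ i, c i ∈ maximalIdeal R

theorem CotangentIndependent.linearIndependent {ι : Type*} [Fintype ι] {y : ι → R}
    (hy : ∀ i, y i ∈ maximalIdeal R) (h : CotangentIndependent y) :
    LinearIndependent (ResidueField R)
      (fun i => (maximalIdeal R).toCotangent ⟨y i, hy i⟩ : ι → CotangentSpace R) := by
  rw [Fintype.linearIndependent_iff]
  intro g hg i
  choose c hc using fun i => IsLocalRing.residue_surjective (g i)
  rw [← hc i, residue_eq_zero_iff]
  refine h c ?_ i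
  have h1 : (maximalIdeal R).toCotangent (∑ i, c i • ⟨y i, hy i⟩) = 0 := by
    rw [← hg, map_sum]
    refine Finset.sum_congr rfl fun i _ => ?_
    rw [map_smul, ← hc i]
    rfl
  rw [Ideal.toCotangent_eq_zero] at h1
  simpa using h1

/-- Elements with linearly independent classes in the cotangent space extend to a regular system
of parameters. -/
theorem CotangentIndependent.exists_isRegularParams (hx : IsRegularParams x) {ι : Type} [Fintype ι]
    {y : ι → R} (hy : ∀ i, y i ∈ maximalIdeal R) (h : CotangentIndependent y) :
    ∃ (d : ℕ) (z : Fin d → R) (e : ι ↪ Fin d), IsRegularParams z ∧ ∀ i, z (e i) = y i := by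
  classical
  have hR := hx.isRegularLocalRing
  have hli := h.linearIndependent hy
  -- The classes of the y_i are completed to a basis of the cotangent space. Lifts of a basis
  -- generate the maximal ideal by Nakayama, and regularity makes their number equal to the
  -- dimension.
  obtain ⟨κ, b, hb⟩ : ∃ (κ : Type u) (b : Module.Basis (ι ⊕ κ) (ResidueField R) (CotangentSpace R)),
      ∀ i, b (.inl i) = (maximalIdeal R).toCotangent ⟨y i, hy i⟩ := by
    refine ⟨_, Module.Basis.sumExtend hli, fun i => ?_⟩
    simp [Module.Basis.sumExtend]
    rfl
  have : Finite (ι ⊕ κ) := Module.Finite.finite_basis b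
  have := Fintype.ofFinite (ι ⊕ κ)
  choose z hz using fun k : ι ⊕ κ =>
    (maximalIdeal R).toCotangent_surjective (b k)
  let z' : ι ⊕ κ → maximalIdeal R :=
    Sum.elim (fun i => ⟨y i, hy i⟩) (fun k => z (.inr k))
  have hz' : ∀ k, (maximalIdeal R).toCotangent (z' k) = b k := by
    rintro (i | k)
    · exact (hb i).symm
    · exact hz _
  let e := Fintype.equivFin (ι ⊕ κ)
  refine ⟨_, fun i => (z' (e.symm i) : R), ⟨fun i => e (.inl i), fun i j hij => by simpa using hij⟩, ⟨?_, ?_⟩, ?_⟩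
  · have h1 : Submodule.span (ResidueField R) ((maximalIdeal R).toCotangent '' (Set.range z')) = ⊤ := by
      rw [← Set.range_comp, ← b.span_eq]
      congr 2
      ext k
      simp [hz']
    rw [CotangentSpace.span_image_eq_top_iff] at h1
    have h2 := congrArg (Submodule.map (maximalIdeal R).subtype) h1
    rw [Submodule.map_span, Submodule.map_top, ← Set.range_comp, Submodule.range_subtype] at h2
    refine Eq.trans ?_ h2
    congr 1
    ext t
    constructor
    · rintro ⟨i, rfl⟩; exact ⟨e.symm i, rfl⟩
    · rintro ⟨k, rfl⟩; exact ⟨e k, by simp⟩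
  · rw [← (IsRegularLocalRing.iff_finrank_cotangentSpace R).mp inferInstance,
      Module.finrank_eq_card_basis b]
  · intro i
    change ((z' (e.symm (e (.inl i))) : maximalIdeal R) : R) = y i
    rw [Equiv.symm_apply_apply]
    rfl

theorem IsRegularParams.cotangentIndependent (hx : IsRegularParams x) :
    CotangentIndependent x := by
  have hR := hx.isRegularLocalRing
  have h1 : ⊤ ≤ Submodule.span (ResidueField R)
      (Set.range fun i => ((maximalIdeal R).toCotangent ⟨x i, hx.mem i⟩ : CotangentSpace R)) := by
    have : Set.range (fun i => ((maximalIdeal R).toCotangent ⟨x i, hx.mem i⟩ : CotangentSpace R))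
        = (maximalIdeal R).toCotangent '' (Set.range fun i => ⟨x i, hx.mem i⟩) := by
      rw [← Set.range_comp]; rfl
    rw [this, (CotangentSpace.span_image_eq_top_iff).mpr]
    apply Submodule.map_injective_of_injective (maximalIdeal R).subtype_injective
    rw [Submodule.map_span, Submodule.map_top, ← Set.range_comp, Submodule.range_subtype]
    exact hx.1
  have h2 : LinearIndependent (ResidueField R)
      (fun i => ((maximalIdeal R).toCotangent ⟨x i, hx.mem i⟩ : CotangentSpace R)) := by
    refine linearIndependent_of_top_le_span_of_card_eq_finrank h1 ?_
    have := (IsRegularLocalRing.iff_finrank_cotangentSpace R).mp inferInstance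
    rw [hx.2] at this
    rw [Fintype.card_fin]
    exact_mod_cast this.symm
  intro c hc i
  rw [← residue_eq_zero_iff]
  refine Fintype.linearIndependent_iff.mp h2 (fun i => residue R (c i)) ?_ i
  have h3 : (maximalIdeal R).toCotangent (∑ i, c i • ⟨x i, hx.mem i⟩) = 0 := by
    rw [Ideal.toCotangent_eq_zero]
    simpa using hc
  rw [map_sum] at h3
  rw [← h3]
  refine Finset.sum_congr rfl fun i _ => ?_
  rw [map_smul]
  rfl

end RegularParams

end ToroidalNP

namespace ToroidalNP

/-! ### Divisorial hull and residual ideal -/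

section Hull

variable {A : Type*} [CommRing A]

/-- The divisorial hull of an ideal of a domain; it is `((a) : ((a) : I))` for each nonzero
`a ∈ I`. -/
def divisorialHull (I : Ideal A) : Ideal A where
  carrier := {r | ∀ a ∈ I, ∀ y, (∀ i ∈ I, a ∣ y * i) → a ∣ r * y}
  zero_mem' := fun a _ y _ => by simp
  add_mem' := fun {r s} hr hs a ha y hy => by
    rw [add_mul]
    exact dvd_add (hr a ha y hy) (hs a ha y hy)
  smul_mem' := fun c r hr a ha y hy => by
    rw [smul_eq_mul, mul_assoc]
    exact (hr a ha y hy).mul_left c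

/-- The residual ideal `I : I^{**}`. -/
def residualIdeal (I : Ideal A) : Ideal A :=
  I.colon (divisorialHull I : Set A)

theorem mem_divisorialHull {I : Ideal A} {r : A} :
    r ∈ divisorialHull I ↔ ∀ a ∈ I, ∀ y, (∀ i ∈ I, a ∣ y * i) → a ∣ r * y := Iff.rfl

theorem divisorialHull_bot : divisorialHull (⊥ : Ideal A) = ⊥ := by
  ext r
  rw [mem_divisorialHull, Ideal.mem_bot]
  constructor
  · intro h
    simpa using h 0 rfl 1 (by simp)
  · rintro rfl a _ y _
    simp

variable [IsDomain A]

/-- One nonzero a in `I` tests all others: if b divides y * i for every i in `I`, then y * a = b *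
t, and t satisfies the same divisibility condition with respect to a. -/
theorem mem_divisorialHull_iff {I : Ideal A} {a : A} (ha : a ∈ I) (ha0 : a ≠ 0) {r : A} :
    r ∈ divisorialHull I ↔ ∀ y, (∀ i ∈ I, a ∣ y * i) → a ∣ r * y := by
  refine ⟨fun h => h a ha, fun h b hb y hy => ?_⟩
  rcases eq_or_ne b 0 with rfl | hb0
  · have := hy a ha
    rw [zero_dvd_iff, mul_eq_zero, or_iff_left ha0] at this
    simp [this]
  obtain ⟨t, ht⟩ := hy a ha
  obtain ⟨s, hs⟩ := h t fun i hi => by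
    obtain ⟨z, hz⟩ := hy i hi
    refine ⟨z, mul_left_cancel₀ hb0 ?_⟩
    linear_combination (-i) * ht + a * hz
  refine ⟨s, mul_left_cancel₀ ha0 ?_⟩
  linear_combination r * ht + b * hs

/-- Colons by finitely generated ideals localize, so this form shows that the hull does. -/
theorem divisorialHull_eq_colon {I : Ideal A} {a : A} (ha : a ∈ I) (ha0 : a ≠ 0) :
    divisorialHull I = (Ideal.span {a}).colon ((Ideal.span {a}).colon (I : Set A) : Set A) := by
  ext r
  simp only [mem_divisorialHull_iff ha ha0, Submodule.mem_colon, SetLike.mem_coe,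
    smul_eq_mul, Ideal.mem_span_singleton]

theorem divisorialHull_span_singleton (h : A) :
    divisorialHull (Ideal.span {h}) = Ideal.span {h} := by
  rcases eq_or_ne h 0 with rfl | h0
  · simp only [Ideal.span_singleton_zero, divisorialHull_bot]
  ext r
  rw [mem_divisorialHull_iff (Ideal.mem_span_singleton_self h) h0, Ideal.mem_span_singleton]
  constructor
  · intro H
    simpa using H 1 fun i hi => by simpa using Ideal.mem_span_singleton.mp hi
  · exact fun H y _ => H.mul_right y

theorem residualIdeal_of_isPrincipal {I : Ideal A} (hI : I.IsPrincipal) : residualIdeal I = ⊤ := by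
  obtain ⟨h, hh⟩ := hI
  rw [residualIdeal, hh]
  rw [show Submodule.span A {h} = Ideal.span {h} from rfl, divisorialHull_span_singleton,
    Submodule.colon_eq_top_iff_subset]

end Hull

/-! ### Localization of the hull and of the residual ideal -/

section Localization

variable {A B : Type*} [CommRing A] [CommRing B] [Algebra A B] (M : Submonoid A)
  [IsLocalization M B]

-- Finite generation of `J` allows the denominators, one for each generator, to be cleared by a
-- single product.
include M in
theorem map_colon_of_fg (I J : Ideal A) (hJ : J.FG) :
    (I.colon (J : Set A)).map (algebraMap A B) =
      (I.map (algebraMap A B)).colon (J.map (algebraMap A B) : Set B) := by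
  apply le_antisymm
  · rw [Ideal.map_le_iff_le_comap]
    intro r hr
    rw [Ideal.mem_comap, Submodule.mem_colon]
    intro s hs
    rw [smul_eq_mul]
    have : J.map (algebraMap A B) ≤
        Submodule.comap (LinearMap.mulLeft B (algebraMap A B r)) (I.map (algebraMap A B)) := by
      rw [Ideal.map, Ideal.span_le]
      rintro _ ⟨j, hj, rfl⟩
      change algebraMap A B r * algebraMap A B j ∈ I.map (algebraMap A B)
      rw [← map_mul]
      exact Ideal.mem_map_of_mem _ (Submodule.mem_colon.mp hr j hj)
    exact this hs
  · intro z hz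
    obtain ⟨⟨r, m⟩, hrm⟩ := IsLocalization.surj M z
    obtain ⟨S, rfl⟩ := hJ
    have h1 : ∀ s ∈ S, ∃ m' ∈ M, m' * (r * s) ∈ I := by
      intro s hs
      have h2 : algebraMap A B (r * s) ∈ I.map (algebraMap A B) := by
        rw [map_mul, ← hrm, mul_assoc, mul_comm _ (algebraMap A B s), ← mul_assoc]
        refine Ideal.mul_mem_right _ _ ?_
        exact Submodule.mem_colon.mp hz _ (Ideal.mem_map_of_mem _ (Ideal.subset_span hs))
      exact (IsLocalization.algebraMap_mem_map_algebraMap_iff M B I _).mp h2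
    choose! k hkM hk using h1
    have h3 : (∏ s ∈ S, k s) * r ∈ I.colon (Ideal.span (S : Set A) : Set A) := by
      rw [Ideal.colon_span, Submodule.mem_colon]
      intro s hs
      obtain ⟨t, ht⟩ := Finset.dvd_prod_of_mem k hs
      rw [ht, smul_eq_mul, show k s * t * r * s = t * (k s * (r * s)) by ring]
      exact Ideal.mul_mem_left _ _ (hk s hs)
    have h4 : (∏ s ∈ S, k s) ∈ M := Submonoid.prod_mem M hkM
    rw [IsLocalization.mem_map_algebraMap_iff M]
    refine ⟨(⟨_, h3⟩, ⟨_, M.mul_mem h4 m.2⟩), ?_⟩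
    simp only [map_mul]
    rw [← hrm]
    ring

include M in
theorem map_divisorialHull [IsDomain A] [IsDomain B] [IsNoetherianRing A]
    (hM : M ≤ nonZeroDivisors A) (I : Ideal A) :
    (divisorialHull I).map (algebraMap A B) = divisorialHull (I.map (algebraMap A B)) := by
  by_cases hI : I = ⊥
  · subst hI
    rw [divisorialHull_bot, Ideal.map_bot, divisorialHull_bot]
  obtain ⟨a, ha, ha0⟩ := Submodule.exists_mem_ne_zero_of_ne_bot hI
  have ha0' : algebraMap A B a ≠ 0 := fun h =>
    ha0 ((IsLocalization.injective B hM) (by rw [h, map_zero]))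
  rw [divisorialHull_eq_colon ha ha0,
    divisorialHull_eq_colon (Ideal.mem_map_of_mem _ ha) ha0',
    map_colon_of_fg M _ _ (IsNoetherian.noetherian _),
    map_colon_of_fg M _ _ (IsNoetherian.noetherian _), Ideal.map_span, Set.image_singleton]

include M in
theorem map_residualIdeal [IsDomain A] [IsDomain B] [IsNoetherianRing A]
    (hM : M ≤ nonZeroDivisors A) (I : Ideal A) :
    (residualIdeal I).map (algebraMap A B) = residualIdeal (I.map (algebraMap A B)) := by
  rw [residualIdeal, residualIdeal, map_colon_of_fg M _ _ (IsNoetherian.noetherian _),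
    map_divisorialHull M hM]

end Localization

/-! ### Monomial ideals -/

section Monomial

set_option linter.unusedSectionVars false

variable {R : Type u} [CommRing R] [IsLocalRing R] [IsNoetherianRing R] {d : ℕ} {x : Fin d → R}

theorem IsRegularParams.monomial_ne_zero (hx : IsRegularParams x) (b : Fin d → ℕ) :
    ∏ j, x j ^ b j ≠ 0 := by
  have := hx.isDomain
  exact Finset.prod_ne_zero_iff.mpr fun j _ => pow_ne_zero _ (hx.ne_zero j)

theorem exists_mem_of_monomial_mem {P : Ideal R} [hP : P.IsPrime] {b : Fin d → ℕ}
    (h : ∏ j, x j ^ b j ∈ P) : ∃ j, b j ≠ 0 ∧ x j ∈ P := by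
  obtain ⟨j, -, hj⟩ := (hP.prod_mem_iff).mp h
  refine ⟨j, fun h0 => ?_, hP.mem_of_pow_mem _ hj⟩
  rw [h0, pow_zero] at hj
  exact hP.ne_top ((Ideal.eq_top_iff_one _).mpr hj)

theorem IsRegularParams.not_dvd_monomial (hx : IsRegularParams x) {j : Fin d} {b : Fin d → ℕ}
    (h : b j = 0) : ¬ x j ∣ ∏ k, x k ^ b k := by
  intro hd
  obtain ⟨k, -, hk⟩ := (hx.prime j).exists_mem_finset_dvd hd
  by_cases hkj : k = j
  · subst hkj
    rw [h, pow_zero] at hk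
    exact (hx.prime k).not_dvd_one hk
  · exact hx.not_dvd (Ne.symm hkj) ((hx.prime j).dvd_of_dvd_pow hk)

theorem IsRegularParams.monomial_dvd (hx : IsRegularParams x) {b : Fin d → ℕ} {y : R}
    (h : ∀ j, x j ^ b j ∣ y) : ∏ j, x j ^ b j ∣ y := by
  classical
  suffices ∀ s : Finset (Fin d), ∏ j ∈ s, x j ^ b j ∣ y from this _
  intro s
  induction s using Finset.induction_on with
  | empty => simp
  | insert j s hj ih =>
    have := hx.isDomain
    obtain ⟨z, rfl⟩ := ih
    rw [Finset.prod_insert hj, mul_comm]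
    refine mul_dvd_mul_left _ ((hx.prime j).pow_dvd_of_dvd_mul_left _ ?_ (h j))
    intro hd
    obtain ⟨k, hk, hk'⟩ := (hx.prime j).exists_mem_finset_dvd hd
    have hjk : j ≠ k := by
      rintro rfl
      exact hj hk
    exact hx.not_dvd hjk ((hx.prime j).dvd_of_dvd_pow hk')

/-- A minimal prime of a monomial ideal is generated by a subset of the parameters. -/
theorem IsRegularParams.exists_eq_span_image (hx : IsRegularParams x) {c : ℕ}
    {b : Fin c → Fin d → ℕ} {P : Ideal R}
    (hP : P ∈ (Ideal.span (Set.range fun i => ∏ j, x j ^ b i j)).minimalPrimes) :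
    ∃ T : Finset (Fin d), P = Ideal.span (x '' T) := by
  classical
  have hPp : P.IsPrime := hP.1.1
  refine ⟨Finset.univ.filter (fun j => x j ∈ P), ?_⟩
  set T := Finset.univ.filter (fun j => x j ∈ P) with hT
  have h1 : Ideal.span (x '' T) ≤ P := by
    rw [Ideal.span_le]
    rintro _ ⟨j, hj, rfl⟩
    exact (Finset.mem_filter.mp hj).2
  -- Each monomial lies in P, hence so does one of its parameters. The parameters lying in P thus
  -- generate a prime that contains all the monomials, and minimality applies.
  refine le_antisymm (hP.2 ⟨hx.isPrime_span_image T, ?_⟩ h1) h1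
  rw [Ideal.span_le]
  rintro _ ⟨i, rfl⟩
  obtain ⟨j, hj0, hj⟩ := exists_mem_of_monomial_mem (hP.1.2 (Ideal.subset_span ⟨i, rfl⟩))
  have : x j ∈ Ideal.span (x '' T) :=
    Ideal.subset_span (Set.mem_image_of_mem x (by simpa [hT] using hj))
  exact Ideal.mem_of_dvd _ ((dvd_pow_self _ hj0).trans
    (Finset.dvd_prod_of_mem _ (Finset.mem_univ j))) this

/-- P contains a parameter x_j, and also a second parameter coming from a generator not divisible by
x_j; hence 0 < (x_j) < P is a strict chain of primes. -/
theorem IsRegularParams.two_le_height (hx : IsRegularParams x) {c : ℕ} (hc : 0 < c)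
    {b : Fin c → Fin d → ℕ} (hb : ∀ j, ∃ i, b i j = 0) {P : Ideal R} [hPp : P.IsPrime]
    (hP : Ideal.span (Set.range fun i => ∏ j, x j ^ b i j) ≤ P) : 2 ≤ P.height := by
  have := hx.isDomain
  have hm : ∀ i, ∏ j, x j ^ b i j ∈ P := fun i => hP (Ideal.subset_span ⟨i, rfl⟩)
  obtain ⟨j, -, hj⟩ := exists_mem_of_monomial_mem (hm ⟨0, hc⟩)
  obtain ⟨i, hi⟩ := hb j
  obtain ⟨k, hk0, hk⟩ := exists_mem_of_monomial_mem (hm i)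
  have hkj : j ≠ k := fun e => hk0 (e ▸ hi)
  have hQ : (Ideal.span {x j}).IsPrime :=
    (Ideal.span_singleton_prime (hx.ne_zero j)).mpr (hx.prime j)
  have h1 : (⊥ : Ideal R) < Ideal.span {x j} := by
    rw [bot_lt_iff_ne_bot, Ne, Ideal.span_singleton_eq_bot]
    exact hx.ne_zero j
  have h2 : Ideal.span {x j} < P := by
    refine lt_of_le_of_ne ((Ideal.span_singleton_le_iff_mem _).mpr hj) fun e => ?_
    rw [← e, Ideal.mem_span_singleton] at hk
    exact hx.not_dvd hkj hk
  have h3 := Ideal.height_add_one_le_of_lt_of_isPrime h1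
  have h4 := Ideal.height_add_one_le_of_lt_of_isPrime h2
  rw [Ideal.height_bot, zero_add] at h3
  calc (2 : ℕ∞) = 1 + 1 := by norm_num
    _ ≤ _ := by gcongr
    _ ≤ _ := h4

theorem height_le_of_mem_minimalPrimes_span_range {c : ℕ} {b : Fin c → R}
    {P : Ideal R} (hP : P ∈ (Ideal.span (Set.range b)).minimalPrimes) :
    P.height ≤ c := by
  refine (Ideal.height_le_card_of_mem_minimalPrimes_span (Set.finite_range _) hP).trans ?_
  rw [← Set.image_univ]
  have := Set.ncard_image_le (f := b) Set.finite_univ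
  rw [Set.ncard_univ, Nat.card_eq_fintype_card, Fintype.card_fin] at this
  exact_mod_cast this

theorem colon_mul_span_singleton [IsDomain R] {g : R} (hg : g ≠ 0) (N : Ideal R) :
    (Ideal.span {g} * N).colon (Ideal.span {g} : Set R) = N := by
  ext r
  rw [Ideal.mem_colon_span_singleton, mul_comm r g, Ideal.mem_span_singleton_mul]
  constructor
  · rintro ⟨z, hz, h⟩
    rwa [← mul_left_cancel₀ hg h]
  · exact fun h => ⟨r, h, rfl⟩

/-- A nonzero monomial ideal is the product of its divisorial hull, generated by the greatest
common divisor of the monomials, and its residual ideal. -/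
theorem IsRegularParams.residualIdeal_monomial (hx : IsRegularParams x) {c : ℕ} (hc : 0 < c)
    (b : Fin c → Fin d → ℕ) :
    ∃ (m : Fin d → ℕ) (b' : Fin c → Fin d → ℕ),
      divisorialHull (Ideal.span (Set.range fun i => ∏ j, x j ^ b i j)) =
        Ideal.span {∏ j, x j ^ m j} ∧
      residualIdeal (Ideal.span (Set.range fun i => ∏ j, x j ^ b i j)) =
        Ideal.span (Set.range fun i => ∏ j, x j ^ b' i j) ∧
      (∀ j, ∃ i, b' i j = 0) ∧
      Ideal.span (Set.range fun i => ∏ j, x j ^ b i j) =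
        Ideal.span {∏ j, x j ^ m j} * Ideal.span (Set.range fun i => ∏ j, x j ^ b' i j) := by
  have := hx.isDomain
  have hne : (Finset.univ : Finset (Fin c)).Nonempty := ⟨⟨0, hc⟩, Finset.mem_univ _⟩
  -- The exponents of the greatest common divisor.
  let m : Fin d → ℕ := fun j => Finset.univ.inf' hne fun i => b i j
  let b' : Fin c → Fin d → ℕ := fun i j => b i j - m j
  have hmb : ∀ i j, b i j = m j + b' i j := fun i j =>
    (Nat.add_sub_of_le (Finset.inf'_le (fun i => b i j) (Finset.mem_univ i))).symm
  have hb' : ∀ j, ∃ i, b' i j = 0 := by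
    intro j
    obtain ⟨i, -, hi⟩ := Finset.exists_mem_eq_inf' hne fun i => b i j
    exact ⟨i, by simp only [b', m, hi, Nat.sub_self]⟩
  set g := ∏ j, x j ^ m j with hg
  have hg0 : g ≠ 0 := hx.monomial_ne_zero m
  have hgb : ∀ i, ∏ j, x j ^ b i j = g * ∏ j, x j ^ b' i j := fun i => by
    rw [hg, ← Finset.prod_mul_distrib]
    exact Finset.prod_congr rfl fun j _ => by rw [hmb, pow_add]
  have hI : Ideal.span (Set.range fun i => ∏ j, x j ^ b i j) =
      Ideal.span {g} * Ideal.span (Set.range fun i => ∏ j, x j ^ b' i j) := by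
    rw [Ideal.span_mul_span', Set.singleton_mul, ← Set.range_comp]
    congr 2
    funext i
    exact hgb i
  have hhull : divisorialHull (Ideal.span (Set.range fun i => ∏ j, x j ^ b i j)) =
      Ideal.span {g} := by
    ext r
    rw [mem_divisorialHull_iff (Ideal.subset_span (Set.mem_range_self ⟨0, hc⟩)) (hx.monomial_ne_zero _),
      Ideal.mem_span_singleton]
    constructor
    · intro h
      -- Testing with y equal to the cofactor of the first generator: after cancelling it, g divides
      -- r.
      have h0 := h (∏ j, x j ^ b' ⟨0, hc⟩ j) fun i hi => by
        rw [hI, Ideal.mem_span_singleton_mul] at hi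
        obtain ⟨z, -, rfl⟩ := hi
        rw [hgb]
        exact ⟨z, by ring⟩
      rw [hgb] at h0
      exact (mul_dvd_mul_iff_right (hx.monomial_ne_zero _)).mp h0
    · rintro ⟨r', rfl⟩ y hy
      -- For each j, compare with a generator whose cofactor is not divisible by x_j; the full power
      -- of the prime x_j must then divide y.
      have h1 : ∏ j, x j ^ b' ⟨0, hc⟩ j ∣ y := by
        apply hx.monomial_dvd
        intro j
        obtain ⟨i, hi⟩ := hb' j
        have h2 := hy _ (Ideal.subset_span (Set.mem_range_self i))
        rw [hgb, hgb, mul_left_comm] at h2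
        have h3 := (mul_dvd_mul_iff_left hg0).mp h2
        exact (hx.prime j).pow_dvd_of_dvd_mul_right _ (hx.not_dvd_monomial hi)
          ((Finset.dvd_prod_of_mem _ (Finset.mem_univ j)).trans h3)
      obtain ⟨z, rfl⟩ := h1
      rw [hgb]
      exact ⟨r' * z, by ring⟩
  refine ⟨m, b', hhull, ?_, hb', hI⟩
  rw [residualIdeal, hhull, hI, colon_mul_span_singleton hg0]

end Monomial

end ToroidalNP

namespace ToroidalNP

/-! ### Derivations and formal injectivity of dominant maps -/

section Derivations

open TensorProduct

/-- Formal smoothness kills the first cotangent homology, so L ⊗ Ω[A⁄K] injects into Ω[L⁄K]. As L is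
a field, this injection has a linear retraction, along which the derivation extends. -/
theorem exists_derivation_extending {K A L : Type*} [CommRing K] [CommRing A] [Field L]
    [Algebra K A] [Algebra K L] [Algebra A L] [IsScalarTower K A L] [Algebra.FormallySmooth A L]
    (d : Derivation K A L) : ∃ D : Derivation K L L, ∀ a, D (algebraMap A L a) = d a := by
  have hinj : Function.Injective (KaehlerDifferential.mapBaseChange K A L) := by
    rw [injective_iff_map_eq_zero]
    intro x hx
    obtain ⟨y, rfl⟩ := (Algebra.H1Cotangent.exact_δ_mapBaseChange K A L x).mp hx
    have : Subsingleton (Algebra.H1Cotangent A L) :=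
      Algebra.FormallySmooth.subsingleton_h1Cotangent
    rw [Subsingleton.elim y 0, map_zero]
  obtain ⟨g, hg⟩ := LinearMap.exists_leftInverse_of_injective _ (LinearMap.ker_eq_bot.mpr hinj)
  let ℓ : L ⊗[A] Ω[A⁄K] →ₗ[L] L := TensorProduct.AlgebraTensorModule.lift
    ((LinearMap.toSpanSingleton L (Ω[A⁄K] →ₗ[A] L) d.liftKaehlerDifferential))
  refine ⟨(ℓ ∘ₗ g).compDer (KaehlerDifferential.D K L), fun a => ?_⟩
  have h1 : KaehlerDifferential.D K L (algebraMap A L a) =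
      KaehlerDifferential.mapBaseChange K A L (1 ⊗ₜ KaehlerDifferential.D K A a) := by
    simp
  have h2 := LinearMap.congr_fun hg (1 ⊗ₜ KaehlerDifferential.D K A a)
  simp only [LinearMap.comp_apply, LinearMap.id_apply] at h2
  change ℓ (g (KaehlerDifferential.D K L (algebraMap A L a))) = _
  rw [h1, h2]
  simp [ℓ]

/-- The partial derivative of the polynomial ring extends to L: the fraction field F is a
localization of that ring, and L is formally smooth over F because the characteristic is zero. -/
theorem exists_derivation_of_algebraicIndependent {K L : Type u} [Field K] [CharZero K] [Field L]
    [Algebra K L] [Algebra.EssFiniteType K L] {m : ℕ} {w : Fin m → L}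
    (hw : AlgebraicIndependent K w) (i : Fin m) :
    ∃ D : Derivation K L L, ∀ j, D (w j) = if j = i then 1 else 0 := by
  let A := MvPolynomial (Fin m) K
  let F := FractionRing A
  algebraize [(MvPolynomial.aeval w : A →ₐ[K] L).toRingHom]
  have hst : IsScalarTower K A L := IsScalarTower.of_algebraMap_eq fun r =>
    ((MvPolynomial.aeval w : A →ₐ[K] L).commutes r).symm
  have hinj : Function.Injective (algebraMap A L) := hw
  have hfs : FaithfulSMul A L := (faithfulSMul_iff_algebraMap_injective A L).mpr hinj
  let _ : Algebra F L := FractionRing.liftAlgebra A L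
  have : IsScalarTower A F L := FractionRing.isScalarTower_liftAlgebra A L
  have : IsScalarTower K F L := IsScalarTower.to₁₃₄ K A F L
  have : CharZero F := algebraRat.charZero F
  have : Algebra.EssFiniteType F L := Algebra.EssFiniteType.of_comp K F L
  have : Algebra.FormallySmooth A F := .of_isLocalization (nonZeroDivisors A)
  have : Algebra.FormallySmooth A L := .comp A F L
  obtain ⟨D, hD⟩ := exists_derivation_extending
    ((Algebra.linearMap A L).compDer (MvPolynomial.pderiv (R := K) i))
  refine ⟨D, fun j => ?_⟩
  have h1 : w j = algebraMap A L (MvPolynomial.X j) := by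
    change w j = MvPolynomial.aeval w (MvPolynomial.X j)
    simp
  rw [h1, hD]
  change algebraMap A L (MvPolynomial.pderiv i (MvPolynomial.X j)) = _
  rw [MvPolynomial.pderiv_X, Pi.single_apply]
  by_cases h : j = i <;> simp [h]

/-- Since Ω[S⁄K] is finite, one g clears the denominators of D on a finite set of generators, hence
everywhere. -/
theorem exists_derivation_clearing_denominators {K S L : Type*} [CommRing K] [CommRing S]
    [IsDomain S] [Field L] [Algebra K S] [Algebra S L] [Algebra K L] [IsScalarTower K S L]
    [IsFractionRing S L] [Module.Finite S (Ω[S⁄K])] (D : Derivation K L L) :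
    ∃ (g : S) (D' : Derivation K S S), g ≠ 0 ∧
      ∀ s, algebraMap S L (D' s) = algebraMap S L g * D (algebraMap S L s) := by
  classical
  let ℓ : Ω[S⁄K] →ₗ[S] L := (D.compAlgebraMap S).liftKaehlerDifferential
  have hℓ : ∀ s, ℓ (KaehlerDifferential.D K S s) = D (algebraMap S L s) := fun s => by
    simp [ℓ, Derivation.compAlgebraMap]
  obtain ⟨T, hT⟩ := (Module.Finite.fg_top : (⊤ : Submodule S (Ω[S⁄K])).FG)
  obtain ⟨g, hg⟩ := IsLocalization.exist_integer_multiples_of_finset (nonZeroDivisors S)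
    (T.image ℓ)
  have hint : ∀ x : Ω[S⁄K], ∃ s : S, algebraMap S L s = (g : S) • ℓ x := by
    intro x
    have hx : x ∈ Submodule.span S (T : Set (Ω[S⁄K])) := hT ▸ Submodule.mem_top
    induction hx using Submodule.span_induction with
    | mem x hx => exact hg _ (Finset.mem_image_of_mem ℓ hx)
    | zero => exact ⟨0, by simp⟩
    | add x y _ _ hx hy =>
      obtain ⟨a, ha⟩ := hx
      obtain ⟨b, hb⟩ := hy
      exact ⟨a + b, by rw [map_add, ha, hb, map_add, smul_add]⟩
    | smul c x _ hx =>
      obtain ⟨a, ha⟩ := hx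
      exact ⟨c * a, by rw [map_mul, ha, map_smul, smul_comm, Algebra.smul_def c]⟩
  choose t ht using fun s => hint (KaehlerDifferential.D K S s)
  have ht' : ∀ s, algebraMap S L (t s) = algebraMap S L g * D (algebraMap S L s) := fun s => by
    rw [ht, hℓ, Algebra.smul_def]
  have hinj := IsFractionRing.injective S L
  refine ⟨g, Derivation.mk' { toFun := t, map_add' := ?_, map_smul' := ?_ } ?_,
    nonZeroDivisors.ne_zero g.2, ht'⟩
  · intro a b
    apply hinj
    simp only [map_add, ht', mul_add]
  · intro c a
    apply hinj
    rw [RingHom.id_apply, Algebra.smul_def, Algebra.smul_def, map_mul, ht', ht', map_mul,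
      ← IsScalarTower.algebraMap_apply K S L]
    have h : D (algebraMap K L c * algebraMap S L a) =
        algebraMap K L c * D (algebraMap S L a) := by
      rw [← Algebra.smul_def, D.map_smul, Algebra.smul_def]
    rw [h]
    ring
  · intro a b
    apply hinj
    change algebraMap S L (t (a * b)) = algebraMap S L (a • t b + b • t a)
    simp only [ht', map_mul, map_add, smul_eq_mul, Derivation.leibniz]
    ring

theorem Derivation.mem_pow_of_mem_pow_succ {K S : Type*} [CommRing K] [CommRing S] [Algebra K S]
    (D : Derivation K S S) (I : Ideal S) (n : ℕ) : ∀ s ∈ I ^ (n + 1), D s ∈ I ^ n := by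
  induction n with
  | zero => intro s _; simp
  | succ n ih =>
    intro s hs
    rw [pow_succ] at hs
    induction hs using Submodule.mul_induction_on' with
    | mem_mul_mem a ha b hb =>
      rw [D.leibniz, smul_eq_mul, smul_eq_mul]
      refine add_mem (Ideal.mul_mem_right _ _ ha) ?_
      rw [pow_succ, mul_comm b]
      exact Ideal.mul_mem_mul (ih a ha) hb
    | add a _ b _ ha hb => rw [map_add]; exact add_mem ha hb

variable {K R : Type*} [Field K] [CommRing R] [IsLocalRing R] [Algebra K R]
  [Module.Finite R (Ω[R⁄K])] {m : ℕ} {v : Fin m → R}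

/-- The residue field is K, so every r is a constant plus a combination of the v_j. By Leibniz, dr
lies in the span of the dv_j up to the maximal ideal times Ω, and Nakayama concludes. -/
theorem kaehler_span_eq_top (hv : Ideal.span (Set.range v) = maximalIdeal R)
    (hres : ∀ r : R, ∃ c : K, r - algebraMap K R c ∈ maximalIdeal R) :
    Submodule.span R (Set.range fun j => KaehlerDifferential.D K R (v j)) = ⊤ := by
  rw [eq_top_iff]
  refine Submodule.le_of_le_smul_of_le_jacobson_bot (I := maximalIdeal R)
    Module.Finite.fg_top (IsLocalRing.jacobson_eq_maximalIdeal ⊥ bot_ne_top).ge ?_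
  rw [← KaehlerDifferential.span_range_derivation K R, Submodule.span_le]
  rintro _ ⟨r, rfl⟩
  obtain ⟨c, hc⟩ := hres r
  rw [← hv] at hc
  obtain ⟨b, hb⟩ := (Submodule.mem_span_range_iff_exists_fun R).mp hc
  have h1 : KaehlerDifferential.D K R r = KaehlerDifferential.D K R (∑ j, b j • v j) := by
    rw [hb, map_sub, Derivation.map_algebraMap, sub_zero]
  rw [h1, map_sum]
  refine Submodule.sum_mem _ fun j _ => ?_
  rw [smul_eq_mul, Derivation.leibniz]
  refine Submodule.add_mem_sup (Submodule.smul_mem _ _ (Submodule.subset_span ⟨j, rfl⟩))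
    (Submodule.smul_mem_smul (hv ▸ Ideal.subset_span ⟨j, rfl⟩) ?_)
  rw [KaehlerDifferential.span_range_derivation]
  exact Submodule.mem_top

/-- Differentials of elements of the squared maximal ideal lie in the maximal ideal times Ω. So the
linear coefficients of x are, modulo the maximal ideal, coefficients of dx; in particular a unit
coefficient remains a unit. -/
theorem kaehler_eq_sum (hv : Ideal.span (Set.range v) = maximalIdeal R)
    (hres : ∀ r : R, ∃ c : K, r - algebraMap K R c ∈ maximalIdeal R) (a : Fin m → R) (x : R)
    (hx : x - ∑ j, a j * v j ∈ maximalIdeal R ^ 2) :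
    ∃ r : Fin m → R, (∀ j, r j - a j ∈ maximalIdeal R) ∧
      KaehlerDifferential.D K R x = ∑ j, r j • KaehlerDifferential.D K R (v j) := by
  have hvm : ∀ j, v j ∈ maximalIdeal R := fun j => hv ▸ Ideal.subset_span ⟨j, rfl⟩
  have hsq : ∀ y ∈ maximalIdeal R ^ 2, KaehlerDifferential.D K R y ∈
      maximalIdeal R • (⊤ : Submodule R (Ω[R⁄K])) := by
    intro y hy
    rw [pow_two] at hy
    induction hy using Submodule.mul_induction_on' with
    | mem_mul_mem a ha b hb =>
      rw [Derivation.leibniz]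
      exact add_mem (Submodule.smul_mem_smul ha trivial) (Submodule.smul_mem_smul hb trivial)
    | add a _ b _ ha hb => rw [map_add]; exact add_mem ha hb
  have h1 : KaehlerDifferential.D K R x - ∑ j, a j • KaehlerDifferential.D K R (v j) ∈
      maximalIdeal R • (⊤ : Submodule R (Ω[R⁄K])) := by
    have h2 : KaehlerDifferential.D K R x - ∑ j, a j • KaehlerDifferential.D K R (v j) =
        KaehlerDifferential.D K R (x - ∑ j, a j * v j) +
          ∑ j, v j • KaehlerDifferential.D K R (a j) := by
      rw [map_sub, map_sum]
      simp only [Derivation.leibniz, Finset.sum_add_distrib]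
      abel
    rw [h2]
    exact add_mem (hsq _ hx) (Submodule.sum_mem _ fun j _ =>
      Submodule.smul_mem_smul (hvm j) trivial)
  rw [← kaehler_span_eq_top hv hres, Submodule.mem_ideal_smul_span_iff_exists_sum] at h1
  obtain ⟨μ, hμ, hsum⟩ := h1
  refine ⟨fun j => a j + μ j, fun j => by simpa using hμ j, ?_⟩
  simp only [add_smul, Finset.sum_add_distrib]
  rw [← sub_eq_iff_eq_add', ← hsum, Finsupp.sum_fintype _ _ (by simp)]

end Derivations

/-! ### First-order formal injectivity of dominant maps -/

section FormalInjectivity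

variable {K R S : Type u} [Field K] [CharZero K] [CommRing R] [IsLocalRing R] [Algebra K R]
  [Module.Finite R (Ω[R⁄K])] [CommRing S] [IsLocalRing S] [IsDomain S] [IsNoetherianRing S]
  [Algebra K S] [Algebra.EssFiniteType K S] [Algebra R S] [IsScalarTower K R S]

/-- A formal function killed by a dominant map has vanishing linear part. -/
theorem mem_sq_of_forall_mem_pow {m : ℕ} {v : Fin m → R}
    (hv : Ideal.span (Set.range v) = maximalIdeal R)
    (hres : ∀ r : R, ∃ c : K, r - algebraMap K R c ∈ maximalIdeal R)
    (hind : AlgebraicIndependent K fun j => algebraMap R S (v j)) (h : ℕ → R)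
    (h0 : h 0 ∈ maximalIdeal R) (hh : ∀ n, h n - h 0 ∈ maximalIdeal R ^ 2)
    (hS : ∀ n, algebraMap R S (h n) ∈ maximalIdeal S ^ n) : h 0 ∈ maximalIdeal R ^ 2 := by
  rw [← hv] at h0
  obtain ⟨a, ha⟩ := (Submodule.mem_span_range_iff_exists_fun R).mp h0
  by_contra hcon
  obtain ⟨i, hi⟩ : ∃ i, a i ∉ maximalIdeal R := by
    by_contra! hc
    apply hcon
    rw [← ha, pow_two]
    exact Ideal.sum_mem _ fun j _ =>
      Ideal.mul_mem_mul (hc j) (hv ▸ Ideal.subset_span ⟨j, rfl⟩)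
  let L := FractionRing S
  have hind' : AlgebraicIndependent K fun j => algebraMap S L (algebraMap R S (v j)) :=
    hind.map' (f := IsScalarTower.toAlgHom K S L) (IsFractionRing.injective S L)
  have : Algebra.EssFiniteType S L := Algebra.EssFiniteType.of_isLocalization _ (nonZeroDivisors S)
  have : Algebra.EssFiniteType K L := Algebra.EssFiniteType.comp K S L
  -- A vector field dual to the parameter v_i whose coefficient in `h 0` is a unit.
  obtain ⟨D, hD⟩ := exists_derivation_of_algebraicIndependent hind' i
  obtain ⟨g, D', hg, hD'⟩ := exists_derivation_clearing_denominators (S := S) D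
  apply hg
  -- `D'` sends the image of `h (n + 1)` to a unit times g and lowers the adic order by at most one.
  -- Hence g lies in every power of the maximal ideal and vanishes by Krull's intersection theorem.
  have hinf : g ∈ ⨅ n : ℕ, maximalIdeal S ^ n := by
    rw [Ideal.mem_iInf]
    intro n
    obtain ⟨r, hr, hr'⟩ := kaehler_eq_sum hv hres a (h (n + 1)) (by
      have := hh (n + 1)
      rw [← ha] at this
      exact this)
    have h1 : D' (algebraMap R S (h (n + 1))) = algebraMap R S (r i) * g := by
      let ℓ := (D'.compAlgebraMap R).liftKaehlerDifferential
      have h2 := congrArg ℓ hr'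
      have h3 : ∀ x, ℓ (KaehlerDifferential.D K R x) = D' (algebraMap R S x) := fun x => by
        simp [ℓ, Derivation.compAlgebraMap]
      rw [map_sum, h3] at h2
      rw [h2, Finset.sum_eq_single i]
      · rw [map_smul, h3, Algebra.smul_def]
        congr 1
        apply IsFractionRing.injective S L
        rw [hD', hD, if_pos rfl, mul_one]
      · intro j _ hj
        rw [map_smul, h3]
        have : D' (algebraMap R S (v j)) = 0 := by
          apply IsFractionRing.injective S L
          rw [hD', hD, if_neg hj, mul_zero, map_zero]
        rw [this, smul_zero]
      · simp
    have hu : IsUnit (r i) := by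
      by_contra hnu
      apply hi
      have := sub_mem ((mem_maximalIdeal _).mpr hnu) (hr i)
      simpa using this
    have h4 := Derivation.mem_pow_of_mem_pow_succ D' (maximalIdeal S) n _ (hS (n + 1))
    rw [h1] at h4
    exact (Ideal.unit_mul_mem_iff_mem _ (hu.map _)).mp h4
  rwa [Ideal.iInf_pow_eq_bot_of_isLocalRing _ (maximalIdeal.isMaximal S).ne_top,
    Ideal.mem_bot] at hinf

end FormalInjectivity

end ToroidalNP

namespace ToroidalNP

/-! ### Power series -/

section PowerSeries

open MvPowerSeries Finsupp

/-- The order for the weight concentrated at i is the order of vanishing along X_i. It is additive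
on products, which is what makes X_i prime. -/
theorem powerSeries_X_dvd_iff {σ K : Type*} [Field K] (i : σ) (φ : MvPowerSeries σ K) :
    X i ∣ φ ↔ φ.weightedOrder (Finsupp.single i 1) ≠ 0 := by
  classical
  rw [X_dvd_iff, ← pos_iff_ne_zero, ← Order.one_le_iff_pos]
  have hw : ∀ m : σ →₀ ℕ, Finsupp.weight (Finsupp.single i 1 : σ →₀ ℕ) m = m i := by
    intro m
    rw [Finsupp.weight_apply, Finsupp.sum, Finset.sum_eq_single i]
    · simp
    · intro j _ hj
      simp [Ne.symm hj]
    · intro h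
      simp [Finsupp.notMem_support_iff.mp h]
  constructor
  · intro h
    refine le_weightedOrder _ (n := 1) fun m hm => h m ?_
    rw [hw] at hm
    exact_mod_cast (by simpa using hm : m i = 0)
  · intro h m hm
    refine coeff_eq_zero_of_lt_weightedOrder (w := (Finsupp.single i 1 : σ →₀ ℕ)) ?_
    rw [hw, hm]
    exact lt_of_lt_of_le (by simp) h

theorem powerSeries_X_prime {σ K : Type*} [Field K] (i : σ) :
    Prime (X i : MvPowerSeries σ K) := by
  refine ⟨?_, ?_, ?_⟩
  · intro h
    have := congrArg (coeff (Finsupp.single i 1)) h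
    simp at this
  · intro h
    rw [isUnit_iff_constantCoeff] at h
    simp at h
  · intro a b hab
    rw [powerSeries_X_dvd_iff, weightedOrder_mul] at hab
    rw [powerSeries_X_dvd_iff, powerSeries_X_dvd_iff]
    by_contra! h
    exact hab (by rw [h.1, h.2, add_zero])

/-- The coefficients of the linear part of a power series. -/
noncomputable def linCoeff {d : ℕ} {K : Type*} [Field K] (k : Fin d)
    (φ : MvPowerSeries (Fin d) K) : K :=
  constantCoeff (pderiv K k φ)

section LinCoeff

variable {d : ℕ} {K : Type*} [Field K] (k : Fin d)

theorem linCoeff_add (φ ψ : MvPowerSeries (Fin d) K) :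
    linCoeff k (φ + ψ) = linCoeff k φ + linCoeff k ψ := by
  simp [linCoeff]

theorem linCoeff_sub (φ ψ : MvPowerSeries (Fin d) K) :
    linCoeff k (φ - ψ) = linCoeff k φ - linCoeff k ψ := by
  simp [linCoeff]

theorem linCoeff_sum {ι : Type*} (s : Finset ι) (φ : ι → MvPowerSeries (Fin d) K) :
    linCoeff k (∑ i ∈ s, φ i) = ∑ i ∈ s, linCoeff k (φ i) := by
  simp [linCoeff]

theorem linCoeff_mul (φ ψ : MvPowerSeries (Fin d) K) :
    linCoeff k (φ * ψ) =
      constantCoeff φ * linCoeff k ψ + constantCoeff ψ * linCoeff k φ := by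
  simp [linCoeff]

theorem linCoeff_C (c : K) : linCoeff k (C c : MvPowerSeries (Fin d) K) = 0 := by
  simp [linCoeff]

theorem linCoeff_one : linCoeff k (1 : MvPowerSeries (Fin d) K) = 0 := by
  simp [linCoeff]

theorem linCoeff_X (i : Fin d) :
    linCoeff k (X i : MvPowerSeries (Fin d) K) = if k = i then 1 else 0 := by
  classical
  rw [linCoeff, pderiv_X, Pi.single_apply]
  by_cases h : k = i
  · simp [h]
  · simp [h, Ne.symm h]

theorem linCoeff_eq_zero_of_mem_sq {I : Ideal (MvPowerSeries (Fin d) K)}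
    (hI : ∀ φ ∈ I, constantCoeff φ = 0) {φ : MvPowerSeries (Fin d) K} (h : φ ∈ I ^ 2) :
    linCoeff k φ = 0 := by
  rw [pow_two] at h
  induction h using Submodule.mul_induction_on' with
  | mem_mul_mem a ha b hb => rw [linCoeff_mul, hI a ha, hI b hb]; simp
  | add a _ b _ ha hb => rw [linCoeff_add, ha, hb, add_zero]

end LinCoeff

theorem aeval_pderiv_chain {K A : Type*} [CommRing K] [CommRing A] [Algebra K A] {m : ℕ}
    (D : Derivation K A A) (g : Fin m → A) (P : MvPolynomial (Fin m) K) :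
    D (MvPolynomial.aeval g P) =
      ∑ j, MvPolynomial.aeval g (MvPolynomial.pderiv j P) * D (g j) := by
  induction P using MvPolynomial.induction_on with
  | C a => simp
  | add p q hp hq => simp only [map_add, hp, hq, add_mul, Finset.sum_add_distrib]
  | mul_X p i hp =>
    rw [map_mul, D.leibniz, hp, MvPolynomial.aeval_X]
    simp only [MvPolynomial.pderiv_mul, map_add, map_mul, MvPolynomial.aeval_X, add_mul,
      Finset.sum_add_distrib, smul_eq_mul, Finset.mul_sum, MvPolynomial.pderiv_X]
    rw [Finset.sum_eq_single (s := Finset.univ) (a := i)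
      (f := fun j => MvPolynomial.aeval g p * MvPolynomial.aeval g
        ((Pi.single j 1 : Fin m → MvPolynomial (Fin m) K) i) * D (g j))]
    · rw [Pi.single_eq_same, map_one, mul_one, add_comm]
      congr 1
      exact Finset.sum_congr rfl fun j _ => by ring
    · intro j _ hj
      rw [Pi.single_eq_of_ne (Ne.symm hj)]
      simp
    · simp

/-- Power series with linearly independent linear parts are algebraically independent. -/
theorem algebraicIndependent_of_linCoeff {K : Type*} [Field K] [CharZero K] {m d : ℕ}
    (g : Fin m → MvPowerSeries (Fin d) K)
    (hg : ∀ c : Fin m → K, (∀ k, ∑ j, c j * linCoeff k (g j) = 0) → c = 0) :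
    AlgebraicIndependent K g := by
  classical
  let f : (Fin m → K) →ₗ[K] (Fin d → K) :=
    { toFun := fun c k => ∑ j, c j * linCoeff k (g j)
      map_add' := fun a b => by
        funext k
        simp [add_mul, Finset.sum_add_distrib]
      map_smul' := fun r a => by
        funext k
        simp [Finset.mul_sum, mul_assoc] }
  have hf : LinearMap.ker f = ⊥ := by
    rw [LinearMap.ker_eq_bot']
    exact fun c hc => hg c fun k => congrFun hc k
  obtain ⟨h, hh⟩ := LinearMap.exists_leftInverse_of_injective f hf
  -- A right inverse of the matrix of linear coefficients.
  let B : Matrix (Fin d) (Fin m) K := fun k l => h (Pi.single k 1) l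
  have hMB : ∀ j l, ∑ k, linCoeff k (g j) * B k l = if j = l then 1 else 0 := by
    intro j l
    have h1 : f (Pi.single j 1) = ∑ k, linCoeff k (g j) • (Pi.single k 1 : Fin d → K) := by
      funext k
      simp [f, Pi.single_apply]
    have h2 := LinearMap.congr_fun hh (Pi.single j 1)
    rw [LinearMap.comp_apply, h1, map_sum] at h2
    have h3 := congrFun h2 l
    simp only [map_smul, Finset.sum_apply, Pi.smul_apply, smul_eq_mul, LinearMap.id_apply,
      Pi.single_apply] at h3
    simpa [B, eq_comm] using h3
  -- The Jacobian matrix of g times `B`: its constant term is the identity, so its determinant is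
  -- nonzero.
  let N : Matrix (Fin m) (Fin m) (MvPowerSeries (Fin d) K) :=
    fun j l => ∑ k, pderiv K k (g j) * C (B k l)
  have hN : N.det ≠ 0 := by
    intro h0
    have h1 : (constantCoeff (σ := Fin d) (R := K)).mapMatrix N = 1 := by
      ext j l
      rw [Matrix.one_apply, ← hMB j l]
      change constantCoeff (N j l) = _
      simp [N, linCoeff]
    have h2 := congrArg (constantCoeff (σ := Fin d) (R := K)) h0
    rw [RingHom.map_det, h1, Matrix.det_one, map_zero] at h2
    exact one_ne_zero h2
  -- Induction on the degree. Differentiating a relation and cancelling the Jacobian gives relations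
  -- for the partial derivatives, of lower degree; these vanish by induction, so P is constant in
  -- characteristic zero.
  suffices ∀ (n : ℕ) (P : MvPolynomial (Fin m) K), P.totalDegree ≤ n →
      MvPolynomial.aeval g P = 0 → P = 0 by
    rw [AlgebraicIndependent, injective_iff_map_eq_zero]
    exact fun P hP => this _ P le_rfl hP
  intro n
  induction n with
  | zero =>
    intro P hP h0
    rw [Nat.le_zero, MvPolynomial.totalDegree_eq_zero_iff_eq_C] at hP
    rw [hP, MvPolynomial.aeval_C] at h0
    have h1 := congrArg (constantCoeff (σ := Fin d) (R := K)) h0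
    rw [MvPowerSeries.algebraMap_apply, Algebra.algebraMap_self_apply, constantCoeff_C,
      map_zero] at h1
    rw [hP, h1, MvPolynomial.C_0]
  | succ n ih =>
    intro P hP h0
    have hder : ∀ j, MvPolynomial.aeval g (MvPolynomial.pderiv j P) = 0 := by
      have h1 : Matrix.vecMul (fun j => MvPolynomial.aeval g (MvPolynomial.pderiv j P)) N = 0 := by
        funext l
        simp only [Matrix.vecMul, dotProduct, N, Finset.mul_sum, Pi.zero_apply]
        rw [Finset.sum_comm]
        refine Finset.sum_eq_zero fun k _ => ?_
        have h2 := aeval_pderiv_chain (pderiv K k) g P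
        rw [h0, map_zero] at h2
        simp only [← mul_assoc]
        rw [← Finset.sum_mul, ← h2, zero_mul]
      exact fun j => congrFun (Matrix.eq_zero_of_vecMul_eq_zero hN h1) j
    have hder' : ∀ j, MvPolynomial.pderiv j P = 0 := by
      intro j
      refine ih _ ?_ (hder j)
      refine Finset.sup_le fun s hs => ?_
      rw [MvPolynomial.mem_support_iff, MvPolynomial.coeff_pderiv] at hs
      have h1 := MvPolynomial.le_totalDegree (p := P) (s := s + Finsupp.single j 1)
        (MvPolynomial.mem_support_iff.mpr (left_ne_zero_of_mul hs))
      rw [Finsupp.sum_add_index' (by simp) (by simp), Finsupp.sum_single_index rfl] at h1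
      exact Nat.le_of_succ_le_succ (h1.trans hP)
    refine ih P ?_ h0
    refine Finset.sup_le fun s hs => ?_
    rw [MvPolynomial.mem_support_iff] at hs
    by_cases hs0 : s = 0
    · simp [hs0]
    obtain ⟨j, hj⟩ := Finsupp.ne_iff.mp hs0
    exfalso
    have h1 := congrArg (MvPolynomial.coeff (s - Finsupp.single j 1)) (hder' j)
    have hle : Finsupp.single j 1 ≤ s := by
      rw [Finsupp.single_le_iff]
      exact Nat.one_le_iff_ne_zero.mpr hj
    rw [MvPolynomial.coeff_pderiv, tsub_add_cancel_of_le hle, MvPolynomial.coeff_zero] at h1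
    rcases mul_eq_zero.mp h1 with h2 | h2
    · exact hs h2
    · have : (((s - Finsupp.single j 1 : Fin m →₀ ℕ) j + 1 : ℕ) : K) ≠ 0 := Nat.cast_ne_zero.mpr (by omega)
      exact this (by exact_mod_cast h2)

end PowerSeries

/-! ### Extending ring homomorphisms to completions -/

section CompletedLift

variable {R : Type*} [CommRing R] [IsLocalRing R]

theorem factorPow_comp_quotientMap_comp_evalₐ {P : Type*} [CommRing P] {I : Ideal P} (f : R →+* P)
    (hf : ∀ n, maximalIdeal R ^ n ≤ (I ^ n).comap f) {m n : ℕ} (hle : m ≤ n) :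
    (Ideal.Quotient.factorPow I hle).comp ((Ideal.quotientMap (I ^ n) f (hf n)).comp
        (AdicCompletion.evalₐ (maximalIdeal R) n : Completed R →+* R ⧸ maximalIdeal R ^ n)) =
      (Ideal.quotientMap (I ^ m) f (hf m)).comp
        (AdicCompletion.evalₐ (maximalIdeal R) m : Completed R →+* R ⧸ maximalIdeal R ^ m) := by
  ext x
  obtain ⟨y, rfl⟩ := AdicCompletion.mk_surjective (maximalIdeal R) R x
  simp only [RingHom.comp_apply, RingHom.coe_coe, AdicCompletion.evalₐ_mk]
  rw [← AdicCompletion.Ideal.mk_eq_mk _ hle]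
  rfl

theorem exists_completed_lift {P : Type*} [CommRing P] (I : Ideal P) [IsAdicComplete I P]
    (f : R →+* P) (hf : (maximalIdeal R).map f ≤ I) :
    ∃ F : Completed R →+* P, ∀ r, F (algebraMap R (Completed R) r) = f r := by
  have hpow : ∀ n, maximalIdeal R ^ n ≤ (I ^ n).comap f := fun n => by
    rw [← Ideal.map_le_iff_le_comap, Ideal.map_pow]
    exact Ideal.pow_right_mono hf n
  have hcompat := fun {m n : ℕ} (hle : m ≤ n) => factorPow_comp_quotientMap_comp_evalₐ f hpow hle
  refine ⟨IsAdicComplete.liftRingHom I _ hcompat, fun r => ?_⟩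
  have : IsHausdorff I P := inferInstance
  rw [← sub_eq_zero]
  refine this.haus _ fun n => ?_
  rw [SModEq.zero, smul_eq_mul, Ideal.mul_top, ← Ideal.Quotient.eq_zero_iff_mem, map_sub,
    IsAdicComplete.mk_liftRingHom, sub_eq_zero]
  change Ideal.quotientMap (I ^ n) f (hpow n) (AdicCompletion.evalₐ (maximalIdeal R) n
    (algebraMap R (Completed R) r)) = _
  rw [AlgHom.commutes]
  rfl

theorem evalₐ_completedMap {S : Type*} [CommRing S] [IsLocalRing S] (f : R →+* S)
    [IsLocalHom f] (n : ℕ) (x : Completed R) :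
    AdicCompletion.evalₐ (maximalIdeal S) n (completedMap f x) =
      Ideal.quotientMap (maximalIdeal S ^ n) f (pow_maximalIdeal_le_comap f n)
        (AdicCompletion.evalₐ (maximalIdeal R) n x) := by
  unfold completedMap
  rw [AdicCompletion.evalₐ_liftRingHom]
  · rfl
  · exact fun hle => factorPow_comp_quotientMap_comp_evalₐ f (pow_maximalIdeal_le_comap f) hle

theorem completedMap_algebraMap {S : Type*} [CommRing S] [IsLocalRing S] (f : R →+* S)
    [IsLocalHom f] (r : R) :
    completedMap f (algebraMap R (Completed R) r) = algebraMap S (Completed S) (f r) := by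
  apply AdicCompletion.ext_evalₐ
  intro n
  rw [AlgHom.commutes, evalₐ_completedMap, AlgHom.commutes]
  rfl

end CompletedLift

end ToroidalNP

namespace ToroidalNP

/-! ### Powers of the maximal ideal of a completion -/

section CompletedIdeal

variable {R : Type*} [CommRing R] [IsLocalRing R] [IsNoetherianRing R]

theorem mem_maximalIdeal_pow_completed_iff (n : ℕ) (z : Completed R) :
    z ∈ maximalIdeal (Completed R) ^ n ↔ AdicCompletion.evalₐ (maximalIdeal R) n z = 0 := by
  rw [AdicCompletion.maximalIdeal_eq_map, ← Ideal.map_pow, ← Submodule.restrictScalars_mem R,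
    ← Ideal.smul_top_eq_map,
    AdicCompletion.pow_smul_top_eq_ker_eval (maximalIdeal R).fg_of_isNoetherianRing]
  obtain ⟨y, rfl⟩ := AdicCompletion.mk_surjective (maximalIdeal R) R z
  rw [AdicCompletion.evalₐ_mk, LinearMap.mem_ker, Ideal.Quotient.eq_zero_iff_mem]
  change Submodule.Quotient.mk (y n) = 0 ↔ _
  rw [Submodule.Quotient.mk_eq_zero, smul_eq_mul, Ideal.mul_top]

theorem algebraMap_mem_maximalIdeal_pow_completed_iff (n : ℕ) (r : R) :
    algebraMap R (Completed R) r ∈ maximalIdeal (Completed R) ^ n ↔ r ∈ maximalIdeal R ^ n := by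
  rw [mem_maximalIdeal_pow_completed_iff, AdicCompletion.evalₐ]
  change AdicCompletion.evalₐ (maximalIdeal R) n (algebraMap R (Completed R) r) = 0 ↔ _
  rw [AlgHom.commutes]
  exact Ideal.Quotient.eq_zero_iff_mem

theorem algebraMap_mem_maximalIdeal_completed_iff (r : R) :
    algebraMap R (Completed R) r ∈ maximalIdeal (Completed R) ↔ r ∈ maximalIdeal R := by
  have := algebraMap_mem_maximalIdeal_pow_completed_iff 1 r
  rwa [pow_one, pow_one] at this

end CompletedIdeal

/-! ### The coordinate ring of a nonsingular affine toric variety -/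

section Toric

variable {d n : ℕ}

/-- The `i`-th standard generator of the semigroup of a regular cone. -/
def toricBasis (d n : ℕ) (i : Fin d) : toricMonoid d n :=
  ⟨Pi.single i 1, fun j _ => by
    by_cases h : j = i
    · subst h; simp
    · simp [h]⟩

/-- The inverse of the `i`-th standard generator, if it is invertible. -/
def toricBasisNeg (d n : ℕ) (i : Fin d) (hi : n ≤ i.val) : toricMonoid d n :=
  ⟨Pi.single i (-1), fun j hj => by
    rw [Pi.single_eq_of_ne]
    rintro rfl
    omega⟩

theorem toricBasis_add_toricBasisNeg (i : Fin d) (hi : n ≤ i.val) :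
    toricBasis d n i + toricBasisNeg d n i hi = 0 := by
  ext j
  by_cases h : j = i
  · subst h; simp [toricBasis, toricBasisNeg]
  · simp [toricBasis, toricBasisNeg, h]

theorem toricMonoid_induction {p : toricMonoid d n → Prop} (zero : p 0)
    (add : ∀ s t, p s → p t → p (s + t)) (basis : ∀ i, p (toricBasis d n i))
    (neg : ∀ i hi, p (toricBasisNeg d n i hi)) (s : toricMonoid d n) : p s := by
  have hn : ∀ (k : ℕ) t, p t → p (k • t) := by
    intro k t ht
    induction k with
    | zero => simpa using zero
    | succ k ih => rw [succ_nsmul]; exact add _ _ ih ht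
  have hsum : ∀ (S : Finset (Fin d)) (g : Fin d → toricMonoid d n), (∀ i, p (g i)) →
      p (∑ i ∈ S, g i) := fun S g hg =>
    Finset.sum_induction g p add zero fun i _ => hg i
  -- Coordinates with index below n are nonnegative; the others split into positive and negative
  -- parts.
  have hs : s = ∑ i, ((s.1 i).toNat • toricBasis d n i +
      if hi : n ≤ i.val then (-s.1 i).toNat • toricBasisNeg d n i hi else 0) := by
    ext j
    rw [AddSubmonoid.coe_finsetSum, Finset.sum_apply, Finset.sum_eq_single j]
    · by_cases hj : n ≤ j.val
      · simp [hj, toricBasis, toricBasisNeg]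
        omega
      · have := s.2 j (by omega)
        simp [hj, toricBasis, this]
    · intro i _ hij
      by_cases hi : n ≤ i.val
      · simp [hi, toricBasis, toricBasisNeg, hij.symm]
      · simp [hi, toricBasis, hij.symm]
    · simp
  rw [hs]
  refine hsum _ _ fun i => add _ _ (hn _ _ (basis i)) ?_
  split_ifs with hi
  · exact hn _ _ (neg i hi)
  · exact zero

instance toricMonoid_fg (d n : ℕ) : AddMonoid.FG (toricMonoid d n) := by
  classical
  refine ⟨⟨Finset.univ.image (toricBasis d n) ∪ Finset.univ.image
    (fun i : Fin d => if hi : n ≤ i.val then toricBasisNeg d n i hi else 0), ?_⟩⟩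
  refine (AddSubmonoid.eq_top_iff' _).mpr fun s => ?_
  induction s using toricMonoid_induction with
  | zero => exact zero_mem _
  | add s t hs ht => exact add_mem hs ht
  | basis i => exact AddSubmonoid.subset_closure (by simp)
  | neg i hi =>
    refine AddSubmonoid.subset_closure ?_
    simp only [Finset.coe_union, Finset.coe_image, Finset.coe_univ, Set.image_univ]
    exact Or.inr ⟨i, by simp [hi]⟩

variable (K : Type u) [Field K]

instance toricRing_finiteType (d n : ℕ) : Algebra.FiniteType K (ToricRing K d n) :=
  inferInstance

instance toricRing_isNoetherianRing (d n : ℕ) : IsNoetherianRing (ToricRing K d n) :=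
  Algebra.FiniteType.isNoetherianRing K _

/-- The character `χ^s`. -/
noncomputable def toricChar {d n : ℕ} (s : toricMonoid d n) : ToricRing K d n := AddMonoidAlgebra.single s 1

theorem toricChar_zero : toricChar K (0 : toricMonoid d n) = 1 := rfl

theorem toricChar_add (s t : toricMonoid d n) :
    toricChar K (s + t) = toricChar K s * toricChar K t := by
  simp [toricChar, AddMonoidAlgebra.single_mul_single]

theorem toricChar_isUnit (i : Fin d) (hi : n ≤ i.val) :
    IsUnit (toricChar K (toricBasis d n i)) := by
  refine IsUnit.of_mul_eq_one (toricChar K (toricBasisNeg d n i hi)) ?_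
  rw [← toricChar_add, toricBasis_add_toricBasisNeg, toricChar_zero]

theorem toricMap_toricChar {m l : ℕ} (γ : toricMonoid m l →+ toricMonoid d n)
    (s : toricMonoid m l) : toricMap K γ (toricChar K s) = toricChar K (γ s) := by
  simp [toricMap, toricChar]

theorem toricMap_algebraMap {m l : ℕ} (γ : toricMonoid m l →+ toricMonoid d n) (c : K) :
    toricMap K γ (algebraMap K _ c) = algebraMap K _ c := by
  simp [toricMap]

theorem toricRing_induction {p : ToricRing K d n → Prop} (x : ToricRing K d n)
    (char : ∀ s, p (toricChar K s)) (add : ∀ a b, p a → p b → p (a + b))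
    (smul : ∀ (c : K) a, p a → p (algebraMap K _ c * a)) : p x := by
  induction x using AddMonoidAlgebra.induction_linear with
  | zero => simpa using smul 0 _ (char 0)
  | add a b ha hb => exact add _ _ ha hb
  | single s c =>
    have : (AddMonoidAlgebra.single s c : ToricRing K d n) =
        algebraMap K _ c * toricChar K s := by
      rw [← Algebra.smul_def, toricChar]
      simp
    rw [this]
    exact smul _ _ (char s)

variable {K}

theorem toricBasis_mem_of_toricChar_mem (P : Ideal (ToricRing K d n)) [P.IsPrime]
    (s : toricMonoid d n) (hs : toricChar K s ∈ P) :
    ∃ i : Fin d, i.val < n ∧ toricChar K (toricBasis d n i) ∈ P := by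
  induction s using toricMonoid_induction with
  | zero =>
    rw [toricChar_zero] at hs
    exact absurd ((Ideal.eq_top_iff_one _).mpr hs) ‹P.IsPrime›.ne_top
  | add s t ihs iht =>
    rw [toricChar_add] at hs
    exact (‹P.IsPrime›.mem_or_mem hs).elim ihs iht
  | basis i =>
    by_cases hi : i.val < n
    · exact ⟨i, hi, hs⟩
    · exact absurd (Ideal.eq_top_of_isUnit_mem _ hs (toricChar_isUnit K i (not_lt.mp hi)))
        ‹P.IsPrime›.ne_top
  | neg i hi =>
    refine absurd ((Ideal.eq_top_iff_one _).mpr ?_) ‹P.IsPrime›.ne_top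
    rw [← toricChar_zero, ← toricBasis_add_toricBasisNeg i hi, toricChar_add]
    exact P.mul_mem_left _ hs

/-- This membership and the upper bound `boundaryIdeal_le` are all that is needed of the boundary
ideal, which is never computed. At a point off the torus some character vanishes, hence so does one
of the first n basis characters. -/
theorem prod_toricChar_mem_boundaryIdeal :
    ∏ i with i.val < n, toricChar K (toricBasis d n i) ∈ boundaryIdeal K d n := by
  rw [boundaryIdeal, PrimeSpectrum.mem_vanishingIdeal]
  intro x hx
  simp only [torus, Set.mem_compl_iff, Set.mem_ofPred_eq, not_forall, not_not] at hx
  obtain ⟨s, hs⟩ := hx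
  obtain ⟨i, hi, h⟩ := toricBasis_mem_of_toricChar_mem x.asIdeal s hs
  exact Ideal.mem_of_dvd _ (Finset.dvd_prod_of_mem _ (by simpa using hi)) h

theorem boundaryIdeal_le (P : Ideal (ToricRing K d n)) [P.IsPrime] {s : toricMonoid d n}
    (hs : toricChar K s ∈ P) : boundaryIdeal K d n ≤ P := by
  intro a ha
  rw [boundaryIdeal, PrimeSpectrum.mem_vanishingIdeal] at ha
  refine ha ⟨P, ‹_›⟩ ?_
  simp only [torus, Set.mem_compl_iff, Set.mem_ofPred_eq, not_forall, not_not]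
  exact ⟨s, hs⟩

/-- A closed point of a toric variety over an algebraically closed field is a character. -/
theorem exists_eval_of_isMaximal [IsAlgClosed K] (pt : Ideal (ToricRing K d n))
    [hpt : pt.IsMaximal] :
    ∃ ε : ToricRing K d n →ₐ[K] K, ∀ a, ε a = 0 ↔ a ∈ pt := by
  let : Field (ToricRing K d n ⧸ pt) := Ideal.Quotient.field pt
  have : Module.Finite K (ToricRing K d n ⧸ pt) := finite_of_finite_type_of_isJacobsonRing _ _
  let e := AlgEquiv.ofBijective (Algebra.ofId K (ToricRing K d n ⧸ pt))
    IsAlgClosed.algebraMap_bijective_of_isIntegral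
  refine ⟨(e.symm : _ →ₐ[K] K).comp (Ideal.Quotient.mkₐ K pt), fun a => ?_⟩
  simp [Ideal.Quotient.eq_zero_iff_mem]

/-- That a - ε(a) lies in the span passes from basis characters to products, inverses and linear
combinations. So a closed point is cut out by d translated coordinates. -/
theorem span_toricBasis_sub (ε : ToricRing K d n →ₐ[K] K) (a : ToricRing K d n) (ha : ε a = 0) :
    a ∈ Ideal.span (Set.range fun i => toricChar K (toricBasis d n i) -
      algebraMap K _ (ε (toricChar K (toricBasis d n i)))) := by
  set T := Ideal.span (Set.range fun i => toricChar K (toricBasis d n i) -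
      algebraMap K (ToricRing K d n) (ε (toricChar K (toricBasis d n i)))) with hT
  have hb : ∀ i, toricChar K (toricBasis d n i) -
      algebraMap K _ (ε (toricChar K (toricBasis d n i))) ∈ T :=
    fun i => Ideal.subset_span ⟨i, rfl⟩
  have h1 : ∀ s, toricChar K s - algebraMap K _ (ε (toricChar K s)) ∈ T := by
    intro s
    induction s using toricMonoid_induction with
    | zero => rw [toricChar_zero, map_one, map_one, sub_self]; exact zero_mem _
    | add s t hs ht =>
      have : toricChar K (s + t) - algebraMap K _ (ε (toricChar K (s + t))) =
          toricChar K s * (toricChar K t - algebraMap K _ (ε (toricChar K t))) +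
          algebraMap K _ (ε (toricChar K t)) *
            (toricChar K s - algebraMap K _ (ε (toricChar K s))) := by
        rw [toricChar_add, map_mul, map_mul]
        ring
      rw [this]
      exact add_mem (T.mul_mem_left _ ht) (T.mul_mem_left _ hs)
    | basis i => exact hb i
    | neg i hi =>
      have h2 : toricChar K (toricBasis d n i) * toricChar K (toricBasisNeg d n i hi) = 1 := by
        rw [← toricChar_add, toricBasis_add_toricBasisNeg, toricChar_zero]
      have h3 := congrArg (fun z => algebraMap K (ToricRing K d n) (ε z)) h2
      simp only [map_mul, map_one] at h3
      have : toricChar K (toricBasisNeg d n i hi) -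
          algebraMap K _ (ε (toricChar K (toricBasisNeg d n i hi))) =
          -(toricChar K (toricBasisNeg d n i hi) *
            algebraMap K _ (ε (toricChar K (toricBasisNeg d n i hi)))) *
            (toricChar K (toricBasis d n i) -
              algebraMap K _ (ε (toricChar K (toricBasis d n i)))) := by
        linear_combination (-toricChar K (toricBasisNeg d n i hi)) * h3 +
          (algebraMap K _ (ε (toricChar K (toricBasisNeg d n i hi)))) * h2
      rw [this]
      exact T.mul_mem_left _ (hb i)
  have h2 : ∀ a, a - algebraMap K _ (ε a) ∈ T := by
    intro a
    induction a using toricRing_induction with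
    | char s => exact h1 s
    | add a b iha ihb =>
      have : a + b - algebraMap K _ (ε (a + b)) =
          (a - algebraMap K _ (ε a)) + (b - algebraMap K _ (ε b)) := by
        rw [map_add, map_add]; ring
      rw [this]
      exact add_mem iha ihb
    | smul c a iha =>
      have : algebraMap K _ c * a - algebraMap K _ (ε (algebraMap K _ c * a)) =
          algebraMap K _ c * (a - algebraMap K _ (ε a)) := by
        rw [map_mul, AlgHom.commutes, map_mul, Algebra.algebraMap_self_apply]; ring
      rw [this]
      exact T.mul_mem_left _ iha
  have h3 := h2 a
  rwa [ha, map_zero, sub_zero] at h3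

/-! ### Power series coordinates at a closed point of a toric variety -/

open MvPowerSeries in
/-- The expansion of the characters at a closed point with coordinates `lam`. -/
theorem exists_toricExpansion (lam : Fin d → K) (hlam : ∀ i : Fin d, n ≤ i.val → lam i ≠ 0) :
    ∃ Ψ : ToricRing K d n →ₐ[K] MvPowerSeries (Fin d) K, ∀ i,
      (lam i = 0 → Ψ (toricChar K (toricBasis d n i)) = X i) ∧
      (lam i ≠ 0 → Ψ (toricChar K (toricBasis d n i)) = C (lam i) * (1 + X i)) := by
  classical
  have hunit : ∀ i, lam i ≠ 0 → IsUnit (C (lam i) * (1 + X i) : MvPowerSeries (Fin d) K) := by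
    intro i hi
    rw [isUnit_iff_constantCoeff]
    simpa using hi
  let w : Fin d → ℤ → MvPowerSeries (Fin d) K := fun i z =>
    if h : lam i = 0 then X i ^ z.toNat else (((hunit i h).unit ^ z : (MvPowerSeries (Fin d) K)ˣ) : _)
  have w0 : ∀ i, w i 0 = 1 := by
    intro i
    by_cases h : lam i = 0
    · simp [w, h]
    · simp [w, h]
  have wadd : ∀ i (s t : toricMonoid d n), w i (s.1 i + t.1 i) = w i (s.1 i) * w i (t.1 i) := by
    intro i s t
    by_cases h : lam i = 0
    · have hi : i.val < n := by
        by_contra hi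
        exact hlam i (not_lt.mp hi) h
      simp only [w, h, dite_true]
      rw [Int.toNat_add (s.2 i hi) (t.2 i hi), pow_add]
    · simp only [w, h, dite_false]
      rw [zpow_add, Units.val_mul]
  let F : Multiplicative (toricMonoid d n) →* MvPowerSeries (Fin d) K :=
    { toFun := fun s => ∏ i, w i (s.toAdd.1 i)
      map_one' := Finset.prod_eq_one fun i _ => w0 i
      map_mul' := fun s t => by
        rw [← Finset.prod_mul_distrib]
        exact Finset.prod_congr rfl fun i _ => wadd i _ _ }
  refine ⟨AddMonoidAlgebra.lift K _ _ F, fun i => ?_⟩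
  rw [toricChar, AddMonoidAlgebra.lift_single, one_smul]
  have h1 : F (.ofAdd (toricBasis d n i)) = w i 1 := by
    change ∏ j, w j ((Pi.single i 1 : Fin d → ℤ) j) = _
    rw [Finset.prod_eq_single i]
    · rw [Pi.single_eq_same]
    · intro j _ hj
      rw [Pi.single_eq_of_ne hj, w0]
    · simp
  rw [h1]
  exact ⟨fun h => by simp [w, h], fun h => by simp [w, h]⟩

end Toric

end ToroidalNP

namespace ToroidalNP

/-! ### Formal charts at closed points of toric varieties -/

section ToricChart

open MvPowerSeries

variable {K : Type u} [Field K] {d n : ℕ}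

theorem exists_X_dvd_of_dvd_prod (T : Finset (Fin d)) {φ : MvPowerSeries (Fin d) K}
    (hφ : φ ∣ ∏ i ∈ T, X i) (h0 : constantCoeff φ = 0) : ∃ i ∈ T, X i ∣ φ := by
  classical
  obtain ⟨ψ, hψ⟩ := hφ
  obtain ⟨t, w, b, c, htw, -, hbc, rfl, -⟩ := mul_eq_mul_prime_prod (x := φ) (y := ψ) (a := 1)
    (s := T) (p := fun i => (X i : MvPowerSeries (Fin d) K)) (fun i _ => powerSeries_X_prime i)
    (by rw [one_mul, hψ])
  rcases t.eq_empty_or_nonempty with rfl | ⟨i, hi⟩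
  · exfalso
    rw [Finset.prod_empty, mul_one] at h0
    have := congrArg constantCoeff hbc
    rw [map_mul, h0, zero_mul, map_one] at this
    exact zero_ne_one this.symm
  · exact ⟨i, htw ▸ Finset.mem_union_left _ hi, (Finset.dvd_prod_of_mem _ hi).mul_left _⟩

theorem linCoeff_eq_of_X_dvd {i : Fin d} {φ : MvPowerSeries (Fin d) K} (h : X i ∣ φ) {k : Fin d}
    (hk : k ≠ i) : linCoeff k φ = 0 := by
  obtain ⟨ψ, rfl⟩ := h
  rw [linCoeff_mul, constantCoeff_X, linCoeff_X, if_neg hk]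
  simp

/-- The map from the coordinate ring of a toric variety to the completed local ring at a point. -/
noncomputable def toricToCompleted (pt : Ideal (ToricRing K d n)) [pt.IsMaximal] :
    ToricRing K d n →+* Completed (Localization.AtPrime pt) :=
  (algebraMap (Localization.AtPrime pt) _).comp (algebraMap _ (Localization.AtPrime pt))

/-- Formal coordinates at a closed point of a nonsingular affine toric variety; `lam` are the
values of the coordinates at the point. -/
structure ToricChart (pt : Ideal (ToricRing K d n)) [pt.IsMaximal] where
  lam : Fin d → K
  lam_ne_zero : ∀ i : Fin d, n ≤ i.val → lam i ≠ 0
  expand : Completed (Localization.AtPrime pt) →+* MvPowerSeries (Fin d) K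
  expand_algebraMap : ∀ c : K, expand (toricToCompleted pt (algebraMap K _ c)) = C c
  expand_basis : ∀ i, lam i = 0 →
    expand (toricToCompleted pt (toricChar K (toricBasis d n i))) = X i
  expand_basis' : ∀ i, lam i ≠ 0 →
    expand (toricToCompleted pt (toricChar K (toricBasis d n i))) = C (lam i) * (1 + X i)
  maximalIdeal_eq : maximalIdeal (Completed (Localization.AtPrime pt)) =
    Ideal.span (Set.range fun i => toricToCompleted pt (toricChar K (toricBasis d n i) -
      algebraMap K _ (lam i)))

/-- A closed point is a character ε. Elements outside `pt` expand to units and `pt` expands into the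
ideal of the variables, so the expansion at the values of ε passes to the localization and then to
the completion. -/
theorem nonempty_toricChart [IsAlgClosed K] (pt : Ideal (ToricRing K d n)) [pt.IsMaximal] :
    Nonempty (ToricChart pt) := by
  obtain ⟨ε, hε⟩ := exists_eval_of_isMaximal pt
  let lam : Fin d → K := fun i => ε (toricChar K (toricBasis d n i))
  have hlam : ∀ i : Fin d, n ≤ i.val → lam i ≠ 0 := fun i hi =>
    ((toricChar_isUnit K i hi).map ε).ne_zero
  obtain ⟨Ψ, hΨ⟩ := exists_toricExpansion (n := n) lam hlam
  have hpt : pt = Ideal.span (Set.range fun i => toricChar K (toricBasis d n i) -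
      algebraMap K _ (lam i)) := by
    refine le_antisymm (fun a ha => span_toricBasis_sub ε a ((hε a).mpr ha)) ?_
    rw [Ideal.span_le]
    rintro _ ⟨i, rfl⟩
    rw [SetLike.mem_coe, ← hε, map_sub, AlgHom.commutes, Algebra.algebraMap_self_apply, sub_self]
  have hpt' : pt ≤ (Ideal.span (Set.range X)).comap Ψ.toRingHom := by
    rw [hpt, Ideal.span_le]
    rintro _ ⟨i, rfl⟩
    rw [SetLike.mem_coe, Ideal.mem_comap]
    change Ψ _ ∈ _
    rw [map_sub, AlgHom.commutes]
    have hX : (X i : MvPowerSeries (Fin d) K) ∈ Ideal.span (Set.range X) :=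
      Ideal.subset_span ⟨i, rfl⟩
    by_cases h : lam i = 0
    · rw [(hΨ i).1 h, h, map_zero, sub_zero]
      exact hX
    · rw [(hΨ i).2 h]
      have : C (lam i) * (1 + X i) - algebraMap K (MvPowerSeries (Fin d) K) (lam i) =
          C (lam i) * X i := by
        rw [MvPowerSeries.algebraMap_apply, Algebra.algebraMap_self_apply]
        ring
      rw [this]
      exact Ideal.mul_mem_left _ _ hX
  have hcc : ∀ a, constantCoeff (Ψ a) = 0 → a ∈ pt := by
    intro a ha
    have h1 : a - algebraMap K _ (ε a) ∈ pt := by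
      rw [← hε, map_sub, AlgHom.commutes, Algebra.algebraMap_self_apply, sub_self]
    have h2 : ∀ x ∈ Ideal.span (Set.range (X : Fin d → MvPowerSeries (Fin d) K)),
        constantCoeff x = 0 := by
      intro x hx
      have : Ideal.span (Set.range (X : Fin d → MvPowerSeries (Fin d) K)) ≤
          RingHom.ker constantCoeff := by
        rw [Ideal.span_le]
        rintro _ ⟨i, rfl⟩
        simp
      exact this hx
    have h3 := h2 _ (hpt' h1)
    change constantCoeff (Ψ (a - algebraMap K _ (ε a))) = 0 at h3
    rw [map_sub, map_sub, ha, AlgHom.commutes, MvPowerSeries.algebraMap_apply,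
      Algebra.algebraMap_self_apply, constantCoeff_C, zero_sub, neg_eq_zero] at h3
    exact (hε a).mp h3
  have hu : ∀ y : pt.primeCompl, IsUnit (Ψ.toRingHom y) := by
    intro y
    rw [isUnit_iff_constantCoeff, isUnit_iff_ne_zero]
    exact fun h => y.2 (hcc _ h)
  let Ψ' : Localization.AtPrime pt →+* MvPowerSeries (Fin d) K := IsLocalization.lift hu
  have hΨ' : ∀ a, Ψ' (algebraMap _ _ a) = Ψ a := fun a => IsLocalization.lift_eq hu a
  have hmax : maximalIdeal (Localization.AtPrime pt) = pt.map (algebraMap _ _) :=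
    (Localization.AtPrime.map_eq_maximalIdeal).symm
  obtain ⟨Θ, hΘ⟩ := exists_completed_lift (Ideal.span (Set.range X)) Ψ' (by
    rw [hmax, Ideal.map_map, Ideal.map_le_iff_le_comap]
    intro a ha
    have := hpt' ha
    rw [Ideal.mem_comap] at this ⊢
    rw [RingHom.comp_apply, hΨ']
    exact this)
  have hΘ' : ∀ a, Θ (toricToCompleted pt a) = Ψ a := fun a => by
    rw [toricToCompleted, RingHom.comp_apply, hΘ, hΨ']
  refine ⟨⟨lam, hlam, Θ, fun c => ?_, fun i hi => ?_, fun i hi => ?_, ?_⟩⟩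
  · rw [hΘ', AlgHom.commutes, MvPowerSeries.algebraMap_apply, Algebra.algebraMap_self_apply]
  · rw [hΘ', (hΨ i).1 hi]
  · rw [hΘ', (hΨ i).2 hi]
  · rw [AdicCompletion.maximalIdeal_eq_map]
    refine (congrArg (Ideal.map _) hmax).trans ?_
    rw [Ideal.map_map]
    refine (congrArg (Ideal.map _) hpt).trans ?_
    rw [Ideal.map_span, ← Set.range_comp]
    rfl

namespace ToricChart

variable {pt : Ideal (ToricRing K d n)} [pt.IsMaximal] (Θ : ToricChart pt)

open Classical in
/-- The nonzero linear coefficient of the expansion of a coordinate. -/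
noncomputable def slope (i : Fin d) : K := if Θ.lam i = 0 then 1 else Θ.lam i

theorem slope_of_ne {i : Fin d} (h : Θ.lam i ≠ 0) : Θ.slope i = Θ.lam i := if_neg h

theorem slope_ne_zero (i : Fin d) : Θ.slope i ≠ 0 := by
  by_cases h : Θ.lam i = 0
  · simp [slope, h]
  · rwa [slope_of_ne _ h]

theorem constantCoeff_basis (i : Fin d) :
    constantCoeff (Θ.expand (toricToCompleted pt (toricChar K (toricBasis d n i)))) = Θ.lam i := by
  by_cases h : Θ.lam i = 0
  · rw [Θ.expand_basis i h, h, constantCoeff_X]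
  · rw [Θ.expand_basis' i h]
    simp

theorem constantCoeff_eq_zero_iff (z : Completed (Localization.AtPrime pt)) :
    constantCoeff (Θ.expand z) = 0 ↔ z ∈ maximalIdeal (Completed (Localization.AtPrime pt)) := by
  constructor
  · intro h hz
    have := ((by simpa using hz : IsUnit z).map Θ.expand).map (constantCoeff (σ := Fin d) (R := K))
    exact this.ne_zero h
  · intro h
    have : maximalIdeal (Completed (Localization.AtPrime pt)) ≤
        RingHom.ker ((constantCoeff (σ := Fin d) (R := K)).comp Θ.expand) := by
      rw [Θ.maximalIdeal_eq, Ideal.span_le]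
      rintro _ ⟨i, rfl⟩
      rw [SetLike.mem_coe, RingHom.mem_ker, RingHom.comp_apply]
      beta_reduce
      rw [map_sub, map_sub, map_sub,
        Θ.constantCoeff_basis, Θ.expand_algebraMap, constantCoeff_C, sub_self]
    exact this h

theorem linCoeff_basis (k i : Fin d) :
    linCoeff k (Θ.expand (toricToCompleted pt (toricChar K (toricBasis d n i)))) =
      if k = i then Θ.slope i else 0 := by
  classical
  by_cases h : Θ.lam i = 0
  · rw [Θ.expand_basis i h, linCoeff_X]
    simp [slope, h]
  · rw [Θ.expand_basis' i h, linCoeff_mul, linCoeff_C, linCoeff_add, linCoeff_one, linCoeff_X]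
    simp [slope, h]

/-- A torus coordinate expands as lam_k (1 + X_k), so the k-th derivative at the point acts on
characters as a logarithmic derivative: additive in s, with value the exponent s_k. -/
theorem linCoeff_char (k : Fin d) (hk : Θ.lam k ≠ 0) (s : toricMonoid d n) :
    linCoeff k (Θ.expand (toricToCompleted pt (toricChar K s))) =
      constantCoeff (Θ.expand (toricToCompleted pt (toricChar K s))) * (s.1 k : K) := by
  classical
  have hb : ∀ i, linCoeff k (Θ.expand (toricToCompleted pt (toricChar K (toricBasis d n i)))) =
      constantCoeff (Θ.expand (toricToCompleted pt (toricChar K (toricBasis d n i)))) *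
        ((toricBasis d n i).1 k : K) := by
    intro i
    rw [Θ.linCoeff_basis, Θ.constantCoeff_basis]
    by_cases h : k = i
    · subst h
      simp [toricBasis, Θ.slope_of_ne hk]
    · simp [toricBasis, h]
  induction s using toricMonoid_induction with
  | zero => rw [toricChar_zero, map_one, map_one, linCoeff_one]; simp
  | add s t hs ht =>
    rw [toricChar_add, map_mul, map_mul, linCoeff_mul, hs, ht, map_mul]
    simp only [AddSubmonoid.coe_add, Pi.add_apply, Int.cast_add]
    ring
  | basis i => exact hb i
  | neg i hi =>
    have h1 : toricChar K (toricBasis d n i) * toricChar K (toricBasisNeg d n i hi) = 1 := by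
      rw [← toricChar_add, toricBasis_add_toricBasisNeg, toricChar_zero]
    have h2 := congrArg (fun z => Θ.expand (toricToCompleted pt z)) h1
    simp only [map_mul, map_one] at h2
    have h3 := congrArg (linCoeff k) h2
    have h4 := congrArg constantCoeff h2
    rw [linCoeff_mul, hb, linCoeff_one] at h3
    rw [map_mul, map_one] at h4
    have h5 : ((toricBasisNeg d n i hi).1 k : K) = -((toricBasis d n i).1 k : K) := by
      have := congrArg (fun s : toricMonoid d n => s.1 k) (toricBasis_add_toricBasisNeg i hi)
      simp only [AddSubmonoid.coe_add, Pi.add_apply, AddSubmonoid.coe_zero, Pi.zero_apply] at this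
      rw [eq_neg_of_add_eq_zero_right this, Int.cast_neg]
    rw [h5]
    set a := constantCoeff (Θ.expand (toricToCompleted pt (toricChar K (toricBasis d n i))))
    have ha : a ≠ 0 := left_ne_zero_of_mul_eq_one h4
    apply mul_left_cancel₀ ha
    linear_combination h3

theorem linCoeff_sum_mul_sub (k : Fin d) (a : Fin d → Completed (Localization.AtPrime pt)) :
    linCoeff k (Θ.expand (∑ i, a i * toricToCompleted pt (toricChar K (toricBasis d n i) -
      algebraMap K _ (Θ.lam i)))) =
      constantCoeff (Θ.expand (a k)) * Θ.slope k := by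
  classical
  rw [map_sum, linCoeff_sum, Finset.sum_eq_single k]
  · rw [map_mul, linCoeff_mul, map_sub, map_sub, linCoeff_sub, map_sub, Θ.expand_algebraMap,
      linCoeff_C, constantCoeff_C, Θ.constantCoeff_basis, Θ.linCoeff_basis]
    simp
  · intro i _ hi
    rw [map_mul, linCoeff_mul, map_sub, map_sub, linCoeff_sub, map_sub, Θ.expand_algebraMap,
      linCoeff_C, constantCoeff_C, Θ.constantCoeff_basis, Θ.linCoeff_basis]
    simp [hi.symm]
  · simp

theorem exists_eq_sum {z : Completed (Localization.AtPrime pt)}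
    (hz : z ∈ maximalIdeal (Completed (Localization.AtPrime pt))) :
    ∃ a : Fin d → Completed (Localization.AtPrime pt),
      z = ∑ i, a i * toricToCompleted pt (toricChar K (toricBasis d n i) -
        algebraMap K _ (Θ.lam i)) := by
  rw [Θ.maximalIdeal_eq, Ideal.mem_span_range_iff_exists_fun] at hz
  obtain ⟨a, ha⟩ := hz
  exact ⟨a, ha.symm⟩

/-- When z is expanded in the translated coordinates, its k-th linear coefficient is the constant
term of the k-th coefficient times a nonzero slope. -/
theorem mem_sq_of_linCoeff_eq_zero {z : Completed (Localization.AtPrime pt)}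
    (hz : z ∈ maximalIdeal (Completed (Localization.AtPrime pt)))
    (h : ∀ k, linCoeff k (Θ.expand z) = 0) :
    z ∈ maximalIdeal (Completed (Localization.AtPrime pt)) ^ 2 := by
  obtain ⟨a, rfl⟩ := Θ.exists_eq_sum hz
  rw [pow_two]
  refine Ideal.sum_mem _ fun i _ => Ideal.mul_mem_mul ?_ ?_
  · have h1 := h i
    rw [Θ.linCoeff_sum_mul_sub] at h1
    rw [← Θ.constantCoeff_eq_zero_iff]
    refine (mul_eq_zero.mp h1).resolve_right ?_
    exact Θ.slope_ne_zero i
  · rw [Θ.maximalIdeal_eq]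
    exact Ideal.subset_span ⟨i, rfl⟩

theorem linCoeff_eq_zero_of_mem_sq (k : Fin d) {z : Completed (Localization.AtPrime pt)}
    (hz : z ∈ maximalIdeal (Completed (Localization.AtPrime pt)) ^ 2) :
    linCoeff k (Θ.expand z) = 0 := by
  refine ToroidalNP.linCoeff_eq_zero_of_mem_sq k
    (I := (maximalIdeal (Completed (Localization.AtPrime pt))).map Θ.expand) ?_ ?_
  · intro φ hφ
    have : (maximalIdeal (Completed (Localization.AtPrime pt))).map Θ.expand ≤
        RingHom.ker (constantCoeff (σ := Fin d) (R := K)) := by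
      rw [Ideal.map_le_iff_le_comap]
      exact fun z hz => (Θ.constantCoeff_eq_zero_iff z).mpr hz
    exact this hφ
  · rw [← Ideal.map_pow]
    exact Ideal.mem_map_of_mem _ hz

theorem map_boundaryIdeal_le (i : Fin d) (hi : Θ.lam i = 0) :
    (boundaryIdeal K d n).map (Θ.expand.comp (toricToCompleted pt)) ≤ Ideal.span {X i} := by
  rw [Ideal.map_le_iff_le_comap]
  have := (Ideal.span_singleton_prime (powerSeries_X_prime (K := K) i).ne_zero).mpr
    (powerSeries_X_prime i)
  refine boundaryIdeal_le _ (s := toricBasis d n i) ?_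
  rw [Ideal.mem_comap, RingHom.comp_apply, Θ.expand_basis i hi]
  exact Ideal.mem_span_singleton_self _

-- Basis characters not vanishing at the point expand to units and can be dropped; those vanishing
-- there all have index below n by `lam_ne_zero`.
open Classical in
theorem prod_X_mem_map_boundaryIdeal :
    ∏ i with Θ.lam i = 0, (X i : MvPowerSeries (Fin d) K) ∈
      (boundaryIdeal K d n).map (Θ.expand.comp (toricToCompleted pt)) := by
  have h1 := Ideal.mem_map_of_mem (Θ.expand.comp (toricToCompleted pt))
    (prod_toricChar_mem_boundaryIdeal (K := K) (d := d) (n := n))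
  refine Ideal.mem_of_dvd _ ?_ h1
  rw [map_prod, ← Finset.prod_filter_mul_prod_filter_not _ (fun i => Θ.lam i = 0)]
  refine (IsUnit.mul_right_dvd ?_).mpr ?_
  · rw [isUnit_iff_constantCoeff, map_prod, isUnit_iff_ne_zero, Finset.prod_ne_zero_iff]
    intro i hi
    rw [RingHom.comp_apply, Θ.constantCoeff_basis]
    exact (Finset.mem_filter.mp hi).2
  · rw [Finset.filter_filter]
    have : (Finset.univ.filter fun i : Fin d => i.val < n ∧ Θ.lam i = 0) =
        Finset.univ.filter fun i => Θ.lam i = 0 := by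
      refine Finset.filter_congr fun i _ => and_iff_right_of_imp fun h => ?_
      by_contra hi
      exact Θ.lam_ne_zero i (not_lt.mp hi) h
    rw [this]
    refine (Finset.prod_congr rfl fun i hi => ?_).dvd
    rw [RingHom.comp_apply, Θ.expand_basis i (Finset.mem_filter.mp hi).2]

end ToricChart

end ToricChart

end ToroidalNP

/-! ### Linear parts of elements of a local ring in a local model -/

namespace ToroidalNP

theorem ringEquiv_mem_maximalIdeal_pow_iff {A B : Type*} [CommRing A] [IsLocalRing A] [CommRing B]
    [IsLocalRing B] (e : A ≃+* B) (n : ℕ) (z : A) :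
    e z ∈ maximalIdeal B ^ n ↔ z ∈ maximalIdeal A ^ n := by
  have h1 := pow_maximalIdeal_le_comap (e : A →+* B) n
  have h2 := pow_maximalIdeal_le_comap (e.symm : B →+* A) n
  refine ⟨fun h => ?_, fun h => h1 h⟩
  have := h2 h
  rw [Ideal.mem_comap] at this
  simpa using this

namespace LocalModel

open MvPowerSeries

variable {K : Type u} [Field K] {R : Type u} [CommRing R] [IsLocalRing R]
  {κ : K →+* R} {I : Ideal R} (M : LocalModel κ I) (Θ : ToricChart M.pt)

/-- The expansion of elements of a local ring in the formal coordinates of a local model. -/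
noncomputable def expand : R →+* MvPowerSeries (Fin M.d) K :=
  (Θ.expand.comp (M.iso : Completed R →+* _)).comp (algebraMap R (Completed R))

theorem expand_apply (r : R) : M.expand Θ r = Θ.expand (M.iso (algebraMap R (Completed R) r)) :=
  rfl

theorem expand_const (c : K) : M.expand Θ (κ c) = C c := by
  rw [expand_apply, M.iso_const]
  exact Θ.expand_algebraMap c

theorem map_expand : I.map (M.expand Θ) =
    (boundaryIdeal K M.d M.n).map (Θ.expand.comp (toricToCompleted M.pt)) := by
  have := congrArg (Ideal.map Θ.expand) M.iso_boundary
  rw [Ideal.map_map, Ideal.map_map, Ideal.map_map, Ideal.map_map] at this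
  exact this

theorem map_expand_le (i : Fin M.d) (hi : Θ.lam i = 0) :
    I.map (M.expand Θ) ≤ Ideal.span {X i} := by
  rw [M.map_expand]
  exact Θ.map_boundaryIdeal_le i hi

open Classical in
theorem prod_X_mem_map_expand :
    ∏ i with Θ.lam i = 0, (X i : MvPowerSeries (Fin M.d) K) ∈ I.map (M.expand Θ) := by
  rw [M.map_expand]
  exact Θ.prod_X_mem_map_boundaryIdeal

variable [IsNoetherianRing R]

theorem constantCoeff_expand_eq_zero_iff (r : R) :
    constantCoeff (M.expand Θ r) = 0 ↔ r ∈ maximalIdeal R := by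
  rw [expand_apply, Θ.constantCoeff_eq_zero_iff]
  have := ringEquiv_mem_maximalIdeal_pow_iff M.iso 1 (algebraMap R (Completed R) r)
  rw [pow_one, pow_one] at this
  rw [this, algebraMap_mem_maximalIdeal_completed_iff]

include M Θ in
theorem exists_sub_const_mem (r : R) : ∃ c : K, r - κ c ∈ maximalIdeal R := by
  refine ⟨constantCoeff (M.expand Θ r), ?_⟩
  rw [← M.constantCoeff_expand_eq_zero_iff Θ, map_sub, map_sub, M.expand_const, constantCoeff_C,
    sub_self]

/-- Cotangent classes are detected by linear parts of expansions; every independence question below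
is settled through this criterion. -/
theorem mem_sq_iff_linCoeff_expand {r : R} (hr : r ∈ maximalIdeal R) :
    r ∈ maximalIdeal R ^ 2 ↔ ∀ k, linCoeff k (M.expand Θ r) = 0 := by
  rw [← algebraMap_mem_maximalIdeal_pow_completed_iff,
    ← ringEquiv_mem_maximalIdeal_pow_iff M.iso]
  refine ⟨fun h k => Θ.linCoeff_eq_zero_of_mem_sq k h, fun h => Θ.mem_sq_of_linCoeff_eq_zero ?_ h⟩
  rwa [← Θ.constantCoeff_eq_zero_iff, ← expand_apply, M.constantCoeff_expand_eq_zero_iff]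

/-- The expansion of a factor of an equation of the boundary has linear part supported on the
boundary coordinates. -/
theorem linCoeff_expand_of_dvd {g u : R} (hI : I = Ideal.span {g})  (hu : u ∈ maximalIdeal R) (hdvd : u ∣ g) (k : Fin M.d) (hk : Θ.lam k ≠ 0) :
    linCoeff k (M.expand Θ u) = 0 := by
  classical
  have h1 := M.prod_X_mem_map_expand Θ
  rw [congrArg (Ideal.map (M.expand Θ)) hI, Ideal.map_span, Set.image_singleton, Ideal.mem_span_singleton] at h1
  obtain ⟨i, hi, h2⟩ := exists_X_dvd_of_dvd_prod _ ((map_dvd (M.expand Θ) hdvd).trans h1)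
    ((M.constantCoeff_expand_eq_zero_iff Θ u).mpr hu)
  refine linCoeff_eq_of_X_dvd h2 ?_
  rintro rfl
  exact hk (Finset.mem_filter.mp hi).2

/-- If the boundary is defined by a monomial in a regular system of parameters, then each formal
boundary coordinate vector is, up to a nonzero scalar, the linear part of one of the parameters
occurring in the monomial. -/
theorem exists_linCoeff_expand {d : ℕ} {v : Fin d → R} (hv : IsRegularParams v) {a : Fin d → ℕ}
    (hI : I = Ideal.span {∏ j, v j ^ a j}) (i : Fin M.d) (hi : Θ.lam i = 0) :
    ∃ j, a j ≠ 0 ∧ linCoeff i (M.expand Θ (v j)) ≠ 0 ∧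
      ∀ k ≠ i, linCoeff k (M.expand Θ (v j)) = 0 := by
  have h1 := M.map_expand_le Θ i hi
  rw [congrArg (Ideal.map (M.expand Θ)) hI, Ideal.map_span, Set.image_singleton, Ideal.span_singleton_le_span_singleton,
    map_prod] at h1
  obtain ⟨j, -, h2⟩ := (powerSeries_X_prime i).exists_mem_finset_dvd h1
  rw [map_pow] at h2
  have h0 : a j ≠ 0 := by
    intro h0
    rw [h0, pow_zero] at h2
    exact (powerSeries_X_prime (K := K) i).not_isUnit (isUnit_of_dvd_one h2)
  have h3 := (powerSeries_X_prime i).dvd_of_dvd_pow h2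
  refine ⟨j, h0, fun h => ?_, fun k hk => linCoeff_eq_of_X_dvd h3 hk⟩
  -- Were the i-th coefficient zero too, the parameter would have no linear part at all, contrary to
  -- independence.
  have h4 : v j ∈ maximalIdeal R ^ 2 := by
    rw [M.mem_sq_iff_linCoeff_expand Θ (hv.mem j)]
    intro k
    by_cases hk : k = i
    · rw [hk, h]
    · exact linCoeff_eq_of_X_dvd h3 hk
  have h5 := hv.cotangentIndependent (Pi.single j 1) (by
    simpa [Pi.single_apply] using h4) j
  rw [Pi.single_eq_same] at h5
  exact (maximalIdeal.isMaximal R).ne_top ((Ideal.eq_top_iff_one _).mpr h5)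

include M Θ in
theorem algebraicIndependent_params [CharZero K] [Algebra K R] (hκ : algebraMap K R = κ) {d : ℕ}
    {v : Fin d → R} (hv : IsRegularParams v) : AlgebraicIndependent K v := by
  let F : R →ₐ[K] MvPowerSeries (Fin M.d) K :=
    { M.expand Θ with
      commutes' := fun c => by
        change M.expand Θ (algebraMap K R c) = _
        rw [hκ, M.expand_const, MvPowerSeries.algebraMap_apply, Algebra.algebraMap_self_apply] }
  refine AlgebraicIndependent.of_comp F (algebraicIndependent_of_linCoeff _ fun c hc => ?_)
  have h1 : ∑ j, κ (c j) * v j ∈ maximalIdeal R ^ 2 := by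
    rw [M.mem_sq_iff_linCoeff_expand Θ (Ideal.sum_mem _ fun j _ => Ideal.mul_mem_left _ _ (hv.mem j))]
    intro k
    rw [map_sum, linCoeff_sum, ← hc k]
    refine Finset.sum_congr rfl fun j _ => ?_
    rw [map_mul, linCoeff_mul, M.expand_const, linCoeff_C, constantCoeff_C]
    simp [F]
  funext j
  have h2 := hv.cotangentIndependent _ h1 j
  rwa [← M.constantCoeff_expand_eq_zero_iff Θ, M.expand_const, constantCoeff_C] at h2

end LocalModel

end ToroidalNP

/-! ### The differential of a toric morphism -/

namespace ToroidalNP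

theorem completedMap_mem_maximalIdeal_pow {R S : Type*} [CommRing R] [IsLocalRing R]
    [IsNoetherianRing R] [CommRing S] [IsLocalRing S] [IsNoetherianRing S] (f : R →+* S)
    [IsLocalHom f] (n : ℕ) {z : Completed R} (hz : z ∈ maximalIdeal (Completed R) ^ n) :
    completedMap f z ∈ maximalIdeal (Completed S) ^ n := by
  rw [mem_maximalIdeal_pow_completed_iff] at hz ⊢
  rw [evalₐ_completedMap, hz, map_zero]

section ToricMap

open MvPowerSeries

variable {K : Type u} [Field K] {d n d' n' : ℕ} {pt : Ideal (ToricRing K d n)} [pt.IsMaximal]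
  {pt' : Ideal (ToricRing K d' n')} [pt'.IsMaximal] (Θ : ToricChart pt) (Ξ : ToricChart pt')
  (γ : toricMonoid d' n' →+ toricMonoid d n) (h : pt' = pt.comap (toricMap K γ))

theorem completedMap_toricToCompleted (x : ToricRing K d' n') :
    completedMap (Localization.localRingHom pt' pt (toricMap K γ) h) (toricToCompleted pt' x) =
      toricToCompleted pt (toricMap K γ x) := by
  rw [toricToCompleted, RingHom.comp_apply, completedMap_algebraMap,
    Localization.localRingHom_to_map]
  rfl

theorem constantCoeff_expand_completedMap (z : Completed (Localization.AtPrime pt')) :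
    constantCoeff (Θ.expand
      (completedMap (Localization.localRingHom pt' pt (toricMap K γ) h) z)) =
      constantCoeff (Ξ.expand z) := by
  set c := constantCoeff (Ξ.expand z) with hc
  have h1 : z - toricToCompleted pt' (algebraMap K _ c) ∈
      maximalIdeal (Completed (Localization.AtPrime pt')) := by
    rw [← Ξ.constantCoeff_eq_zero_iff, map_sub, map_sub, Ξ.expand_algebraMap, constantCoeff_C, hc,
      sub_self]
  have h2 := completedMap_mem_maximalIdeal_pow
    (Localization.localRingHom pt' pt (toricMap K γ) h) 1 (by rwa [pow_one])
  rw [pow_one, ← Θ.constantCoeff_eq_zero_iff, map_sub, completedMap_toricToCompleted,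
    toricMap_algebraMap, map_sub, map_sub, Θ.expand_algebraMap, constantCoeff_C, sub_eq_zero] at h2
  exact h2

include h in
theorem constantCoeff_expand_toricMap (x : ToricRing K d' n') :
    constantCoeff (Θ.expand (toricToCompleted pt (toricMap K γ x))) =
      constantCoeff (Ξ.expand (toricToCompleted pt' x)) := by
  rw [← completedMap_toricToCompleted γ h, constantCoeff_expand_completedMap Θ Ξ]

/-- With a positive exponent at k the character would be divisible by the k-th coordinate, which
vanishes at the point. -/
theorem ToricChart.eq_zero_of_constantCoeff_ne_zero {s : toricMonoid d n}
    (hs : constantCoeff (Θ.expand (toricToCompleted pt (toricChar K s))) ≠ 0) {k : Fin d}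
    (hk : Θ.lam k = 0) : s.1 k = 0 := by
  by_contra h0
  have hkn : k.val < n := by
    by_contra hkn
    exact Θ.lam_ne_zero k (not_lt.mp hkn) hk
  have hpos : 0 < s.1 k := lt_of_le_of_ne (s.2 k hkn) (Ne.symm h0)
  obtain ⟨t, ht⟩ : ∃ t : toricMonoid d n, s = toricBasis d n k + t := by
    refine ⟨⟨s.1 - Pi.single k 1, fun i hi => ?_⟩, ?_⟩
    · by_cases hik : i = k
      · subst hik
        simp only [Pi.sub_apply, Pi.single_eq_same]
        omega
      · simpa [hik] using s.2 i hi
    · ext i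
      simp [toricBasis]
  apply hs
  rw [ht, toricChar_add, map_mul, map_mul, map_mul, Θ.constantCoeff_basis, hk, zero_mul]

/-- In torus directions the differential is the matrix of exponents of γ. The factor lam_j / slope_j
is 1 for a torus coordinate downstairs and 0 for a boundary one, whose pullback is a character
vanishing at the point and so without linear part in torus directions. -/
theorem ToricChart.linCoeff_expand_completedMap (z : Completed (Localization.AtPrime pt'))
    (hz : z ∈ maximalIdeal (Completed (Localization.AtPrime pt'))) (k : Fin d)
    (hk : Θ.lam k ≠ 0) :
    linCoeff k (Θ.expand (completedMap (Localization.localRingHom pt' pt (toricMap K γ) h) z)) =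
      ∑ j, linCoeff j (Ξ.expand z) * (Ξ.lam j / Ξ.slope j) *
        ((γ (toricBasis d' n' j)).1 k : K) := by
  obtain ⟨a, rfl⟩ := Ξ.exists_eq_sum hz
  rw [map_sum, map_sum, linCoeff_sum]
  refine Finset.sum_congr rfl fun j _ => ?_
  have h1 : constantCoeff (Θ.expand (toricToCompleted pt (toricChar K (γ (toricBasis d' n' j))))) =
      Ξ.lam j := by
    rw [← toricMap_toricChar, constantCoeff_expand_toricMap Θ Ξ γ h, Ξ.constantCoeff_basis]
  rw [Ξ.linCoeff_sum_mul_sub, map_mul, map_mul, linCoeff_mul, completedMap_toricToCompleted,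
    map_sub, toricMap_toricChar, toricMap_algebraMap, map_sub, map_sub, map_sub, linCoeff_sub,
    Θ.expand_algebraMap, linCoeff_C, constantCoeff_C, h1, sub_self, zero_mul, add_zero, sub_zero,
    Θ.linCoeff_char k hk, h1, constantCoeff_expand_completedMap Θ Ξ]
  have h2 := Ξ.slope_ne_zero j
  field_simp

include h in
/-- If elements killed by the toric map have no linear part at the point, then the exponents of the
torus coordinates are linearly independent. -/
theorem ToricChart.eq_zero_of_sum_mul_eq_zero [CharZero K]
    (hker : ∀ x, toricMap K γ x = 0 → toricToCompleted pt' x ∈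
      maximalIdeal (Completed (Localization.AtPrime pt')) →
      ∀ k, linCoeff k (Ξ.expand (toricToCompleted pt' x)) = 0)
    (w : Fin d' → K) (hw0 : ∀ j, Ξ.lam j = 0 → w j = 0)
    (hw : ∀ k, Θ.lam k ≠ 0 → ∑ j, w j * ((γ (toricBasis d' n' j)).1 k : K) = 0) : w = 0 := by
  by_contra hne
  obtain ⟨j₀, hj₀⟩ := Function.ne_iff.mp hne
  -- The exponents are integers, so a ℚ-linear functional on K turns the relation into a rational
  -- one, still nontrivial at `j₀`.
  obtain ⟨ψ, hψ⟩ : ∃ ψ : Module.Dual ℚ K, ψ (w j₀) ≠ 0 := by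
    by_contra! hc
    exact hj₀ ((Module.forall_dual_apply_eq_zero_iff ℚ _).mp hc)
  obtain ⟨b, hb⟩ := IsLocalization.exist_integer_multiples (nonZeroDivisors ℤ) Finset.univ
    (fun j => ψ (w j))
  choose m hm using fun j => hb j (Finset.mem_univ j)
  have hb0 : ((b : ℤ) : ℚ) ≠ 0 := by exact_mod_cast nonZeroDivisors.ne_zero b.2
  have hm' : ∀ j, (m j : ℚ) = (b : ℤ) * ψ (w j) := fun j => by
    have := hm j
    simpa using this
  have hm0 : ∀ j, Ξ.lam j = 0 → m j = 0 := fun j hj => by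
    have := hm' j
    rw [hw0 j hj, map_zero, mul_zero] at this
    exact_mod_cast this
  have hmj : m j₀ ≠ 0 := by
    intro h0
    have := hm' j₀
    rw [h0, Int.cast_zero, zero_eq_mul] at this
    exact this.elim hb0 hψ
  -- For a boundary coordinate k upstairs each term vanishes: a torus coordinate downstairs pulls
  -- back to a character not vanishing at the point, whose exponent at k is zero.
  have hrow : ∀ k, ∑ j, m j * (γ (toricBasis d' n' j)).1 k = 0 := by
    intro k
    by_cases hk : Θ.lam k = 0
    · refine Finset.sum_eq_zero fun j _ => ?_
      by_cases hj : Ξ.lam j = 0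
      · rw [hm0 j hj, zero_mul]
      · rw [Θ.eq_zero_of_constantCoeff_ne_zero _ hk, mul_zero]
        rwa [← toricMap_toricChar, constantCoeff_expand_toricMap Θ Ξ γ h, Ξ.constantCoeff_basis]
    · have h1 := congrArg ψ (hw k hk)
      rw [map_zero, map_sum] at h1
      have h2 : ∑ j, (m j : ℚ) * ((γ (toricBasis d' n' j)).1 k : ℚ) = 0 := by
        rw [← mul_zero ((b : ℤ) : ℚ), ← h1, Finset.mul_sum]
        refine Finset.sum_congr rfl fun j _ => ?_
        have h3 : w j * ((γ (toricBasis d' n' j)).1 k : K) =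
            ((γ (toricBasis d' n' j)).1 k : ℚ) • w j := by
          rw [Rat.smul_def, Rat.cast_intCast, mul_comm]
        rw [hm', h3, map_smul, smul_eq_mul]
        ring
      exact_mod_cast h2
  -- The positive and negative parts of m both lie in the monoid, and `hrow` says that γ identifies
  -- them.
  let sp : toricMonoid d' n' := ∑ j, (m j).toNat • toricBasis d' n' j
  let sm : toricMonoid d' n' := ∑ j, (-m j).toNat • toricBasis d' n' j
  have hcoord : ∀ (c : Fin d' → ℕ) (i : Fin d'),
      (∑ j, c j • toricBasis d' n' j : toricMonoid d' n').1 i = c i := by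
    intro c i
    rw [AddSubmonoid.coe_finsetSum, Finset.sum_apply, Finset.sum_eq_single i]
    · simp [toricBasis]
    · intro j _ hj
      simp [toricBasis, hj.symm]
    · simp
  have hγ : γ sp = γ sm := by
    ext k
    rw [← sub_eq_zero, ← hrow k]
    simp only [sp, sm, map_sum, map_nsmul]
    rw [AddSubmonoid.coe_finsetSum, AddSubmonoid.coe_finsetSum, Finset.sum_apply,
      Finset.sum_apply, ← Finset.sum_sub_distrib]
    refine Finset.sum_congr rfl fun j _ => ?_
    simp only [AddSubmonoidClass.coe_nsmul, Pi.smul_apply, nsmul_eq_mul, ← sub_mul]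
    congr 1
    omega
  have hne : constantCoeff (Ξ.expand (toricToCompleted pt' (toricChar K sp))) ≠ 0 := by
    refine Finset.sum_induction (M := toricMonoid d' n') _
      (fun s => constantCoeff (Ξ.expand (toricToCompleted pt' (toricChar K s))) ≠ 0) ?_ ?_ ?_
    · intro s t hs ht
      rw [toricChar_add, map_mul, map_mul, map_mul]
      exact mul_ne_zero hs ht
    · rw [toricChar_zero, map_one, map_one, map_one]
      exact one_ne_zero
    · intro j _
      by_cases hj : Ξ.lam j = 0
      · rw [hm0 j hj, Int.toNat_zero, zero_smul, toricChar_zero, map_one, map_one, map_one]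
        exact one_ne_zero
      · generalize (m j).toNat = c
        induction c with
        | zero =>
          rw [zero_smul, toricChar_zero, map_one, map_one, map_one]
          exact one_ne_zero
        | succ c ih =>
          rw [succ_nsmul, toricChar_add, map_mul, map_mul, map_mul, Ξ.constantCoeff_basis]
          exact mul_ne_zero ih hj
  have heq : constantCoeff (Ξ.expand (toricToCompleted pt' (toricChar K sp))) =
      constantCoeff (Ξ.expand (toricToCompleted pt' (toricChar K sm))) := by
    rw [← constantCoeff_expand_toricMap Θ Ξ γ h, ← constantCoeff_expand_toricMap Θ Ξ γ h,
      toricMap_toricChar, toricMap_toricChar, hγ]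
  have hj₀' : Ξ.lam j₀ ≠ 0 := fun hj => hj₀ (hw0 j₀ hj)
  -- The difference of the two characters pulls back to zero, yet its linear coefficient at `j₀` is
  -- a nonzero constant times m at `j₀`.
  have h1 := hker (toricChar K sp - toricChar K sm)
    (by rw [map_sub, toricMap_toricChar, toricMap_toricChar, hγ, sub_self])
    (by rw [← Ξ.constantCoeff_eq_zero_iff, map_sub, map_sub, map_sub, heq, sub_self]) j₀
  rw [map_sub, map_sub, linCoeff_sub, Ξ.linCoeff_char _ hj₀', Ξ.linCoeff_char _ hj₀', ← heq,
    ← mul_sub, hcoord, hcoord] at h1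
  have h2 := (mul_eq_zero.mp h1).resolve_left hne
  apply hmj
  have h3 : ((m j₀).toNat : ℤ) - ((-m j₀).toNat : ℤ) = 0 := by exact_mod_cast h2
  omega

end ToricMap

end ToroidalNP

/-! ### The local structure of a toroidal morphism -/

namespace ToroidalNP

theorem sum_dite_eq_sum_subtype {ι A : Type*} [Fintype ι] [AddCommMonoid A] (p : ι → Prop)
    [DecidablePred p] (g : {i // p i} → A) :
    ∑ l, (if h : p l then g ⟨l, h⟩ else 0) = ∑ x, g x := by
  symm
  refine Fintype.sum_of_injective Subtype.val Subtype.val_injective _ _ (fun i hi => ?_)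
    (fun i => by simp [i.2])
  rw [dif_neg]
  exact fun h => hi ⟨⟨i, h⟩, rfl⟩

theorem exists_prod_pow_eq {S : Type*} [CommRing S] {d : ℕ} (z : Fin d → S) {ι : Type*} [Fintype ι]
    (y : ι → S) (b : ι → ℕ) (hy : ∀ i, b i ≠ 0 → ∃ l, z l = y i) :
    ∃ a : Fin d → ℕ, ∏ i, y i ^ b i = ∏ l, z l ^ a l := by
  classical
  refine Finset.prod_induction _ (fun x => ∃ a : Fin d → ℕ, x = ∏ l, z l ^ a l) ?_ ?_ ?_
  · rintro _ _ ⟨a, rfl⟩ ⟨a', rfl⟩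
    exact ⟨a + a', by simp [pow_add, Finset.prod_mul_distrib]⟩
  · exact ⟨0, by simp⟩
  · intro i _
    by_cases hi : b i = 0
    · exact ⟨0, by simp [hi]⟩
    · obtain ⟨l, hl⟩ := hy i hi
      refine ⟨Pi.single l (b i), ?_⟩
      rw [Finset.prod_eq_single l]
      · rw [Pi.single_eq_same, hl]
      · intro j _ hj
        rw [Pi.single_eq_of_ne hj, pow_zero]
      · simp

/-- Only the primality of the given factors is used. The powers are unfolded into a product of
repeated primes, and m counts the copies absorbed by x. -/
theorem exists_associated_prod_pow_of_dvd {S : Type*} [CommRing S] [IsDomain S] {ι : Type*}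
    [Fintype ι] {p : ι → S} (hp : ∀ i, Prime (p i)) {n : ι → ℕ} {x : S} (hx : x ∣ ∏ i, p i ^ n i) :
    ∃ m : ι → ℕ, (∀ i, m i ≤ n i) ∧ Associated (∏ i, p i ^ m i) x := by
  classical
  obtain ⟨y, hy⟩ := hx
  have h1 : ∏ i, p i ^ n i = ∏ i ∈ Finset.univ.sigma fun i => Finset.range (n i), p i.1 := by
    rw [Finset.prod_sigma]
    simp
  obtain ⟨t, w, b, c, htw, -, hbc, hxb, -⟩ := mul_eq_mul_prime_prod (x := x) (y := y) (a := 1)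
    (p := fun i : Σ _ : ι, ℕ => p i.1) (fun i _ => hp i.1) (by rw [one_mul, ← h1, hy])
  refine ⟨fun i => (t.filter fun j => j.1 = i).card, fun i => ?_, ?_⟩
  · calc (t.filter fun j => j.1 = i).card ≤ ((Finset.range (n i)).image fun k => (⟨i, k⟩ : Σ _ : ι, ℕ)).card := by
          refine Finset.card_le_card ?_
          rintro ⟨i', k⟩ hj
          rw [Finset.mem_filter] at hj
          obtain ⟨hj, rfl⟩ := hj
          have := htw ▸ Finset.mem_union_left w hj
          rw [Finset.mem_sigma] at this
          exact Finset.mem_image.mpr ⟨k, this.2, rfl⟩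
      _ ≤ n i := Finset.card_image_le.trans (Finset.card_range _).le
  · have h2 : ∏ i, p i ^ (t.filter fun j => j.1 = i).card = ∏ j ∈ t, p j.1 := by
      rw [← Finset.prod_fiberwise t (fun j => j.1)]
      refine Finset.prod_congr rfl fun i _ => ?_
      rw [Finset.prod_congr rfl fun j hj => congrArg p (Finset.mem_filter.mp hj).2,
        Finset.prod_const]
    rw [h2, hxb, mul_comm]
    have hb : IsUnit b := IsUnit.of_mul_eq_one c hbc.symm
    exact (associated_mul_unit_right _ _ hb)

section LocalToroidal

open MvPowerSeries

variable {K : Type u} [Field K] {R S : Type u} [CommRing R] [IsLocalRing R] [CommRing S]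
  [IsLocalRing S] [Algebra K R] [Algebra K S] [Algebra R S] [IsLocalHom (algebraMap R S)]
  {IR : Ideal R} {IS : Ideal S}

/-- A toric morphism between local models inducing a given local homomorphism. -/
structure LocalModel.Hom (N : LocalModel (algebraMap K R) IR) (M : LocalModel (algebraMap K S) IS)
    where
  γ : toricMonoid N.d N.n →+ toricMonoid M.d M.n
  comap_pt : N.pt = M.pt.comap (toricMap K γ)
  comm : ∀ x : Completed R, M.iso (completedMap (algebraMap R S) x) =
    completedMap (Localization.localRingHom N.pt M.pt (toricMap K γ) comap_pt) (N.iso x)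

variable {N : LocalModel (algebraMap K R) IR} {M : LocalModel (algebraMap K S) IS}
  (H : N.Hom M) (Θ : ToricChart M.pt) (Ξ : ToricChart N.pt)
  [IsNoetherianRing R]

theorem LocalModel.Hom.linCoeff_expand_algebraMap {r : R} (hr : r ∈ maximalIdeal R) {k : Fin M.d}
    (hk : Θ.lam k ≠ 0) :
    linCoeff k (M.expand Θ (algebraMap R S r)) =
      ∑ j, linCoeff j (N.expand Ξ r) * (Ξ.lam j / Ξ.slope j) *
        ((H.γ (toricBasis N.d N.n j)).1 k : K) := by
  rw [M.expand_apply, ← completedMap_algebraMap, H.comm,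
    Θ.linCoeff_expand_completedMap Ξ H.γ H.comap_pt _ _ k hk]
  · rfl
  · rwa [← Ξ.constantCoeff_eq_zero_iff, ← N.expand_apply, N.constantCoeff_expand_eq_zero_iff]

variable [IsNoetherianRing S] [CharZero K] [IsScalarTower K R S] [Module.Finite R (Ω[R⁄K])] [IsDomain S]
  [Algebra.EssFiniteType K S] {dR : ℕ} {v : Fin dR → R}

-- Here dominance of the original morphism reaches the toric model, which is not assumed dominant.
-- The element x corresponds to a formal function at q killed by the pullback, and its truncations
-- pull back into higher and higher powers of the maximal ideal.
include H in
theorem LocalModel.Hom.linCoeff_eq_zero_of_toricMap_eq_zero (hv : IsRegularParams v)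
    (hinj : Function.Injective (algebraMap R S)) (x : ToricRing K N.d N.n)
    (hx : toricMap K H.γ x = 0)
    (hx' : toricToCompleted N.pt x ∈ maximalIdeal (Completed (Localization.AtPrime N.pt)))
    (k : Fin N.d) : linCoeff k (Ξ.expand (toricToCompleted N.pt x)) = 0 := by
  set z := N.iso.symm (toricToCompleted N.pt x) with hz
  have hNz : N.iso z = toricToCompleted N.pt x := N.iso.apply_symm_apply _
  choose g hg using fun n => Ideal.Quotient.mk_surjective
    (AdicCompletion.evalₐ (maximalIdeal R) n z)
  have hmem : ∀ n, z - algebraMap R (Completed R) (g n) ∈ maximalIdeal (Completed R) ^ n := by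
    intro n
    rw [mem_maximalIdeal_pow_completed_iff, map_sub, AlgHom.commutes, ← hg, sub_eq_zero]
    rfl
  have hzm : z ∈ maximalIdeal (Completed R) := by
    have := ringEquiv_mem_maximalIdeal_pow_iff N.iso 1 z
    rw [pow_one, pow_one, hNz] at this
    exact this.mp hx'
  have hzS : completedMap (algebraMap R S) z = 0 := by
    apply M.iso.injective
    rw [H.comm, hNz, completedMap_toricToCompleted, hx, map_zero, map_zero]
  have hgS : ∀ n, algebraMap R S (g n) ∈ maximalIdeal S ^ n := by
    intro n
    have := congrArg (AdicCompletion.evalₐ (maximalIdeal S) n) hzS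
    rw [evalₐ_completedMap, ← hg, map_zero, Ideal.quotientMap_mk] at this
    exact Ideal.Quotient.eq_zero_iff_mem.mp this
  have h2 : g 2 ∈ maximalIdeal R ^ 2 := by
    -- The index shift by 2 makes all truncations agree with the initial one modulo the square of
    -- the maximal ideal.
    refine mem_sq_of_forall_mem_pow (K := K) (S := S) hv.1 (N.exists_sub_const_mem Ξ)
      ((N.algebraicIndependent_params Ξ rfl hv).map' (f := IsScalarTower.toAlgHom K R S) hinj)
      (fun n => g (n + 2)) ?_ (fun n => ?_) (fun n => ?_)
    · rw [← algebraMap_mem_maximalIdeal_completed_iff]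
      have := sub_mem hzm (Ideal.pow_le_self two_ne_zero (hmem 2))
      rwa [sub_sub_cancel] at this
    · rw [← algebraMap_mem_maximalIdeal_pow_completed_iff, map_sub]
      have := sub_mem (hmem (0 + 2)) (Ideal.pow_le_pow_right (by omega) (hmem (n + 2)))
      rwa [sub_sub_sub_cancel_left] at this
    · exact Ideal.pow_le_pow_right (by omega) (hgS (n + 2))
  have h3 : z ∈ maximalIdeal (Completed R) ^ 2 := by
    have := add_mem (hmem 2) ((algebraMap_mem_maximalIdeal_pow_completed_iff 2 (g 2)).mpr h2)
    rwa [sub_add_cancel] at this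
  rw [← hNz]
  exact Ξ.linCoeff_eq_zero_of_mem_sq k ((ringEquiv_mem_maximalIdeal_pow_iff N.iso 2 z).mpr h3)

variable {dS : ℕ} {u : Fin dS → S} {a : Fin dR → ℕ} {b : Fin dS → ℕ}

include H Θ Ξ in
/-- The local equations of the boundary upstairs together with the images of the parameters which
do not divide the equation of the boundary downstairs are part of a regular system of
parameters. -/
theorem LocalModel.Hom.cotangentIndependent (hinj : Function.Injective (algebraMap R S))
    (hv : IsRegularParams v) (hu : IsRegularParams u)
    (hIR : IR = Ideal.span {∏ j, v j ^ a j}) (hIS : IS = Ideal.span {∏ j, u j ^ b j}) :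
    CotangentIndependent (Sum.elim (fun i : {i // b i ≠ 0} => u i)
      (fun j : {j // a j = 0} => algebraMap R S (v j))) := by
  classical
  intro c hc
  rw [Fintype.sum_sum_type] at hc
  simp only [Sum.elim_inl, Sum.elim_inr] at hc
  have hfv : ∀ j, algebraMap R S (v j) ∈ maximalIdeal S := fun j =>
    (mem_maximalIdeal _).mpr fun h => hv.mem j (isUnit_of_map_unit (algebraMap R S) _ h)
  -- The residue field is K, so modulo the square of the maximal ideal the coefficients of the
  -- pulled-back v_j may be replaced by constants.
  choose β hβ using fun j : {j // a j = 0} => M.exists_sub_const_mem Θ (c (.inr j))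
  obtain ⟨r, hr⟩ : ∃ r : R, r = ∑ j : {j // a j = 0}, algebraMap K R (β j) * v j := ⟨_, rfl⟩
  have hrm : r ∈ maximalIdeal R :=
    hr ▸ Ideal.sum_mem _ fun j _ => Ideal.mul_mem_left _ _ (hv.mem j)
  have h1 : (∑ i : {i // b i ≠ 0}, c (.inl i) * u i) + algebraMap R S r ∈ maximalIdeal S ^ 2 := by
    have h2 : ∑ j : {j // a j = 0}, (c (.inr j) - algebraMap K S (β j)) * algebraMap R S (v j) ∈
        maximalIdeal S ^ 2 := by
      rw [pow_two]
      exact Ideal.sum_mem _ fun j _ => Ideal.mul_mem_mul (hβ j) (hfv j)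
    have h3 := sub_mem hc h2
    simp only [sub_mul, Finset.sum_sub_distrib] at h3
    rw [add_sub_assoc, sub_sub_cancel] at h3
    rw [hr, map_sum]
    simpa only [map_mul, ← IsScalarTower.algebraMap_apply] using h3
  have hsm : ∀ x ∈ maximalIdeal S ^ 2, ∀ k, linCoeff k (M.expand Θ x) = 0 := fun x hx =>
    (M.mem_sq_iff_linCoeff_expand Θ (Ideal.pow_le_self two_ne_zero hx)).mp hx
  -- The u_i occurring in D have no linear part in torus directions, so the pullback of r has none
  -- either.
  have h2 : ∀ k, Θ.lam k ≠ 0 → linCoeff k (M.expand Θ (algebraMap R S r)) = 0 := by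
    intro k hk
    have h3 := hsm _ h1 k
    rw [map_add, linCoeff_add, map_sum, linCoeff_sum, Finset.sum_eq_zero, zero_add] at h3
    · exact h3
    · intro i _
      rw [map_mul, linCoeff_mul, (M.constantCoeff_expand_eq_zero_iff Θ _).mpr (hu.mem i),
        M.linCoeff_expand_of_dvd Θ hIS (hu.mem i) _ k hk]
      · ring
      · exact (dvd_pow_self _ i.2).trans (Finset.dvd_prod_of_mem _ (Finset.mem_univ _))
  have h3 := Θ.eq_zero_of_sum_mul_eq_zero Ξ H.γ H.comap_pt
    (H.linCoeff_eq_zero_of_toricMap_eq_zero Ξ hv hinj)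
    (fun j => linCoeff j (N.expand Ξ r) * (Ξ.lam j / Ξ.slope j))
    (fun j hj => by rw [hj, zero_div, mul_zero])
    (fun k hk => by rw [← h2 k hk, H.linCoeff_expand_algebraMap Θ Ξ hrm hk])
  have h4 : ∀ j, Ξ.lam j ≠ 0 → linCoeff j (N.expand Ξ r) = 0 := fun j hj =>
    (mul_eq_zero.mp (congrFun h3 j)).resolve_right (div_ne_zero hj (Ξ.slope_ne_zero j))
  -- By `h4` the linear part of r lies in the boundary directions downstairs. Each of these is
  -- spanned by the linear part of some v_σ(i) dividing the equation of E, so r is congruent to a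
  -- combination of the v_σ(i).
  choose σ hσa hσ hσ' using fun i : {i // Ξ.lam i = 0} =>
    N.exists_linCoeff_expand Ξ hv hIR i.1 i.2
  let τ : {i // Ξ.lam i = 0} → K := fun i =>
    linCoeff i (N.expand Ξ r) / linCoeff i.1 (N.expand Ξ (v (σ i)))
  have h5 : r - ∑ i, algebraMap K R (τ i) * v (σ i) ∈ maximalIdeal R ^ 2 := by
    rw [N.mem_sq_iff_linCoeff_expand Ξ (sub_mem hrm
      (Ideal.sum_mem _ fun j _ => Ideal.mul_mem_left _ _ (hv.mem _)))]
    intro k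
    have h6 : ∀ i, linCoeff k (N.expand Ξ (algebraMap K R (τ i) * v (σ i))) =
        τ i * linCoeff k (N.expand Ξ (v (σ i))) := by
      intro i
      rw [map_mul, linCoeff_mul, N.expand_const, linCoeff_C, constantCoeff_C, mul_zero, add_zero]
    rw [map_sub, linCoeff_sub, map_sum, linCoeff_sum]
    rw [Finset.sum_congr rfl fun i _ => h6 i]
    by_cases hk : Ξ.lam k = 0
    · rw [Finset.sum_eq_single ⟨k, hk⟩, div_mul_cancel₀ _ (hσ ⟨k, hk⟩), sub_self]
      · intro i _ hi
        rw [hσ' i k (fun h => hi (Subtype.ext h.symm)), mul_zero]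
      · simp
    · rw [h4 k hk, Finset.sum_eq_zero, sub_zero]
      intro i _
      rw [hσ' i k (fun h => hk (h ▸ i.2)), mul_zero]
  -- The indices with a_j = 0 are disjoint from the values of σ, so independence of v isolates β_j.
  have h6 : ∀ j, β j = 0 := by
    intro j
    have h7 := hv.cotangentIndependent (fun l => (if h : a l = 0 then algebraMap K R (β ⟨l, h⟩)
      else 0) - ∑ i, if σ i = l then algebraMap K R (τ i) else 0) (by
        convert h5 using 1
        simp only [sub_mul, Finset.sum_sub_distrib, Finset.sum_mul, ite_mul, zero_mul]
        congr 1
        · rw [hr, ← sum_dite_eq_sum_subtype]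
          refine Finset.sum_congr rfl fun l _ => ?_
          split_ifs <;> simp
        · rw [Finset.sum_comm]
          simp) j
    simp only [j.2, dite_true] at h7
    rw [Finset.sum_eq_zero, sub_zero, ← N.constantCoeff_expand_eq_zero_iff Ξ, N.expand_const,
      constantCoeff_C] at h7
    · exact h7
    · intro i _
      rw [if_neg]
      intro h
      exact hσa i (h ▸ j.2)
  have h7 : ∀ j, c (.inr j) ∈ maximalIdeal S := by
    intro j
    have := hβ j
    rwa [h6 j, map_zero, sub_zero] at this
  have h8 : ∑ i : {i // b i ≠ 0}, c (.inl i) * u i ∈ maximalIdeal S ^ 2 := by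
    refine (Ideal.add_mem_iff_left _ ?_).mp hc
    rw [pow_two]
    exact Ideal.sum_mem _ fun j _ => Ideal.mul_mem_mul (h7 j) (hfv j)
  rintro (i | j)
  · have := hu.cotangentIndependent (fun l => if h : b l ≠ 0 then c (.inl ⟨l, h⟩) else 0) (by
      convert h8 using 1
      rw [← sum_dite_eq_sum_subtype]
      refine Finset.sum_congr rfl fun l _ => ?_
      split_ifs <;> simp) i
    simpa [i.2] using this
  · exact h7 j

include H in
/-- For a toroidal morphism, the pullback of an ideal generated by part of an adapted regular
system of parameters is monomial in parameters adapted to the boundary upstairs. -/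
theorem LocalModel.Hom.exists_monomial [IsAlgClosed K]
    (hinj : Function.Injective (algebraMap R S))
    (hv : IsRegularParams v) (hu : IsRegularParams u)
    (hIR : IR = Ideal.span {∏ j, v j ^ a j}) (hIS : IS = Ideal.span {∏ j, u j ^ b j})
    (hrad : IS ≤ (IR.map (algebraMap R S)).radical) (J : Finset (Fin dR)) :
    ∃ (d : ℕ) (z : Fin d → S) (a' : Fin d → ℕ) (c : ℕ) (e : Fin c → Fin d → ℕ),
      IsRegularParams z ∧ IS = Ideal.span {∏ j, z j ^ a' j} ∧ c ≤ dR ∧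
      (Ideal.span (v '' (J : Set (Fin dR)))).map (algebraMap R S) =
        Ideal.span (Set.range fun i => ∏ j, z j ^ e i j) := by
  classical
  obtain ⟨Θ⟩ := nonempty_toricChart M.pt
  obtain ⟨Ξ⟩ := nonempty_toricChart N.pt
  have hfv : ∀ j, algebraMap R S (v j) ∈ maximalIdeal S := fun j =>
    (mem_maximalIdeal _).mpr fun h => hv.mem j (isUnit_of_map_unit (algebraMap R S) _ h)
  obtain ⟨d, z, ι, hz, hzι⟩ := CotangentIndependent.exists_isRegularParams hu
    (y := Sum.elim (fun i : {i // b i ≠ 0} => u i)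
      (fun j : {j // a j = 0} => algebraMap R S (v j)))
    (by rintro (i | j); exacts [hu.mem i, hfv j])
    (H.cotangentIndependent Θ Ξ hinj hv hu hIR hIS)
  have hzu : ∀ i, b i ≠ 0 → ∃ l, z l = u i := fun i hi => ⟨ι (.inl ⟨i, hi⟩), hzι _⟩
  obtain ⟨a', ha'⟩ := exists_prod_pow_eq z u b hzu
  have hmon : ∀ j, ∃ m : Fin d → ℕ, Associated (∏ l, z l ^ m l) (algebraMap R S (v j)) := by
    intro j
    by_cases hj : a j = 0
    · obtain ⟨m, hm⟩ := exists_prod_pow_eq z (fun _ : Unit => algebraMap R S (v j)) 1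
        fun _ _ => ⟨ι (.inr ⟨j, hj⟩), hzι _⟩
      refine ⟨m, ?_⟩
      rw [← hm]
      simp
    -- Some power of the equation of D is divisible by the pullback of the equation of E, hence by
    -- that of v_j; so v_j becomes a unit times a monomial in the u_i occurring in D.
    · obtain ⟨e, he⟩ := hrad (hIS ▸ Ideal.mem_span_singleton_self _)
      rw [hIR, Ideal.map_span, Set.image_singleton, Ideal.mem_span_singleton, map_prod,
        ← Finset.prod_pow] at he
      have h1 : algebraMap R S (v j) ∣ ∏ i, u i ^ (b i * e) := by
        refine dvd_trans ?_ (he.trans (by simp [pow_mul]))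
        refine dvd_trans ?_ (Finset.dvd_prod_of_mem _ (Finset.mem_univ j))
        rw [map_pow]
        exact dvd_pow_self _ hj
      obtain ⟨m, hm, hass⟩ := exists_associated_prod_pow_of_dvd (fun i => hu.prime i) h1
      obtain ⟨m', hm'⟩ := exists_prod_pow_eq z u m fun i hi => hzu i fun h0 => hi (by
        have := hm i
        rwa [h0, zero_mul, Nat.le_zero] at this)
      exact ⟨m', hm' ▸ hass⟩
  choose m hm using hmon
  refine ⟨d, z, a', J.card, fun i => m (J.orderEmbOfFin rfl i), hz, by rw [hIS, ha'],
    (Finset.card_le_univ J).trans (Fintype.card_fin _).le, ?_⟩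
  have h1 : (J : Set (Fin dR)) = Set.range (J.orderEmbOfFin rfl) := by simp
  rw [Ideal.map_span, h1, ← Set.range_comp, ← Set.range_comp]
  refine le_antisymm (Ideal.span_le.mpr ?_) (Ideal.span_le.mpr ?_)
  · rintro _ ⟨i, rfl⟩
    exact Ideal.mem_of_dvd _ (hm _).dvd (Ideal.subset_span ⟨i, rfl⟩)
  · rintro _ ⟨i, rfl⟩
    exact Ideal.mem_of_dvd _ (hm _).symm.dvd (Ideal.subset_span ⟨i, rfl⟩)

end LocalToroidal

end ToroidalNP

namespace ToroidalNP

/-! ### Stalks and pullbacks of ideal sheaves -/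

section IdealStalk

variable {X Y : Scheme.{u}}

theorem map_germ_ideal_eq (I : X.IdealSheafData) {p : X} {A B : X.affineOpens} (h : A ≤ B)
    (hp : p ∈ A.1) : (I.ideal B).map (X.presheaf.germ B.1 p (h hp)).hom =
      (I.ideal A).map (X.presheaf.germ A.1 p hp).hom := by
  rw [← I.map_ideal h, Ideal.map_map, ← CommRingCat.hom_comp]
  congr 2
  exact (X.presheaf.germ_res _ _ _).symm

/-- Any two affine neighbourhoods of p contain a common basic open neighbourhood, through which
their stalk ideals agree; so the supremum is attained on each. -/
theorem idealStalk_eq (I : X.IdealSheafData) {p : X} (W : X.affineOpens) (h : p ∈ W.1) :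
    idealStalk I p = (I.ideal W).map (X.presheaf.germ W.1 p h).hom := by
  refine le_antisymm (iSup_le fun W' => iSup_le fun h' => ?_) (le_iSup₂_of_le W h le_rfl)
  obtain ⟨f, g, hfg, hpf⟩ := exists_basicOpen_le_affine_inter W.2 W'.2 p ⟨h, h'⟩
  have hle : X.affineBasicOpen f ≤ W' := by
    change X.basicOpen f ≤ W'.1
    rw [hfg]
    exact X.basicOpen_le g
  exact ((map_germ_ideal_eq I hle hpf).trans
    (map_germ_ideal_eq I (X.affineBasicOpen_le f) hpf).symm).le

theorem exists_affineOpens_mem_le (p : X) (O : X.Opens) (hp : p ∈ O) :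
    ∃ W : X.affineOpens, p ∈ W.1 ∧ W.1 ≤ O := by
  obtain ⟨_, ⟨W, hW, rfl⟩, hpW, hWO⟩ :=
    X.isBasis_affineOpens.exists_subset_of_mem_open hp O.isOpen
  exact ⟨⟨W, hW⟩, hpW, hWO⟩

open Scheme.IdealSheafData in
-- Both sides have the same upper bounds, because `comap` is left adjoint to `map` and on affine
-- schemes `map` is contraction of ideals.
theorem ideal_comap_top_of_isAffine [IsAffine X] [IsAffine Y] (J : Y.IdealSheafData)
    (g : X ⟶ Y) : (J.comap g).ideal ⟨⊤, isAffineOpen_top X⟩ =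
      (J.ideal ⟨⊤, isAffineOpen_top Y⟩).map g.appTop.hom := by
  have h1 : ∀ L : X.IdealSheafData, J.comap g ≤ L ↔
      (J.ideal ⟨⊤, isAffineOpen_top Y⟩).map g.appTop.hom ≤
        L.ideal ⟨⊤, isAffineOpen_top X⟩ := by
    intro L
    rw [← le_map_iff_comap_le, Ideal.map_le_iff_le_comap]
    have h2 : (L.map g).ideal ⟨⊤, isAffineOpen_top Y⟩ =
        (L.ideal ⟨⊤, isAffineOpen_top X⟩).comap g.appTop.hom :=
      ideal_map L g ⟨⊤, isAffineOpen_top Y⟩ (isAffineOpen_top X)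
    rw [← h2]
    exact ⟨fun h => h _, fun h => le_of_isAffine h⟩
  refine le_antisymm ?_ ((h1 _).mp le_rfl)
  set a := (J.ideal ⟨⊤, isAffineOpen_top Y⟩).map g.appTop.hom
  have h3 : (equivOfIsAffine.symm a).ideal ⟨⊤, isAffineOpen_top X⟩ = a :=
    equivOfIsAffine.apply_symm_apply a
  have h4 := (h1 (equivOfIsAffine.symm a)).mpr h3.ge ⟨⊤, isAffineOpen_top X⟩
  rwa [h3] at h4

open Scheme.IdealSheafData in
theorem ideal_comap_ι (I : X.IdealSheafData) (W : X.affineOpens) :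
    haveI : IsAffine W.1.toScheme := W.2
    (I.comap W.1.ι).ideal ⟨⊤, isAffineOpen_top _⟩ = (I.ideal W).map W.1.topIso.inv.hom := by
  have : IsAffine W.1.toScheme := W.2
  rw [ideal_comap_of_isOpenImmersion, Scheme.Opens.topIso_inv]
  refine Eq.trans ?_ (I.map_ideal' (U := ⟨W.1.ι ''ᵁ ⊤, (isAffineOpen_top _).image_of_isOpenImmersion _⟩)
    (V := W) _).symm
  rw [Scheme.Opens.ι_appIso]
  rfl

theorem ideal_comap_eq (I : Y.IdealSheafData) (φ : X ⟶ Y) (W : X.affineOpens) (V : Y.affineOpens)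
    (e : W.1 ≤ φ ⁻¹ᵁ V.1) :
    (I.comap φ).ideal W = (I.ideal V).map (φ.appLE V.1 W.1 e).hom := by
  have : IsAffine W.1.toScheme := W.2
  have : IsAffine V.1.toScheme := V.2
  have h1 : ((I.comap V.1.ι).comap (φ.resLE V.1 W.1 e)) = (I.comap φ).comap W.1.ι := by
    rw [← Scheme.IdealSheafData.comap_comp, ← Scheme.IdealSheafData.comap_comp,
      Scheme.Hom.resLE_comp_ι]
  have h2 := ideal_comap_top_of_isAffine (I.comap V.1.ι) (φ.resLE V.1 W.1 e)
  rw [h1, ideal_comap_ι, ideal_comap_ι, Ideal.map_map, ← CommRingCat.hom_comp] at h2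
  apply_fun Ideal.map W.1.topIso.hom.hom at h2
  have h3 : (V.1.topIso.inv ≫ (φ.resLE V.1 W.1 e).appTop) ≫ W.1.topIso.hom =
      φ.appLE V.1 W.1 e := by
    rw [Scheme.Hom.appTop, Scheme.Hom.resLE_app_top, Iso.inv_hom_id_assoc, Category.assoc,
      Iso.inv_hom_id, Category.comp_id]
  rw [Ideal.map_map, ← CommRingCat.hom_comp, Iso.inv_hom_id, Ideal.map_map,
    ← CommRingCat.hom_comp, h3, CommRingCat.hom_id, Ideal.map_id] at h2
  exact h2

theorem idealStalk_comap (I : Y.IdealSheafData) (φ : X ⟶ Y) (p : X) :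
    idealStalk (I.comap φ) p = (idealStalk I (φ p)).map (φ.stalkMap p).hom := by
  obtain ⟨V, hV, -⟩ := exists_affineOpens_mem_le (φ p) ⊤ trivial
  obtain ⟨W, hW, hWV⟩ := exists_affineOpens_mem_le p (φ ⁻¹ᵁ V.1) hV
  rw [idealStalk_eq _ W hW, idealStalk_eq _ V hV, ideal_comap_eq I φ W V hWV, Ideal.map_map,
    Ideal.map_map, ← CommRingCat.hom_comp, ← CommRingCat.hom_comp]
  congr 2
  rw [Scheme.Hom.germ_stalkMap, Scheme.Hom.appLE, Category.assoc, X.presheaf.germ_res]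

end IdealStalk

end ToroidalNP

namespace ToroidalNP

/-! ### Ideal sheaves from operations commuting with localization -/

section LocalOperation

/-- An operation on ideals of rings commutes with localization of Noetherian domains. -/
def CommutesWithLocalization (Φ : ∀ (A : Type u) [CommRing A], Ideal A → Ideal A) : Prop :=
  ∀ (A B : Type u) [CommRing A] [CommRing B] [Algebra A B] (M : Submonoid A) [IsLocalization M B]
    [IsDomain A] [IsDomain B] [IsNoetherianRing A], M ≤ nonZeroDivisors A → ∀ I : Ideal A,
      (Φ A I).map (algebraMap A B) = Φ B (I.map (algebraMap A B))

theorem commutesWithLocalization_divisorialHull :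
    CommutesWithLocalization fun A (_ : CommRing A) (I : Ideal A) => divisorialHull I :=
  fun _ _ _ _ _ M _ _ _ _ hM I => map_divisorialHull M hM I

theorem commutesWithLocalization_residualIdeal :
    CommutesWithLocalization fun A (_ : CommRing A) (I : Ideal A) => residualIdeal I :=
  fun _ _ _ _ _ M _ _ _ _ hM I => map_residualIdeal M hM I

theorem isLocalization_germ {X : Scheme.{u}} (W : X.affineOpens) {p : X} (hp : p ∈ W.1) :
    letI := (X.presheaf.germ W.1 p hp).hom.toAlgebra
    IsLocalization.AtPrime (X.presheaf.stalk p) (W.2.primeIdealOf ⟨p, hp⟩).asIdeal :=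
  W.2.isLocalization_stalk ⟨p, hp⟩

variable {X : Scheme.{u}} [IsIntegral X] [IsLocallyNoetherian X]
  {Φ : ∀ (A : Type u) [CommRing A], Ideal A → Ideal A}

theorem CommutesWithLocalization.map_germ (hΦ : CommutesWithLocalization Φ) (W : X.affineOpens)
    {p : X} (hp : p ∈ W.1) (I : Ideal Γ(X, W.1)) :
    (Φ _ I).map (X.presheaf.germ W.1 p hp).hom = Φ _ (I.map (X.presheaf.germ W.1 p hp).hom) := by
  have : Nonempty W.1 := ⟨⟨p, hp⟩⟩
  have : IsNoetherianRing Γ(X, W.1) := IsLocallyNoetherian.component_noetherian W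
  let := (X.presheaf.germ W.1 p hp).hom.toAlgebra
  have h1 := isLocalization_germ W hp
  have h2 : (W.2.primeIdealOf ⟨p, hp⟩).asIdeal.primeCompl ≤ nonZeroDivisors Γ(X, W.1) :=
    Ideal.primeCompl_le_nonZeroDivisors _
  exact hΦ Γ(X, W.1) (X.presheaf.stalk p) _ h2 I

theorem CommutesWithLocalization.map_basicOpen (hΦ : CommutesWithLocalization Φ)
    (W : X.affineOpens) (f : Γ(X, W.1)) (I : Ideal Γ(X, W.1)) :
    (Φ _ I).map (X.presheaf.map (homOfLE (X.basicOpen_le f)).op).hom =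
      Φ _ (I.map (X.presheaf.map (homOfLE (X.basicOpen_le f)).op).hom) := by
  by_cases hf : Nonempty (X.basicOpen f)
  · obtain ⟨p, hp⟩ := hf
    have hne : Nonempty (X.basicOpen f) := ⟨⟨p, hp⟩⟩
    have : Nonempty W.1 := ⟨⟨p, X.basicOpen_le f hp⟩⟩
    have : IsNoetherianRing Γ(X, W.1) := IsLocallyNoetherian.component_noetherian W
    have h1 := W.2.isLocalization_basicOpen f
    refine hΦ Γ(X, W.1) Γ(X, X.basicOpen f) (Submonoid.powers f)
      (powers_le_nonZeroDivisors_of_noZeroDivisors ?_) I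
    rintro rfl
    rw [X.basicOpen_zero] at hp
    exact hp
  -- An empty basic open set has the zero ring of sections, which is not a domain, so localization
  -- of domains does not apply there.
  · have h1 : X.basicOpen f = ⊥ := by
      rw [eq_bot_iff]
      exact fun p hp => (hf ⟨⟨p, hp⟩⟩).elim
    have : Subsingleton Γ(X, X.basicOpen f) := by
      rw [h1]
      infer_instance
    ext x
    rw [Subsingleton.elim x 0]
    simp

/-- The ideal sheaf obtained by applying to the sections of an ideal sheaf an operation on ideals
which commutes with localization. -/
def mapIdealSheaf (hΦ : CommutesWithLocalization Φ) (I : X.IdealSheafData) : X.IdealSheafData where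
  ideal W := Φ _ (I.ideal W)
  map_ideal_basicOpen W f := by
    rw [hΦ.map_basicOpen, I.map_ideal_basicOpen W f]
    rfl

theorem idealStalk_mapIdealSheaf (hΦ : CommutesWithLocalization Φ) (I : X.IdealSheafData) (p : X) :
    idealStalk (mapIdealSheaf hΦ I) p = Φ _ (idealStalk I p) := by
  obtain ⟨W, hW, -⟩ := exists_affineOpens_mem_le p ⊤ trivial
  rw [idealStalk_eq _ W hW, idealStalk_eq _ W hW]
  exact hΦ.map_germ W hW _

end LocalOperation

/-! ### Supports and specialization -/

section Support

variable {X : Scheme.{u}}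

theorem mem_support_iff_idealStalk_ne_top (I : X.IdealSheafData) (p : X) :
    p ∈ I.support ↔ idealStalk I p ≠ ⊤ := by
  obtain ⟨W, hW, -⟩ := exists_affineOpens_mem_le p ⊤ trivial
  rw [Scheme.IdealSheafData.mem_support_iff_of_mem hW, idealStalk_eq _ W hW,
    Scheme.mem_zeroLocus_iff]
  have hu : ∀ f : Γ(X, W.1), p ∈ X.basicOpen f ↔ IsUnit (X.presheaf.germ W.1 p hW f) :=
    fun f => X.mem_basicOpen _ _ hW
  constructor
  · intro h htop
    have : (I.ideal W).map (X.presheaf.germ W.1 p hW).hom ≤ maximalIdeal _ := by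
      rw [Ideal.map_le_iff_le_comap]
      intro f hf
      rw [Ideal.mem_comap, mem_maximalIdeal]
      exact fun hf' => h f hf ((hu f).mpr hf')
    rw [htop, top_le_iff] at this
    exact (maximalIdeal.isMaximal _).ne_top this
  · intro h f hf hfp
    exact h (Ideal.eq_top_of_isUnit_mem _ (Ideal.mem_map_of_mem _ hf) ((hu f).mp hfp))

/-- Carries identities between stalk ideals from a closed point to all its generizations. -/
theorem map_stalkSpecializes_idealStalk (I : X.IdealSheafData) {p q : X} (h : p ⤳ q) :
    (idealStalk I q).map (X.presheaf.stalkSpecializes h).hom = idealStalk I p := by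
  obtain ⟨W, hW, -⟩ := exists_affineOpens_mem_le q ⊤ trivial
  have hpW : p ∈ W.1 := h.mem_open W.1.isOpen hW
  rw [idealStalk_eq _ W hW, idealStalk_eq _ W hpW, Ideal.map_map, ← CommRingCat.hom_comp,
    X.presheaf.germ_stalkSpecializes]

end Support

end ToroidalNP

/-! ### Dominance, finiteness and dimension of stalks -/

namespace ToroidalNP

/-- If g pulls back to zero, the image of φ misses the basic open set of g; that set is empty by
density, so g = 0 by integrality. -/
theorem stalkMap_injective_of_isDominant {X Y : Scheme.{u}} [IsIntegral X] [IsIntegral Y]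
    (φ : X ⟶ Y) [IsDominant φ] (p : X) : Function.Injective (φ.stalkMap p).hom := by
  obtain ⟨W, hW, -⟩ := exists_affineOpens_mem_le (φ p) ⊤ trivial
  refine W.2.stalkMap_injective φ p hW fun g hg => ?_
  rw [Scheme.Hom.germ_stalkMap_apply] at hg
  have hp : p ∈ φ ⁻¹ᵁ W.1 := hW
  have h1 : φ.app W.1 g = 0 := germ_injective_of_isIntegral X p hp (by rw [hg, map_zero])
  have h2 : φ ⁻¹ᵁ Y.basicOpen g = ⊥ := by
    rw [Scheme.preimage_basicOpen, h1, Scheme.basicOpen_zero]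
  have h3 : g = 0 := by
    rw [← basicOpen_eq_bot_iff, eq_bot_iff]
    intro y hy
    obtain ⟨x, hx⟩ := (IsDominant.denseRange (f := φ)).exists_mem_open (Y.basicOpen g).isOpen ⟨y, hy⟩
    have : x ∈ φ ⁻¹ᵁ Y.basicOpen g := hx
    rw [h2] at this
    exact this.elim
  rw [h3, map_zero]

section StalkConst

variable {K : Type u} [Field K] {X Y : Scheme.{u}}

theorem stalkMap_comp_stalkConst (sX : X ⟶ Spec (CommRingCat.of K))
    (sY : Y ⟶ Spec (CommRingCat.of K)) (φ : X ⟶ Y) (h : φ ≫ sY = sX) (p : X) :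
    (φ.stalkMap p).hom.comp (stalkConst sY (φ p)) = stalkConst sX p := by
  subst h
  ext c
  simp only [stalkConst, RingHom.comp_apply, Scheme.Hom.comp_appTop, CommRingCat.hom_comp]
  exact Scheme.Hom.germ_stalkMap_apply φ ⊤ p trivial _

theorem essFiniteType_stalkConst (sX : X ⟶ Spec (CommRingCat.of K)) [LocallyOfFiniteType sX]
    (p : X) : letI := (stalkConst sX p).toAlgebra
    Algebra.EssFiniteType K (X.presheaf.stalk p) := by
  obtain ⟨W, hW, -⟩ := exists_affineOpens_mem_le p ⊤ trivial
  have h1 := sX.finiteType_appLE (isAffineOpen_top _) W.2 le_top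
  let κ : K →+* Γ(X, W.1) := (sX.appLE ⊤ W.1 le_top).hom.comp (Scheme.ΓSpecIso (CommRingCat.of K)).inv.hom
  have h2 : κ.FiniteType := h1.comp (RingHom.FiniteType.of_surjective _
    (Scheme.ΓSpecIso (CommRingCat.of K)).commRingCatIsoToRingEquiv.symm.surjective)
  let := κ.toAlgebra
  let := (X.presheaf.germ W.1 p hW).hom.toAlgebra
  let := (stalkConst sX p).toAlgebra
  have : Algebra.FiniteType K Γ(X, W.1) := h2
  have h3 := isLocalization_germ W hW
  have : IsScalarTower K Γ(X, W.1) (X.presheaf.stalk p) := by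
    refine IsScalarTower.of_algebraMap_eq fun c => ?_
    change _ = (X.presheaf.germ W.1 p hW).hom ((X.presheaf.map (homOfLE le_top).op).hom
      (sX.appTop.hom _))
    exact (X.presheaf.germ_res_apply (homOfLE le_top) p hW _).symm
  have : Algebra.EssFiniteType Γ(X, W.1) (X.presheaf.stalk p) :=
    Algebra.EssFiniteType.of_isLocalization _ (W.2.primeIdealOf ⟨p, hW⟩).asIdeal.primeCompl
  exact Algebra.EssFiniteType.comp K Γ(X, W.1) _

end StalkConst

theorem isClosed_singleton_map {K : Type u} [Field K] {X Y : Scheme.{u}}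
    (sX : X ⟶ Spec (CommRingCat.of K)) (sY : Y ⟶ Spec (CommRingCat.of K)) (φ : X ⟶ Y)
    (h : φ ≫ sY = sX) [LocallyOfFiniteType sX] [LocallyOfFiniteType sY] {p : X}
    (hp : IsClosed ({p} : Set X)) : IsClosed ({φ p} : Set Y) := by
  have : JacobsonSpace Y := LocallyOfFiniteType.jacobsonSpace sY
  have : LocallyOfFiniteType (φ ≫ sY) := h ▸ ‹LocallyOfFiniteType sX›
  have := locallyOfFiniteType_of_comp φ sY
  exact φ.closePoints_subset_preimage_closedPoints hp

theorem ringKrullDim_stalk_le_topologicalKrullDim {X : Scheme.{u}} (p : X) :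
    ringKrullDim (X.presheaf.stalk p) ≤ topologicalKrullDim X := by
  rw [ringKrullDim_stalk_eq_coheight]
  let := specializationOrder X
  rw [← Order.coheight_orderIso (irreducibleSetEquivPoints (α := X)).symm p]
  exact Order.coheight_le_krullDim _

end ToroidalNP

namespace ToroidalNP

/-! ### Irreducible components and minimal primes -/

section Components

variable {X : Scheme.{u}}

theorem primeIdealOf_fromSpec {W : X.Opens} (hA : IsAffineOpen W) (y : PrimeSpectrum Γ(X, W))
    (hy : hA.fromSpec y ∈ W) : hA.primeIdealOf ⟨hA.fromSpec y, hy⟩ = y :=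
  hA.fromSpec.isOpenEmbedding.injective (hA.fromSpec_primeIdealOf _)

theorem specializes_iff_primeIdealOf_le {W : X.Opens} (hA : IsAffineOpen W) {x y : X} (hx : x ∈ W)
    (hy : y ∈ W) : x ⤳ y ↔ hA.primeIdealOf ⟨x, hx⟩ ≤ hA.primeIdealOf ⟨y, hy⟩ := by
  have h := hA.fromSpec.isOpenEmbedding.isInducing.specializes_iff
    (x := hA.primeIdealOf ⟨x, hx⟩) (y := hA.primeIdealOf ⟨y, hy⟩)
  rw [hA.fromSpec_primeIdealOf, hA.fromSpec_primeIdealOf] at h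
  exact h.trans (PrimeSpectrum.le_iff_specializes _ _).symm

theorem mem_support_iff_ideal_le_primeIdealOf (N : X.IdealSheafData) {W : X.Opens} (hA : IsAffineOpen W) {x : X}
    (hx : x ∈ W) : x ∈ N.support ↔ N.ideal ⟨W, hA⟩ ≤ (hA.primeIdealOf ⟨x, hx⟩).asIdeal := by
  have h1 := hA.fromSpec_image_zeroLocus (N.ideal ⟨W, hA⟩ : Set Γ(X, W))
  have h2 : x ∈ X.zeroLocus (N.ideal ⟨W, hA⟩ : Set Γ(X, W)) ∩ W ↔
      hA.primeIdealOf ⟨x, hx⟩ ∈ PrimeSpectrum.zeroLocus (N.ideal ⟨W, hA⟩ : Set Γ(X, W)) := by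
    rw [← h1]
    have h3 := hA.fromSpec.isOpenEmbedding.injective.mem_set_image
      (s := PrimeSpectrum.zeroLocus (N.ideal ⟨W, hA⟩ : Set Γ(X, W)))
      (a := hA.primeIdealOf ⟨x, hx⟩)
    rwa [hA.fromSpec_primeIdealOf] at h3
  refine (Scheme.IdealSheafData.mem_support_iff_of_mem (U := ⟨W, hA⟩) hx).trans ?_
  exact ⟨fun h => h2.mp ⟨h, hx⟩, fun h => (h2.mpr h).1⟩

variable {T : IrreducibleCloseds X} {η : X}

theorem ideal_vanishingIdeal_toCloseds (hη : IsGenericPoint η (T : Set X)) {W : X.Opens} (hA : IsAffineOpen W)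
    (hW : η ∈ W) : (Scheme.IdealSheafData.vanishingIdeal (toCloseds T)).ideal ⟨W, hA⟩ =
      (hA.primeIdealOf ⟨η, hW⟩).asIdeal := by
  have h1 : (hA.fromSpec ⁻¹' (toCloseds T : Set X)) = closure {hA.primeIdealOf ⟨η, hW⟩} := by
    ext y
    have hy : hA.fromSpec y ∈ W := by
      rw [← SetLike.mem_coe, ← hA.range_fromSpec]
      exact ⟨y, rfl⟩
    refine Iff.trans ?_ ((PrimeSpectrum.le_iff_specializes _ y).trans specializes_iff_mem_closure)
    rw [← congrArg (hA.primeIdealOf ⟨η, hW⟩ ≤ ·) (primeIdealOf_fromSpec hA y hy)]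
    rw [← specializes_iff_primeIdealOf_le hA hW hy, hη.specializes_iff_mem]
    rfl
  refine (Scheme.IdealSheafData.vanishingIdeal_ideal _ _).trans
    ((congrArg PrimeSpectrum.vanishingIdeal h1).trans ?_)
  rw [PrimeSpectrum.vanishingIdeal_closure, PrimeSpectrum.vanishingIdeal_singleton]

theorem asIdeal_primeIdealOf_mem_minimalPrimes {N : X.IdealSheafData}
    (hT : T ∈ components (N.support : Set X)) (hη : IsGenericPoint η (T : Set X))
    {W : X.Opens} (hA : IsAffineOpen W) (hW : η ∈ W) :
    (hA.primeIdealOf ⟨η, hW⟩).asIdeal ∈ (N.ideal ⟨W, hA⟩).minimalPrimes := by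
  refine ⟨⟨(hA.primeIdealOf ⟨η, hW⟩).2,
    (mem_support_iff_ideal_le_primeIdealOf N hA hW).mp (hT.1 hη.mem)⟩, ?_⟩
  rintro 𝔮 ⟨hq, hNq⟩ hqp
  set y := hA.fromSpec ⟨𝔮, hq⟩
  have hy : y ∈ W := by
    rw [← SetLike.mem_coe, ← hA.range_fromSpec]
    exact ⟨_, rfl⟩
  have hyq : hA.primeIdealOf ⟨y, hy⟩ = ⟨𝔮, hq⟩ := primeIdealOf_fromSpec hA _ hy
  have hyη : y ⤳ η := by
    rw [specializes_iff_primeIdealOf_le hA hy hW, hyq]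
    exact hqp
  have hyN : y ∈ N.support := by
    rw [mem_support_iff_ideal_le_primeIdealOf N hA hy, hyq]
    exact hNq
  have h1 : (⟨closure {y}, isIrreducible_singleton.closure, isClosed_closure⟩ :
      IrreducibleCloseds X) ≤ T := by
    refine hT.2 (closure_minimal (Set.singleton_subset_iff.mpr hyN) N.support.isClosed) ?_
    change (T : Set X) ⊆ closure {y}
    rw [← hη.def]
    exact hyη.closure_subset
  have h2 : η ⤳ y := hη.specializes_iff_mem.mpr (h1 (subset_closure rfl))
  rwa [specializes_iff_primeIdealOf_le hA hW hy, hyq] at h2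

/-- On an affine neighbourhood T is the prime of its generic point, which is minimal over `N` by
maximality of T. Localizing at p preserves minimality and height, and the height is the dimension of
the stalk at the generic point, that is, the codimension of T. -/
theorem idealAt_toCloseds_mem_minimalPrimes {N : X.IdealSheafData}
    (hT : T ∈ components (N.support : Set X)) {p : X} (hp : p ∈ (T : Set X)) :
    idealAt (toCloseds T) p ∈ (idealStalk N p).minimalPrimes ∧
      (idealAt (toCloseds T) p).height = Order.coheight T := by
  obtain ⟨⟨W, hA⟩, hW, -⟩ := exists_affineOpens_mem_le p ⊤ trivial
  let := specializationOrder X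
  set η : X := irreducibleSetEquivPoints T with hηdef
  have hη : IsGenericPoint η (T : Set X) := by
    have := T.2.isGenericPoint_genericPoint_closure
    rwa [T.3.closure_eq] at this
  have hηp : η ⤳ p := hη.specializes_iff_mem.mpr hp
  have hηW : η ∈ W := hηp.mem_open W.isOpen hW
  have hle := (specializes_iff_primeIdealOf_le hA hηW hW).mp hηp
  have hdisj : Disjoint ((hA.primeIdealOf ⟨p, hW⟩).asIdeal.primeCompl : Set Γ(X, W))
      ((hA.primeIdealOf ⟨η, hηW⟩).asIdeal : Set Γ(X, W)) :=
    Set.disjoint_left.mpr fun x hx hx' => hx (hle hx')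
  let := (X.presheaf.germ W p hW).hom.toAlgebra
  have hloc := isLocalization_germ ⟨W, hA⟩ hW
  have heq : idealAt (toCloseds T) p = ((hA.primeIdealOf ⟨η, hηW⟩).asIdeal).map
      (algebraMap Γ(X, W) (X.presheaf.stalk p)) := by
    rw [idealAt, idealStalk_eq _ ⟨W, hA⟩ hW, ideal_vanishingIdeal_toCloseds hη hA hηW]
    rfl
  have hN : idealStalk N p = (N.ideal ⟨W, hA⟩).map (algebraMap Γ(X, W) (X.presheaf.stalk p)) :=
    idealStalk_eq _ ⟨W, hA⟩ hW
  have hunder := IsLocalization.under_map_of_isPrime_disjoint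
    (hA.primeIdealOf ⟨p, hW⟩).asIdeal.primeCompl (X.presheaf.stalk p)
    (hA.primeIdealOf ⟨η, hηW⟩).2 hdisj
  constructor
  · rw [heq, hN, IsLocalization.minimalPrimes_map (hA.primeIdealOf ⟨p, hW⟩).asIdeal.primeCompl,
      Set.mem_preimage, hunder]
    exact asIdeal_primeIdealOf_mem_minimalPrimes hT hη hA hηW
  · rw [heq, IsLocalization.height_map_of_disjoint _ _ hdisj]
    let := (X.presheaf.germ W η hηW).hom.toAlgebra
    have hloc' := isLocalization_germ ⟨W, hA⟩ hηW
    have h1 := IsLocalization.AtPrime.ringKrullDim_eq_height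
      (hA.primeIdealOf ⟨η, hηW⟩).asIdeal (X.presheaf.stalk η)
    rw [ringKrullDim_stalk_eq_coheight] at h1
    have h2 : Order.coheight η = Order.coheight T := Order.coheight_orderIso _ _
    rw [← h2]
    exact_mod_cast h1.symm

end Components

end ToroidalNP

/-! ### From local monomiality to the theorem -/

namespace ToroidalNP

/-- An empty list of monomials gives I = 0, whose residual ideal is the unit ideal with the single
generator 1. This is why k ≤ c is claimed only for a proper residual ideal. -/
theorem IsRegularParams.exists_residualIdeal_eq {R : Type u} [CommRing R] [IsLocalRing R]
    [IsNoetherianRing R] {d : ℕ} {z : Fin d → R} (hz : IsRegularParams z) {c : ℕ}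
    (e : Fin c → Fin d → ℕ) {I : Ideal R}
    (hI : I = Ideal.span (Set.range fun i => ∏ j, z j ^ e i j)) :
    ∃ (k : ℕ) (b : Fin k → Fin d → ℕ), 0 < k ∧
      residualIdeal I = Ideal.span (Set.range fun i => ∏ j, z j ^ b i j) ∧
      (∀ j, ∃ i, b i j = 0) ∧ (divisorialHull I).IsPrincipal ∧
      I = divisorialHull I * residualIdeal I ∧ (residualIdeal I ≠ ⊤ → k ≤ c) := by
  have := hz.isDomain
  rcases Nat.eq_zero_or_pos c with rfl | hc
  · have hI0 : I = ⊥ := by simp [hI]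
    subst hI0
    have h1 : residualIdeal (⊥ : Ideal R) = ⊤ := residualIdeal_of_isPrincipal inferInstance
    refine ⟨1, 0, one_pos, ?_, fun j => ⟨0, rfl⟩, ?_, ?_, fun h => (h h1).elim⟩
    · simp [h1]
    · rw [divisorialHull_bot]
      infer_instance
    · rw [divisorialHull_bot, Ideal.bot_mul]
  · obtain ⟨m, b, h1, h2, h3, h4⟩ := hz.residualIdeal_monomial hc e
    rw [← hI] at h1 h2 h4
    refine ⟨c, b, hc, h2, h3, ?_, ?_, fun _ => le_rfl⟩
    · rw [h1]
      exact ⟨_, rfl⟩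
    · rw [h1, h2]
      exact h4

theorem support_vanishingIdeal {X : Scheme.{u}} (C : Closeds X) :
    (Scheme.IdealSheafData.vanishingIdeal C).support = C :=
  Closeds.ext (Scheme.IdealSheafData.coe_support_vanishingIdeal C)

/-- D is the support of the pullback of the ideal of E, so its vanishing ideal is the radical of
that pullback, and the extension of a radical lies in the radical of the extension. -/
theorem idealAt_le_radical {U V : Scheme.{u}} (φ : U ⟶ V) {D : Closeds U} {E : Closeds V}
    (h : (D : Set U) = φ ⁻¹' (E : Set V)) (p : U) :
    idealAt D p ≤ ((idealAt E (φ p)).map (φ.stalkMap p).hom).radical := by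
  have h1 : D = ((Scheme.IdealSheafData.vanishingIdeal E).comap φ).support := by
    rw [Scheme.IdealSheafData.support_comap, support_vanishingIdeal]
    exact Closeds.ext h
  obtain ⟨W, hW, -⟩ := exists_affineOpens_mem_le p ⊤ trivial
  rw [idealAt, idealAt, ← idealStalk_comap, h1, Scheme.IdealSheafData.vanishingIdeal_support,
    idealStalk_eq _ W hW, idealStalk_eq _ W hW, Scheme.IdealSheafData.radical_ideal]
  exact Ideal.map_radical_le _

theorem pullbackIdealAt_eq_idealStalk {U V : Scheme.{u}} (φ : U ⟶ V) (Z : Closeds V) (p : U) :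
    pullbackIdealAt φ Z p =
      idealStalk ((Scheme.IdealSheafData.vanishingIdeal Z).comap φ) p :=
  (idealStalk_comap _ φ p).symm

theorem idealAt_eq_top {X : Scheme.{u}} {C : Closeds X} {p : X} (hp : p ∉ C) :
    idealAt C p = ⊤ := by
  by_contra h
  rw [idealAt] at h
  rw [← ne_eq, ← mem_support_iff_idealStalk_ne_top,
    support_vanishingIdeal] at h
  exact hp h

section Toroidal

variable {K : Type u} [Field K] [IsAlgClosed K] [CharZero K] {U V : Scheme.{u}}
  {sU : U ⟶ Spec (CommRingCat.of K)} {sV : V ⟶ Spec (CommRingCat.of K)}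
  {φ : U ⟶ V} {D : Closeds U} {E : Closeds V}

theorem IsToroidal.exists_pullbackIdealAt_monomial (hφ : IsToroidal sU sV φ D E)
    (hU : IsNonsingularVariety sU) (hV : IsNonsingularVariety sV) {Z : IrreducibleCloseds V}
    {p : U} (hp : IsClosed ({p} : Set U)) (hpZ : φ p ∈ (Z : Set V))
    (hZ : MakesSNCAt E Z (φ p)) :
    ∃ (d : ℕ) (z : Fin d → U.presheaf.stalk p) (a : Fin d → ℕ) (c : ℕ) (e : Fin c → Fin d → ℕ),
      IsRegularParams z ∧ idealAt D p = Ideal.span {∏ j, z j ^ a j} ∧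
      (c : WithBot ℕ∞) ≤ topologicalKrullDim V ∧
      pullbackIdealAt φ (toCloseds Z) p = Ideal.span (Set.range fun i => ∏ j, z j ^ e i j) := by
  have := hU.isIntegral
  have := hV.isIntegral
  have := hU.locallyOfFiniteType
  have := hV.locallyOfFiniteType
  have := hφ.dominant
  have := hU.regular p
  have := hV.regular (φ p)
  obtain ⟨dR, v, a, J, hv, hE, hJ⟩ := hZ
  obtain ⟨dS, u, b, hu, hD⟩ := hφ.snc_D p hp
  obtain ⟨M, N, γ, h, hcomm⟩ := hφ.model p hp
  let := (stalkConst sU p).toAlgebra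
  let := (stalkConst sV (φ p)).toAlgebra
  let := (φ.stalkMap p).hom.toAlgebra
  have : IsLocalHom (algebraMap (V.presheaf.stalk (φ p)) (U.presheaf.stalk p)) :=
    inferInstanceAs (IsLocalHom (φ.stalkMap p).hom)
  have : IsScalarTower K (V.presheaf.stalk (φ p)) (U.presheaf.stalk p) :=
    IsScalarTower.of_algebraMap_eq' (stalkMap_comp_stalkConst sU sV φ hφ.comp_eq p).symm
  have := essFiniteType_stalkConst sU p
  have := essFiniteType_stalkConst sV (φ p)
  let H : LocalModel.Hom (K := K) (R := V.presheaf.stalk (φ p)) (S := U.presheaf.stalk p)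
    (IR := idealAt E (φ p)) (IS := idealAt D p) N M := ⟨γ, h, hcomm⟩
  obtain ⟨d, z, a', c, e, hz, hDz, hc, he⟩ := H.exists_monomial
    (stalkMap_injective_of_isDominant φ p) hv hu hE hD (idealAt_le_radical φ hφ.preimage_eq p) J
  refine ⟨d, z, a', c, e, hz, hDz, ?_, ?_⟩
  · refine le_trans ?_ (ringKrullDim_stalk_le_topologicalKrullDim (φ p))
    rw [hv.2]
    exact_mod_cast hc
  · rw [pullbackIdealAt, hJ hpZ]
    exact he

theorem IsToroidal.exists_residualIdeal_monomial (hφ : IsToroidal sU sV φ D E)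
    (hU : IsNonsingularVariety sU) (hV : IsNonsingularVariety sV) {Z : IrreducibleCloseds V}
    {p : U} (hp : IsClosed ({p} : Set U))
    (hZ : φ p ∈ (Z : Set V) → MakesSNCAt E Z (φ p)) {I : Ideal (U.presheaf.stalk p)}
    (hI : I = pullbackIdealAt φ (toCloseds Z) p) :
    ∃ (d : ℕ) (z : Fin d → U.presheaf.stalk p) (a : Fin d → ℕ) (k : ℕ) (b : Fin k → Fin d → ℕ),
      IsRegularParams z ∧ idealAt D p = Ideal.span {∏ j, z j ^ a j} ∧ 0 < k ∧
      residualIdeal I = Ideal.span (Set.range fun i => ∏ j, z j ^ b i j) ∧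
      (∀ j, ∃ i, b i j = 0) ∧ (divisorialHull I).IsPrincipal ∧
      I = divisorialHull I * residualIdeal I ∧
      (residualIdeal I ≠ ⊤ → (k : WithBot ℕ∞) ≤ topologicalKrullDim V) := by
  have := hU.isIntegral
  have := hU.regular p
  by_cases hpZ : φ p ∈ (Z : Set V)
  · obtain ⟨d, z, a, c, e, hz, hD, hc, he⟩ :=
      hφ.exists_pullbackIdealAt_monomial hU hV hp hpZ (hZ hpZ)
    obtain ⟨k, b, hk, h1, h2, h3, h4, h5⟩ := hz.exists_residualIdeal_eq e (hI.trans he)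
    exact ⟨d, z, a, k, b, hz, hD, hk, h1, h2, h3, h4, fun h =>
      le_trans (by exact_mod_cast h5 h) hc⟩
  · obtain ⟨d, z, a, hz, hD⟩ := hφ.snc_D p hp
    have hI' : I = ⊤ := by
      rw [hI, pullbackIdealAt, idealAt_eq_top hpZ, Ideal.map_top]
    -- Off Z the pullback is the unit ideal, generated by the monomial with all exponents zero.
    obtain ⟨k, b, hk, h1, h2, h3, h4, -⟩ := hz.exists_residualIdeal_eq (c := 1) 0
      (I := I) (by simp [hI'])
    refine ⟨d, z, a, k, b, hz, hD, hk, h1, h2, h3, h4, fun h => (h ?_).elim⟩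
    rw [hI']
    exact residualIdeal_of_isPrincipal inferInstance

end Toroidal

end ToroidalNP

open ToroidalNP
theorem mainTheorem6 {K : Type u} [Field K] [IsAlgClosed K] [CharZero K] {U V : Scheme.{u}}
    (sU : U ⟶ Spec (CommRingCat.of K)) (sV : V ⟶ Spec (CommRingCat.of K))
    (hU : ToroidalNP.IsNonsingularVariety sU) (hV : ToroidalNP.IsNonsingularVariety sV)
    (φ : U ⟶ V) (D : Closeds U) (E : Closeds V)
    (hφ : ToroidalNP.IsToroidal sU sV φ D E)
    (Z : IrreducibleCloseds V)
    (hZ : ∀ q : V, IsClosed ({q} : Set V) → q ∈ (Z : Set V) →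
      ∃ ℓ ℓ' : ℕ, ToroidalNP.IsSubvarietyAt E Z ℓ ℓ' q) :
    (∃ N : U.IdealSheafData,
      ToroidalNP.IsNonPrincipalIdeal φ (ToroidalNP.toCloseds Z) N ∧
        ToroidalNP.IsSNCSubscheme N) ∧
    ∀ T ∈ ToroidalNP.components
        (ToroidalNP.nonPrincipalLocus φ (ToroidalNP.toCloseds Z)),
      ToroidalNP.MakesSNC D T ∧
        2 ≤ Order.coheight T ∧
        (Order.coheight T : WithBot ℕ∞) ≤ topologicalKrullDim V := by
  have := hU.isIntegral
  have := hU.locallyOfFiniteType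
  have := hV.locallyOfFiniteType
  have : IsLocallyNoetherian U := LocallyOfFiniteType.isLocallyNoetherian sU
  have : JacobsonSpace U := LocallyOfFiniteType.jacobsonSpace sU
  have hreg := hU.regular
  set I := (Scheme.IdealSheafData.vanishingIdeal (toCloseds Z)).comap φ with hIdef
  set F := mapIdealSheaf commutesWithLocalization_divisorialHull I with hFdef
  set N := mapIdealSheaf commutesWithLocalization_residualIdeal I with hNdef
  have hF : ∀ p, idealStalk F p = divisorialHull (idealStalk I p) :=
    idealStalk_mapIdealSheaf _ I
  have hN : ∀ p, idealStalk N p = residualIdeal (idealStalk I p) :=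
    idealStalk_mapIdealSheaf _ I
  have hI : ∀ p, pullbackIdealAt φ (toCloseds Z) p = idealStalk I p :=
    pullbackIdealAt_eq_idealStalk φ (toCloseds Z)
  have key := fun (p : U) (hp : IsClosed ({p} : Set U)) =>
    hφ.exists_residualIdeal_monomial hU hV hp (fun h => by
      obtain ⟨ℓ, ℓ', h⟩ := hZ (φ p) (isClosed_singleton_map sU sV φ hφ.comp_eq hp) h
      exact h.2.1) (hI p).symm
  simp only [← hF, ← hN] at key
  have hfac : ∀ p : U, (idealStalk F p).IsPrincipal ∧
      idealStalk I p = idealStalk F p * idealStalk N p := by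
    intro p
    -- The local result holds at closed points only; every point specializes to one, and the
    -- factorization localizes.
    obtain ⟨q, hq, hqc⟩ := nonempty_inter_closedPoints (Z := closure {p})
      ⟨p, subset_closure rfl⟩ isClosed_closure.isLocallyClosed
    have hpq : p ⤳ q := specializes_iff_mem_closure.mpr hq
    obtain ⟨-, -, -, -, -, -, -, -, -, -, ⟨f, hf⟩, h, -⟩ := key q hqc
    constructor
    · rw [← map_stalkSpecializes_idealStalk F hpq, hf, ← Ideal.span, Ideal.map_span,
        Set.image_singleton]
      exact ⟨_, rfl⟩
    · rw [← map_stalkSpecializes_idealStalk I hpq, ← map_stalkSpecializes_idealStalk F hpq,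
        ← map_stalkSpecializes_idealStalk N hpq, ← Ideal.map_mul, ← h]
  have hsupp : (N.support : Set U) = nonPrincipalLocus φ (toCloseds Z) := by
    ext p
    change p ∈ N.support ↔ ¬ (pullbackIdealAt φ (toCloseds Z) p).IsPrincipal
    rw [mem_support_iff_idealStalk_ne_top, hI, not_iff_not]
    constructor
    · intro h
      rw [(hfac p).2, h, Ideal.mul_top]
      exact (hfac p).1
    · intro h
      rw [hN]
      exact residualIdeal_of_isPrincipal h
  refine ⟨⟨N, ⟨hsupp, F, fun p => ⟨(hfac p).1, (hI p).trans (hfac p).2⟩⟩, ?_⟩, ?_⟩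
  · intro p hp
    obtain ⟨d, z, -, k, b, hz, -, -, h, -⟩ := key p hp
    exact ⟨d, z, k, b, hz, h⟩
  · intro T hT
    rw [← hsupp] at hT
    constructor
    · intro p hp
      obtain ⟨d, z, a, k, b, hz, hD, -, h, -⟩ := key p hp
      by_cases hpT : p ∈ (T : Set U)
      · have h1 := (idealAt_toCloseds_mem_minimalPrimes hT hpT).1
        rw [h] at h1
        obtain ⟨J, hJ⟩ := hz.exists_eq_span_image h1
        exact ⟨d, z, a, J, hz, hD, fun _ => hJ⟩
      · exact ⟨d, z, a, ∅, hz, hD, fun h => (hpT h).elim⟩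
    · obtain ⟨p, hpT, hp⟩ := nonempty_inter_closedPoints T.2.nonempty T.3.isLocallyClosed
      obtain ⟨d, z, a, k, b, hz, hD, hk, h, hb, -, -, hdim⟩ := key p hp
      obtain ⟨h1, h2⟩ := idealAt_toCloseds_mem_minimalPrimes hT hpT
      have hprime := h1.1.1
      -- T passes through p, so the residual ideal is proper there and the bound on the number of
      -- its generators is available.
      have hne : idealStalk N p ≠ ⊤ := fun htop =>
        hprime.ne_top (top_le_iff.mp (htop ▸ h1.1.2))
      rw [h] at h1
      rw [← h2]
      refine ⟨hz.two_le_height hk hb h1.1.2, le_trans ?_ (hdim hne)⟩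
      exact_mod_cast height_le_of_mem_minimalPrimes_span_range h1
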